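/- All graphs are finite and simple. Let $\mathrm{mvc}(G)$ be the minimum cardinality of a vertex cover of $G$. In the eternal vertex cover game, guards occupy a set $S$ of vertices (at most one guard per vertex); when an edge $uv$ is attacked, all guards move in parallel, each staying in place or moving to an adjacent vertex, with no two guards ending on the same vertex and at least one guard moving across $uv$. An eternal vertex cover class is a family of vertex covers of equal cardinality such that from every member, every attack on an edge can be defended by moving to a member of the family; $\mathrm{evc}(G)$ is the minimum cardinality of a member of an eternal vertex cover class. A graph is locally connected if the open neighbourhood of each vertex induces a connected subgraph (an isolated vertex imposes no condition). A block of a connected graph is a maximal biconnected subgraph (on at least three vertices) or a bridge. (1) For every connected, locally connected graph $G$, $\mathrm{evc}(G)\in\{\mathrm{mvc}(G),\mathrm{mvc}(G)+1\}$. (2) Deciding, for a connected, locally connected graph $G$ and an integer $k\ge 0$, whether $\mathrm{evc}(G)\le k$ is in NP; that is, the language of all encodings of pairs $(G,k)$ with $G$ connected and locally connected and $\mathrm{evc}(G)\le k$ ($G$ given by its adjacency matrix, $k$ in binary) is in NP. (3) Let $G$ be a connected graph with at least two vertices in which every block is locally connected. Then $\mathrm{evc}(G)=\mathrm{mvc}(G)$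 if and only if for every vertex $v$ of $G$ that is not a cut vertex there is a minimum vertex cover of $G$ that contains $v$ and all cut vertices of $G$. (4) Deciding whether $\mathrm{evc}(G)=\mathrm{mvc}(G)$ for graphs $G$ as in (3) is in $P^{NP}$; that is, the language of all encodings of graphs $G$ as in (3) with $\mathrm{evc}(G)=\mathrm{mvc}(G)$ is in $P^{NP}$. -/

import Mathlib

namespace SimpleGraph

/-- The guards move in parallel from the configuration `S` to the configuration `T`: the guard
on `x ∈ S` goes to `f x`, which is `x` or a neighbour of `x`, no two guards end on the same vertex,
and at least one guard moves across the attacked edge `uv`. -/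
def Defends {V : Type*} (G : SimpleGraph V) (u v : V) (S T : Set V) (f : V → V) : Prop :=
  Set.BijOn f S T ∧ (∀ x ∈ S, f x = x ∨ G.Adj x (f x)) ∧
    ((u ∈ S ∧ f u = v) ∨ (v ∈ S ∧ f v = u))

/-- An eternal vertex cover class: a family of vertex covers of the same cardinality such that,
from each of them, an attack on any edge can be defended by moving to a member of the family. -/
structure IsEternalVertexCoverClass {V : Type*} (G : SimpleGraph V) (C : Set (Set V)) : Prop where
  isVertexCover : ∀ S ∈ C, G.IsVertexCover S
  encard_eq : ∀ S ∈ C, ∀ T ∈ C, S.encard = T.encard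
  defend : ∀ S ∈ C, ∀ u v : V, G.Adj u v → ∃ T ∈ C, ∃ f : V → V, G.Defends u v S T f

/-- An eternal vertex cover is a member of some eternal vertex cover class. -/
def IsEternalVertexCover {V : Type*} (G : SimpleGraph V) (S : Set V) : Prop :=
  ∃ C : Set (Set V), G.IsEternalVertexCoverClass C ∧ S ∈ C

/-- The eternal vertex cover number, the least cardinality of an eternal vertex cover.
It has values in `ℕ∞`, as `SimpleGraph.vertexCoverNum` has. -/
noncomputable def eternalVertexCoverNum {V : Type*} (G : SimpleGraph V) : ℕ∞ :=
  ⨅ (S : Set V) (_ : G.IsEternalVertexCover S), S.encard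

/-- A vertex cover of minimum cardinality. -/
def IsMinimumVertexCover {V : Type*} (G : SimpleGraph V) (S : Set V) : Prop :=
  G.IsVertexCover S ∧ S.encard = G.vertexCoverNum

/-- `v` is a cut vertex: its deletion separates two other vertices of the same component. -/
def IsCutVertex {V : Type*} (G : SimpleGraph V) (v : V) : Prop :=
  ∃ (u w : V) (hu : u ∈ ({v}ᶜ : Set V)) (hw : w ∈ ({v}ᶜ : Set V)),
    G.Reachable u w ∧ ¬ (G.induce ({v}ᶜ : Set V)).Reachable ⟨u, hu⟩ ⟨w, hw⟩

/-- A biconnected graph: connected, at least three vertices, and no cut vertex. -/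
def IsBiconnected {V : Type*} (G : SimpleGraph V) : Prop :=
  G.Connected ∧ 3 ≤ ENat.card V ∧ ∀ v, ¬ G.IsCutVertex v

/-- `B` is the vertex set of a block: of a maximal biconnected subgraph, or of a bridge.
(Maximal biconnected subgraphs are induced subgraphs.) -/
def IsBlock {V : Type*} (G : SimpleGraph V) (B : Set V) : Prop :=
  Maximal (fun S : Set V => (G.induce S).IsBiconnected) B ∨
    ∃ u v : V, G.Adj u v ∧ G.IsBridge s(u, v) ∧ B = {u, v}

/-- The open neighbourhood of every vertex induces a connected subgraph. (`Preconnected` puts no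
condition on an isolated vertex, whose neighbourhood is empty; among connected graphs this matters
for the one-vertex graph only.) -/
def IsLocallyConnected {V : Type*} (G : SimpleGraph V) : Prop :=
  ∀ v : V, (G.induce (G.neighborSet v)).Preconnected

/-- Every block is a locally connected graph. -/
def HasLocallyConnectedBlocks {V : Type*} (G : SimpleGraph V) : Prop :=
  ∀ B : Set V, G.IsBlock B → (G.induce B).IsLocallyConnected

end SimpleGraph

/-! ### Oracle machines and complexity classes -/

/-- A deterministic oracle machine with input alphabet `α` and an oracle for words over `Bool`.
It is a multi-stack machine (Mathlib's `TM2` model, equivalent to multi-tape Turing machines up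
to a polynomial) with finitely many stacks, finite stack alphabets, finitely many labels and
finitely many internal states. If `query l = some next`, then at the label `l` the machine asks the
oracle about the word on the query stack. It accepts if it halts in an internal state `v` with
`accept v = true`. -/
structure OracleMachine (α : Type) where
  /-- the stacks -/
  K : Type
  [decEqK : DecidableEq K]
  [finK : Finite K]
  /-- the alphabet of each stack -/
  Γ : K → Type
  [finΓ : ∀ k, Finite (Γ k)]
  /-- the labels of the program -/
  Λ : Type
  [finΛ : Finite Λ]
  /-- the internal states -/
  σ : Type
  [finσ : Finite σ]
  /-- the stack that holds the input at the start, first letter on top -/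
  inputStack : K
  /-- the stack symbols that stand for the input letters -/
  inputSymbol : α → Γ inputStack
  /-- the stack that holds the query words, first letter on top -/
  queryStack : K
  /-- how the symbols on the query stack are read by the oracle -/
  querySymbol : Γ queryStack → Bool
  startLabel : Λ
  startState : σ
  program : Λ → Turing.TM2.Stmt Γ Λ σ
  /-- the query labels, with the labels at which the machine goes on after each answer -/
  query : Λ → Option (Bool → Λ)
  accept : σ → Bool

namespace OracleMachine

attribute [instance] OracleMachine.decEqK OracleMachine.finK OracleMachine.finΓ
  OracleMachine.finΛ OracleMachine.finσ

variable {α : Type} (M : OracleMachine α)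

/-- The configurations: current label (or `none` for halted), internal state, stacks. -/
abbrev Cfg : Type := Turing.TM2.Cfg M.Γ M.Λ M.σ

/-- The initial configuration on the input `w`. -/
def init (w : List α) : M.Cfg :=
  ⟨some M.startLabel, M.startState,
    Function.update (fun _ => []) M.inputStack (w.map M.inputSymbol)⟩

open Classical in
/-- One step with the oracle `A`. A query takes one step, moves on according to the answer, and
empties the query stack; at every other label one `TM2` statement is executed. -/
noncomputable def step (A : Set (List Bool)) : M.Cfg → Option M.Cfg
  | ⟨none, _, _⟩ => none
  | ⟨some l, v, S⟩ =>
    match M.query l with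
    | some next =>
      some ⟨some (next (decide ((S M.queryStack).map M.querySymbol ∈ A))), v,
        Function.update S M.queryStack []⟩
    | none => some (Turing.TM2.stepAux (M.program l) v S)

/-- With the oracle `A`, the machine halts on every input `w` after at most `T |w|` steps, and it
accepts exactly the words of `L`. -/
def DecidesInTime (A : Set (List Bool)) (L : Set (List α)) (T : ℕ → ℕ) : Prop :=
  ∀ w : List α, ∃ (v : M.σ) (S : ∀ k, List (M.Γ k)),
    Nonempty (StateTransition.EvalsToInTime (M.step A) (M.init w) (some ⟨none, v, S⟩)
      (T w.length)) ∧ (M.accept v = true ↔ w ∈ L)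

end OracleMachine

/-- The class `P^A`: decidable in polynomial time with the oracle `A`. -/
def InPWithOracle {α : Type} (A : Set (List Bool)) (L : Set (List α)) : Prop :=
  ∃ (M : OracleMachine α) (p : Polynomial ℕ), M.DecidesInTime A L (fun n => p.eval n)

/-- The class `P`: the oracle answers every query with "no", so that it is of no use. -/
def InP {α : Type} (L : Set (List α)) : Prop :=
  InPWithOracle ∅ L

/-- The class `NP`: there are certificates of polynomial length that can be verified in polynomial
time. The input and the certificate are written one after the other, over two disjoint copies of
the alphabet. -/
def InNP (L : Set (List Bool)) : Prop :=
  ∃ (R : Set (List (Bool ⊕ Bool))) (p : Polynomial ℕ), InP R ∧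
    ∀ x : List Bool, x ∈ L ↔
      ∃ y : List Bool, y.length ≤ p.eval x.length ∧ x.map Sum.inl ++ y.map Sum.inr ∈ R

/-- The class `P^NP`: decidable in polynomial time with an oracle from `NP`. -/
def InPNP (L : Set (List Bool)) : Prop :=
  ∃ A : Set (List Bool), InNP A ∧ InPWithOracle A L

open Classical in
/-- The encoding of a graph on `n` labelled vertices: `n` in unary, the delimiter `false`, and the
rows of the adjacency matrix. -/
noncomputable def encodeGraph {n : ℕ} (G : SimpleGraph (Fin n)) : List Bool :=
  List.replicate n true ++ false ::
    (List.finRange n).flatMap fun i => (List.finRange n).map fun j => decide (G.Adj i j)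

/-- The encoding of a graph and a number `k`, which is written in binary, least significant
digit first. -/
noncomputable def encodeGraphNat {n : ℕ} (G : SimpleGraph (Fin n)) (k : ℕ) : List Bool :=
  encodeGraph G ++ k.bits

/-! Game. A vertex `x` outside a vertex cover `S` has its whole neighbourhood in `S`. If the
neighbours of `x` are linked inside that neighbourhood, every walk can be rerouted around `x`, so
`S` induces a connected subgraph (`IsVertexCover.reachIn`). In a connected, locally connected graph
this applies to every vertex cover; if only the blocks are locally connected, it applies to the
covers that contain all cut vertices. On a connected set of guards, a whole row can shift along a
path towards an attacked vertex (`exists_shift`). A fixed minimum cover with one additional roaming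
guard therefore survives all attacks, which gives (1). With only `mvc` guards, an attack on an
unoccupied `v` is answered by moving to a minimum cover `T` through `v` that is as close as possible
to the current cover `S`. By minimality Hall's condition holds between `T \ S` and `S \ T` with one
element to spare (`exists_matching`), so one row of guards shifts towards `v` and the other guards
of `S \ T` cross a matching. Hence the minimum covers containing all cut vertices form an eternal
class as soon as every vertex lies in one of them. Conversely, every vertex lies in a member of a
class, and a minimum cover in a class cannot omit a cut vertex `x`: attacks from `x` into two sides
of `x` would each save a guard on that side, and the two cheaper sides together with `x` would be a
cover that is too small (`IsEternalVertexCoverClass.isCutVertex_mem`). This gives (3).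

Complexity. For a connected, locally connected graph with at least two vertices, `evc ≤ k` holds
exactly if every vertex lies in a vertex cover of size at most `k`
(`IsLocallyConnected.eternalVertexCoverNum_le_iff`); one such cover for each vertex is the
certificate for (2). For (4), an `NP` oracle is asked for each `k` whether the graph is admissible
and each vertex lies in a cover of size at most `k` containing all cut vertices, and whether `mvc <
k`. The answers "yes" and "no" for some `k` mean that `k = mvc` and that the criterion of (3) holds.

Verification in polynomial time is reduced to logic: arithmetic terms with bounded sums are compiled
to register programs, and these to oracle machines (`ATerm.compile_runs`, `Prog.inPWithOracle`), so
a property expressed by a bounded formula is in `P` (`ATerm.inP`). Reachability and binary digits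
are not computed but certified by relations subject to local conditions: orders for connectivity
(`reachIn_of_order`, `exists_order`), a relation for reachability avoiding a vertex (`BlocksCert`),
and a table of digits (`DigitsCert`). -/

namespace SimpleGraph

/-! ### Walks inside a set of vertices. -/

variable {V : Type*} {G : SimpleGraph V} {S T : Set V} {a b c u v w x y z : V}

/-- `a` and `b` are joined by a walk of `G` all of whose vertices lie in `S`. -/
def ReachIn (G : SimpleGraph V) (S : Set V) (a b : V) : Prop :=
  a ∈ S ∧ Relation.ReflTransGen (fun x y => x ∈ S ∧ y ∈ S ∧ G.Adj x y) a b

namespace ReachIn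

theorem refl (h : a ∈ S) : G.ReachIn S a a := ⟨h, .refl⟩

theorem left_mem (h : G.ReachIn S a b) : a ∈ S := h.1

theorem right_mem (h : G.ReachIn S a b) : b ∈ S := by
  rcases h with ⟨ha, h⟩
  cases h with
  | refl => exact ha
  | tail _ h => exact h.2.1

theorem trans (h : G.ReachIn S a b) (h' : G.ReachIn S b c) : G.ReachIn S a c :=
  ⟨h.1, h.2.trans h'.2⟩

theorem symm (h : G.ReachIn S a b) : G.ReachIn S b a :=
  ⟨h.right_mem, by
    replace h := h.2
    induction h with
    | refl => exact .refl
    | tail _ h' ih => exact .head ⟨h'.2.1, h'.1, h'.2.2.symm⟩ ih⟩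

theorem mono (hST : S ⊆ T) (h : G.ReachIn S a b) : G.ReachIn T a b :=
  ⟨hST h.1, Relation.ReflTransGen.mono (fun _ _ h => ⟨hST h.1, hST h.2.1, h.2.2⟩) _ _ h.2⟩

theorem of_adj (ha : a ∈ S) (hb : b ∈ S) (h : G.Adj a b) : G.ReachIn S a b :=
  ⟨ha, .single ⟨ha, hb, h⟩⟩

theorem cons (ha : a ∈ S) (h : G.Adj a b) (h' : G.ReachIn S b c) : G.ReachIn S a c :=
  (of_adj ha h'.1 h).trans h'

theorem tail (h' : G.ReachIn S a b) (h : G.Adj b c) (hc : c ∈ S) : G.ReachIn S a c :=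
  h'.trans (of_adj h'.right_mem hc h)

/-- Induction along a walk inside `S`, adding edges at the front. -/
theorem head_induction {P : V → Prop} (h : G.ReachIn S a b) (base : P b)
    (step : ∀ x y, x ∈ S → y ∈ S → G.Adj x y → G.ReachIn S y b → P y → P x) : P a := by
  obtain ⟨-, h⟩ := h
  induction h using Relation.ReflTransGen.head_induction_on with
  | refl => exact base
  | head h h' ih => exact step _ _ h.1 h.2.1 h.2.2 ⟨h.2.1, h'⟩ ih

/-- Induction along a walk inside `S`, adding edges at the end. -/
theorem tail_induction {P : V → Prop} (h : G.ReachIn S a b) (base : P a)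
    (step : ∀ x y, x ∈ S → y ∈ S → G.Adj x y → G.ReachIn S a x → P x → P y) : P b := by
  obtain ⟨ha, h⟩ := h
  induction h with
  | refl => exact base
  | tail h' h ih => exact step _ _ h.1 h.2.1 h.2.2 ⟨ha, h'⟩ ih

end ReachIn

theorem reachable_iff_reachIn_univ : G.Reachable a b ↔ G.ReachIn Set.univ a b := by
  simp [reachable_iff_reflTransGen, ReachIn]

theorem reachIn_induce_iff {A : Set V} {T : Set A} {a b : A} :
    (G.induce A).ReachIn T a b ↔ G.ReachIn (Subtype.val '' T) a b := by
  constructor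
  · rintro ⟨ha, h⟩
    exact ⟨⟨a, ha, rfl⟩, h.lift Subtype.val fun x y h => ⟨⟨x, h.1, rfl⟩, ⟨y, h.2.1, rfl⟩, h.2.2⟩⟩
  · intro h
    have key : ∀ c : V, G.ReachIn (Subtype.val '' T) a c → ∃ c' : A, c'.1 = c ∧
        (G.induce A).ReachIn T a c' := by
      intro c hc
      refine hc.tail_induction (P := fun c => ∃ c' : A, c'.1 = c ∧ (G.induce A).ReachIn T a c')
        ⟨a, rfl, ReachIn.refl ?_⟩ ?_
      · obtain ⟨a', ha', e⟩ := h.1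
        rwa [← Subtype.ext e]
      · rintro x y - ⟨y', hy', rfl⟩ hxy - ⟨x', rfl, hx'⟩
        exact ⟨y', rfl, hx'.tail hxy hy'⟩
    obtain ⟨c', e, hc'⟩ := key b h
    rwa [← Subtype.ext e]

/-- Statements about induced subgraphs become statements about `V`, where sets can be varied without
change of type. -/
theorem induce_reachable_iff {A : Set V} {a b : A} :
    (G.induce A).Reachable a b ↔ G.ReachIn A a b := by
  rw [reachable_iff_reachIn_univ, reachIn_induce_iff]
  simp

theorem induce_preconnected_iff {A : Set V} :
    (G.induce A).Preconnected ↔ ∀ a ∈ A, ∀ b ∈ A, G.ReachIn A a b := by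
  simp only [Preconnected, induce_reachable_iff, Subtype.forall]

/-! ### Cut vertices, biconnected sets and locally connected blocks. -/

theorem isCutVertex_iff : G.IsCutVertex v ↔
    ∃ u w, u ≠ v ∧ w ≠ v ∧ G.Reachable u w ∧ ¬ G.ReachIn {v}ᶜ u w := by
  simp only [IsCutVertex, induce_reachable_iff]
  constructor
  · rintro ⟨u, w, hu, hw, h⟩
    exact ⟨u, w, hu, hw, h⟩
  · rintro ⟨u, w, hu, hw, h⟩
    exact ⟨u, w, hu, hw, h⟩

/-- The deleted vertex may range over all of `V`, since deleting one outside `S` changes nothing. -/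
theorem induce_isBiconnected_iff : (G.induce S).IsBiconnected ↔
    3 ≤ S.encard ∧ (∀ a ∈ S, ∀ b ∈ S, G.ReachIn S a b) ∧
      ∀ v, ∀ a ∈ S \ {v}, ∀ b ∈ S \ {v}, G.ReachIn (S \ {v}) a b := by
  have hc : ENat.card S = S.encard := rfl
  have himg : ∀ v : S, (Subtype.val '' ({v}ᶜ : Set S)) = S \ {v.1} := by
    intro v
    ext x
    constructor
    · rintro ⟨x, hx, rfl⟩
      exact ⟨x.2, fun h => hx (Subtype.ext h)⟩
    · rintro ⟨hx, hv⟩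
      exact ⟨⟨x, hx⟩, fun h => hv (congrArg Subtype.val h), rfl⟩
  rw [IsBiconnected, hc, connected_iff, induce_preconnected_iff]
  simp only [isCutVertex_iff, reachIn_induce_iff, himg, induce_reachable_iff]
  constructor
  · rintro ⟨⟨h1, h2⟩, h3, h4⟩
    refine ⟨h3, h1, fun v a ha b hb => ?_⟩
    by_cases hv : v ∈ S
    · by_contra hab
      exact h4 ⟨v, hv⟩ ⟨⟨a, ha.1⟩, ⟨b, hb.1⟩, fun h => ha.2 (congrArg Subtype.val h),
        fun h => hb.2 (congrArg Subtype.val h), h1 a ha.1 b hb.1, hab⟩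
    · rw [Set.sdiff_singleton_eq_self hv]
      exact h1 a ha.1 b hb.1
  · rintro ⟨h3, h1, h4⟩
    refine ⟨⟨h1, ?_⟩, h3, ?_⟩
    · rw [Set.nonempty_coe_sort, ← Set.encard_pos]
      exact lt_of_lt_of_le (by norm_num) h3
    · rintro v ⟨a, b, ha, hb, -, hab⟩
      exact hab (h4 v a ⟨a.2, fun h => ha (Subtype.ext h)⟩ b ⟨b.2, fun h => hb (Subtype.ext h)⟩)

/-- Biconnected vertex sets with two common vertices have a biconnected union. -/
theorem IsBiconnected.union {p q : V} (hS : (G.induce S).IsBiconnected)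
    (hT : (G.induce T).IsBiconnected) (hpq : p ≠ q) (hp : p ∈ S ∩ T) (hq : q ∈ S ∩ T) :
    (G.induce (S ∪ T)).IsBiconnected := by
  rw [induce_isBiconnected_iff] at *
  have key : ∀ (A B : Set V) (r : V), r ∈ A → r ∈ B → (∀ a ∈ A, ∀ b ∈ A, G.ReachIn A a b) →
      (∀ a ∈ B, ∀ b ∈ B, G.ReachIn B a b) → ∀ a ∈ A ∪ B, ∀ b ∈ A ∪ B, G.ReachIn (A ∪ B) a b := by
    intro A B r hrA hrB hA hB
    have : ∀ a ∈ A ∪ B, G.ReachIn (A ∪ B) a r := by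
      rintro a (ha | ha)
      · exact (hA a ha r hrA).mono Set.subset_union_left
      · exact (hB a ha r hrB).mono Set.subset_union_right
    exact fun a ha b hb => (this a ha).trans (this b hb).symm
  refine ⟨hS.1.trans (Set.encard_le_encard Set.subset_union_left),
    key S T p hp.1 hp.2 hS.2.1 hT.2.1, fun v => ?_⟩
  rw [Set.union_sdiff_distrib]
  -- At least one of the two common vertices survives the deletion of `v` and links the two parts.
  by_cases hv : p = v
  · subst hv
    exact key _ _ q ⟨hq.1, hpq.symm⟩ ⟨hq.2, hpq.symm⟩ (hS.2.2 p) (hT.2.2 p)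
  · exact key _ _ p ⟨hp.1, hv⟩ ⟨hp.2, hv⟩ (hS.2.2 v) (hT.2.2 v)

/-- Deleting a vertex breaks a path into at most two pieces, and each of them keeps an end of the
path. -/
theorem Walk.IsPath.reachIn_sdiff {u t : V} {p : G.Walk u t} (hp : p.IsPath) (v : V) {w : V}
    (hw : w ∈ p.support) (hwv : w ≠ v) :
    G.ReachIn ({x | x ∈ p.support} \ {v}) w u ∨ G.ReachIn ({x | x ∈ p.support} \ {v}) w t := by
  induction p with
  | nil => simp at hw; subst hw; exact .inl (.refl ⟨by simp, hwv⟩)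
  | @cons u u' t h q ih =>
    rw [Walk.cons_isPath_iff] at hp
    rw [Walk.support_cons, List.mem_cons] at hw
    have hsub : {x | x ∈ q.support} \ {v} ⊆ {x | x ∈ (Walk.cons h q).support} \ {v} :=
      Set.sdiff_subset_sdiff_left fun x hx => by simp [Set.mem_ofPred.mp hx]
    rcases hw with rfl | hw
    · exact .inl (.refl ⟨by simp, hwv⟩)
    · rcases ih hp.1 hw with hr | hr
      · by_cases huv : u = v
        · subst huv
          right
          have hq : {x | x ∈ q.support} \ {u} = {x | x ∈ q.support} :=
            Set.sdiff_singleton_eq_self hp.2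
          rw [hq] at hsub
          refine ReachIn.mono hsub ?_
          have : ∀ {a b : V} (r : G.Walk a b), G.ReachIn {x | x ∈ r.support} a b := by
            intro a b r
            exact induce_reachable_iff (a := ⟨a, r.start_mem_support⟩)
              (b := ⟨b, r.end_mem_support⟩).mp (r.connected_induce_support.preconnected _ _)
          exact (hq ▸ hr).trans (this q)
        · exact .inl ((hr.mono hsub).tail h.symm ⟨by simp, huv⟩)
      · exact .inr (hr.mono hsub)

/-- Two neighbours of `x` that are joined by a walk avoiding `x` lie with `x` on a cycle. -/
theorem exists_isBiconnected (hy : G.Adj x y) (hz : G.Adj x z) (hyz : y ≠ z)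
    (h : G.ReachIn {x}ᶜ y z) :
    ∃ S : Set V, x ∈ S ∧ y ∈ S ∧ z ∈ S ∧ (G.induce S).IsBiconnected := by
  classical
  have hex : ∃ p : G.Walk y z, ∀ w ∈ p.support, w ≠ x := by
    refine h.head_induction (P := fun y => ∃ p : G.Walk y z, ∀ w ∈ p.support, w ≠ x)
      ⟨Walk.nil, by simp [hz.ne.symm]⟩ ?_
    rintro a b ha hb hab - ⟨p, hp⟩
    exact ⟨.cons hab p, by simpa using ⟨ha, hp⟩⟩
  obtain ⟨p, hpx⟩ := hex
  obtain ⟨p, hp, hpx⟩ : ∃ p : G.Walk y z, p.IsPath ∧ ∀ w ∈ p.support, w ≠ x :=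
    ⟨p.bypass, p.bypass_isPath, fun w hw => hpx w (p.support_bypass_subset_support hw)⟩
  set P : Set V := {w | w ∈ p.support} with hP
  have hyP : y ∈ P := p.start_mem_support
  have hzP : z ∈ P := p.end_mem_support
  have hxP : x ∉ P := fun h => hpx x h rfl
  have hPc : ∀ a ∈ P, ∀ b ∈ P, G.ReachIn P a b :=
    induce_preconnected_iff.mp p.connected_induce_support.preconnected
  refine ⟨insert x P, by simp, by simp [hyP], by simp [hzP], ?_⟩
  -- After the deletion of `v ≠ x`, every vertex of the path still reaches an end of the path, and
  -- both ends are adjacent to `x`.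
  have hroot : ∀ v, v ≠ x → ∀ a ∈ insert x P \ {v}, G.ReachIn (insert x P \ {v}) a x := by
    rintro v hv a ⟨rfl | ha, hav⟩
    · exact .refl ⟨by simp, hav⟩
    · have hsub : P \ {v} ⊆ insert x P \ {v} :=
        Set.sdiff_subset_sdiff_left (Set.subset_insert _ _)
      rcases hp.reachIn_sdiff v ha hav with hr | hr
      · exact (hr.mono hsub).tail hy.symm ⟨by simp, hv.symm⟩
      · exact (hr.mono hsub).tail hz.symm ⟨by simp, hv.symm⟩
  rw [induce_isBiconnected_iff]
  refine ⟨?_, ?_, fun v => ?_⟩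
  · have : ({x, y, z} : Set V).encard = 3 := by
      rw [Set.encard_eq_three]
      exact ⟨x, y, z, hy.ne, hz.ne, hyz, rfl⟩
    rw [← this]
    refine Set.encard_le_encard ?_
    rintro w (rfl | rfl | rfl) <;> simp [hyP, hzP]
  · have : ∀ a ∈ insert x P, G.ReachIn (insert x P) a x := by
      rintro a (rfl | ha)
      · exact .refl (by simp)
      · exact ((hPc a ha y hyP).mono (Set.subset_insert _ _)).tail hy.symm (by simp)
    exact fun a ha b hb => (this a ha).trans (this b hb).symm
  · by_cases hv : v = x
    · subst hv
      rw [Set.insert_sdiff_of_mem _ (by simp), Set.sdiff_singleton_eq_self hxP]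
      exact hPc
    · exact fun a ha b hb => (hroot v hv a ha).trans (hroot v hv b hb).symm

theorem exists_isBlock_superset [Finite V] (h : (G.induce S).IsBiconnected) :
    ∃ B, S ⊆ B ∧ G.IsBlock B := by
  obtain ⟨B, hB, hmax⟩ := (Set.toFinite {S : Set V | (G.induce S).IsBiconnected}).exists_le_maximal h
  exact ⟨B, hB, .inl hmax⟩

/-- Local connectivity of the blocks in terms of the neighbourhoods of the whole graph. -/
theorem hasLocallyConnectedBlocks_iff [Finite V] : G.HasLocallyConnectedBlocks ↔
    ∀ x y z, G.Adj x y → G.Adj x z → G.ReachIn {x}ᶜ y z → G.ReachIn (G.neighborSet x) y z := by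
  have hnb : ∀ (B : Set V) (x : B), Subtype.val '' ((G.induce B).neighborSet x) =
      G.neighborSet x ∩ B := by
    intro B x
    ext y
    simp [and_comm]
  constructor
  · intro h x y z hy hz hyz
    rcases eq_or_ne y z with rfl | hne
    · exact .refl hy
    obtain ⟨S, hxS, hyS, hzS, hS⟩ := exists_isBiconnected hy hz hne hyz
    obtain ⟨B, hSB, hB⟩ := exists_isBlock_superset hS
    have := induce_preconnected_iff.mp (h B hB ⟨x, hSB hxS⟩) ⟨y, hSB hyS⟩ hy ⟨z, hSB hzS⟩ hz
    rw [reachIn_induce_iff, hnb] at this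
    exact this.mono Set.inter_subset_left
  · rintro h B hB x
    rw [induce_preconnected_iff]
    intro y hy z hz
    rw [reachIn_induce_iff, hnb]
    rcases hB with hB | ⟨u, v, huv, -, rfl⟩
    · have hbic := (induce_isBiconnected_iff.mp hB.prop).2.2 x y ⟨y.2, fun h => hy.ne.symm h⟩ z
        ⟨z.2, fun h => hz.ne.symm h⟩
      have hr := h x y z hy hz (hbic.mono fun _ h => h.2)
      -- The walk in the neighbourhood of `x` cannot leave `B`: each of its edges `bc` lies with `x`
      -- in a biconnected set, which shares `x` and `b` with `B` and is thus contained in `B` by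
      -- maximality.
      refine hr.tail_induction (.refl ⟨hy, y.2⟩) ?_
      rintro b c hb hc hbc - ih
      refine ih.tail hbc ⟨hc, ?_⟩
      obtain ⟨S, hxS, hbS, hcS, hS⟩ := exists_isBiconnected hb hc hbc.ne
        (.of_adj hb.ne.symm hc.ne.symm hbc)
      exact hB.le_of_ge (hB.prop.union hS hb.ne ⟨x.2, hxS⟩ ⟨ih.right_mem.2, hbS⟩)
        Set.subset_union_left (.inr hcS)
    -- A bridge has two vertices only, so `x` has a single neighbour in it.
    · have : y = z := by
        have hy' : G.Adj x y := hy
        have hz' : G.Adj x z := hz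
        obtain ⟨x, hx⟩ := x
        obtain ⟨y, hy1⟩ := y
        obtain ⟨z, hz1⟩ := z
        have := hy'.ne
        have := hz'.ne
        simp only [Set.mem_insert_iff, Set.mem_singleton_iff] at hx hy1 hz1
        ext
        grind
      subst this
      exact .refl ⟨hy, y.2⟩

end SimpleGraph

/-! ### Moves of the guards. -/

namespace SimpleGraph

variable {V : Type*} {G : SimpleGraph V} {S T X Z : Set V} {a u v : V}

/-- A row of guards moves by one step along a path. -/
theorem exists_shift (h : G.ReachIn (insert a Z) a u) (haZ : a ∉ Z) (hv : v ∉ insert a Z)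
    (huv : G.Adj u v) : ∃ f : V → V, Set.BijOn f (insert a Z) (insert v Z) ∧
      (∀ x ∈ insert a Z, f x = x ∨ G.Adj x (f x)) ∧ f u = v := by
  classical
  obtain ⟨p, hp, hpS⟩ : ∃ p : G.Walk a u, p.IsPath ∧ ∀ w ∈ p.support, w ∈ insert a Z := by
    have : ∃ p : G.Walk a u, ∀ w ∈ p.support, w ∈ insert a Z := by
      refine h.tail_induction (P := fun u => ∃ p : G.Walk a u, ∀ w ∈ p.support, w ∈ insert a Z)
        ⟨Walk.nil, by simp⟩ ?_
      rintro x y - hy hxy - ⟨p, hp⟩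
      refine ⟨p.concat hxy, fun w hw => ?_⟩
      rw [Walk.support_concat, List.mem_append, List.mem_singleton] at hw
      rcases hw with hw | rfl
      · exact hp w hw
      · exact hy
    obtain ⟨p, hp⟩ := this
    exact ⟨p.bypass, p.bypass_isPath, fun w hw => hp w (p.support_bypass_subset_support hw)⟩
  -- The move is the cyclic permutation of the path extended by `v`: each vertex goes to its
  -- successor and `v` to `a`. As `v` is unoccupied, no guard makes this last jump.
  set q := p.concat huv with hq
  have hqp : q.IsPath := hp.concat (fun h => hv (hpS v h)) huv
  set l := q.support with hl
  have hnd : l.Nodup := hqp.support_nodup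
  have hlen : l.length = q.length + 1 := q.length_support
  have hget : ∀ i (hi : i < l.length), l[i] = q.getVert i :=
    fun i hi => Walk.support_getElem_eq_getVert q hi
  have hsucc : ∀ i, i < q.length → l.formPerm (q.getVert i) = q.getVert (i + 1) := by
    intro i hi
    have := List.formPerm_apply_lt_getElem l hnd i (by omega)
    rwa [hget, hget] at this
  have hlast : l.formPerm v = a := by
    have := List.formPerm_apply_getElem l hnd q.length (by omega)
    simp only [hget, hlen, Nat.mod_self, Walk.getVert_length, Walk.getVert_zero] at this
    exact this
  have hmem : ∀ x, x ∈ l → x ∈ insert v (insert a Z) := by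
    intro x hx
    rw [hl, hq, Walk.support_concat, List.mem_append, List.mem_singleton] at hx
    exact hx.symm.imp id (hpS x)
  have hal : a ∈ l := q.start_mem_support
  have hav : a ≠ v := fun h => hv (by simp [← h])
  refine ⟨l.formPerm, ?_, ?_, ?_⟩
  -- The permutation preserves this set; removing `v` from the source and its image `a` from the
  -- target leaves the required bijection.
  · have hW : l.formPerm '' insert v (insert a Z) = insert v (insert a Z) := by
      have hiff : ∀ x, l.formPerm x ∈ insert v (insert a Z) ↔ x ∈ insert v (insert a Z) := by
        intro x
        by_cases hx : x ∈ l
        · exact ⟨fun _ => hmem x hx, fun _ => hmem _ (List.formPerm_apply_mem_of_mem hx)⟩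
        · rw [List.formPerm_apply_of_notMem hx]
      ext y
      constructor
      · rintro ⟨x, hx, rfl⟩
        exact (hiff x).mpr hx
      · intro hy
        refine ⟨l.formPerm.symm y, (hiff _).mp (by simpa using hy), by simp⟩
    have h1 : insert a Z = insert v (insert a Z) \ {v} := by
      rw [Set.insert_sdiff_of_mem _ (by simp), Set.sdiff_singleton_eq_self hv]
    have h2 : insert v Z = insert v (insert a Z) \ {a} := by
      rw [Set.insert_comm, Set.insert_sdiff_of_mem _ (by simp), Set.sdiff_singleton_eq_self]
      simp [haZ, hav]
    rw [h2]
    refine ⟨?_, l.formPerm.injective.injOn, ?_⟩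
    · intro x hx
      refine ⟨hW ▸ ⟨x, .inr hx, rfl⟩, fun hxa => hv ?_⟩
      have : x = v := l.formPerm.injective (hxa.trans hlast.symm)
      exact this ▸ hx
    · rintro y ⟨hy, hya⟩
      obtain ⟨x, hx, rfl⟩ := hW.symm ▸ hy
      refine ⟨x, h1 ▸ ⟨hx, fun hxv => hya ?_⟩, rfl⟩
      rw [Set.mem_singleton_iff.mp hxv, hlast, Set.mem_singleton_iff]
  · intro x hx
    by_cases hxl : x ∈ l
    · right
      obtain ⟨i, hi, rfl⟩ := List.getElem_of_mem hxl
      rw [hget] at hx ⊢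
      have hi' : i < q.length := by
        rcases Nat.lt_or_ge i q.length with h | h
        · exact h
        · exact absurd (q.getVert_of_length_le h ▸ hx) hv
      rw [hsucc i hi']
      exact q.adj_getVert_succ hi'
    · exact .inl (List.formPerm_apply_of_notMem hxl)
  · have hlq : q.length = p.length + 1 := Walk.length_concat p huv
    have h1 : q.getVert p.length = u := by
      have := q.adj_penultimate
      have := hget p.length (by omega)
      rw [← this]
      simp only [hl, hq, Walk.support_concat]
      rw [List.getElem_append_left (by simp), Walk.support_getElem_eq_getVert, Walk.getVert_length]
    have := hsucc p.length (by omega)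
    rw [h1, ← hlq, Walk.getVert_length] at this
    exact this

theorem Defends.symm {f : V → V} (h : G.Defends u v S T f) : G.Defends v u S T f :=
  ⟨h.1, h.2.1, h.2.2.symm⟩

/-- If both ends of the attacked edge are occupied, the two guards change places. -/
theorem exists_defends_self (hu : u ∈ S) (hv : v ∈ S) (h : G.Adj u v) :
    ∃ f, G.Defends u v S S f := by
  classical
  refine ⟨Equiv.swap u v, ⟨?_, (Equiv.swap u v).injective.injOn, ?_⟩, ?_, .inl ⟨hu, by simp⟩⟩
  · intro x hx
    rcases Equiv.swap_apply_eq_iff.mp (rfl : Equiv.swap u v x = _) with -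
    rw [Equiv.swap_apply_def]
    split_ifs <;> assumption
  · intro x hx
    refine ⟨Equiv.swap u v x, ?_, by simp⟩
    rw [Equiv.swap_apply_def]
    split_ifs <;> assumption
  · intro x _
    rw [Equiv.swap_apply_def]
    split_ifs with h1 h2
    · exact .inr (h1 ▸ h)
    · exact .inr (h2 ▸ h.symm)
    · exact .inl rfl

/-- It suffices to defend attacks on edges with exactly one occupied end. -/
theorem isEternalVertexCoverClass_of {C : Set (Set V)} (hcov : ∀ S ∈ C, G.IsVertexCover S)
    (hcard : ∀ S ∈ C, ∀ T ∈ C, S.encard = T.encard)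
    (hdef : ∀ S ∈ C, ∀ u v, G.Adj u v → u ∈ S → v ∉ S → ∃ T ∈ C, ∃ f, G.Defends u v S T f) :
    G.IsEternalVertexCoverClass C := by
  refine ⟨hcov, hcard, fun S hS u v huv => ?_⟩
  by_cases hu : u ∈ S
  · by_cases hv : v ∈ S
    · exact ⟨S, hS, exists_defends_self hu hv huv⟩
    · exact hdef S hS u v huv hu hv
  · have hv : v ∈ S := (hcov S hS huv).resolve_left hu
    obtain ⟨T, hT, f, hf⟩ := hdef S hS v u huv.symm hv hu
    exact ⟨T, hT, f, hf.symm⟩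

theorem IsEternalVertexCoverClass.num_le {C : Set (Set V)} (hC : G.IsEternalVertexCoverClass C)
    (hS : S ∈ C) : G.eternalVertexCoverNum ≤ S.encard :=
  iInf₂_le S ⟨C, hC, hS⟩

theorem vertexCoverNum_le_eternalVertexCoverNum :
    G.vertexCoverNum ≤ G.eternalVertexCoverNum :=
  le_iInf₂ fun S ⟨_, hC, hS⟩ => (hC.isVertexCover S hS).vertexCoverNum_le

/-- Hall's condition for the exchange of two minimum vertex covers. -/
theorem exists_matching [Finite V] {P : Set V → Prop}
    (hST : S.encard = T.encard) (hS : G.IsVertexCover S) (hT : G.IsMinimumVertexCover T)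
    (hP : ∀ T', S ∩ T ⊆ T' → v ∈ T' → G.IsMinimumVertexCover T' → P T')
    (hmin : ∀ T', P T' → (T \ S).ncard ≤ (T' \ S).ncard) (hvT : v ∈ T) (hvS : v ∉ S)
    (ha : a ∈ S \ T) :
    ∃ g : V → V, Set.BijOn g ((S \ T) \ {a}) ((T \ S) \ {v}) ∧
      ∀ x ∈ (S \ T) \ {a}, G.Adj x (g x) := by
  classical
  have := Fintype.ofFinite V
  set A := S \ T with hA
  set B := T \ S with hB
  have hcard : A.ncard = B.ncard := by
    have := Set.ncard_sdiff_add_ncard S T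
    have h2 := Set.ncard_sdiff_add_ncard T S
    have h3 : S.ncard = T.ncard := by simp [Set.ncard, hST]
    rw [Set.union_comm, ← hB] at h2
    rw [← hA] at this
    omega
  -- If `B'` had at most `B'.ncard` neighbours in `A`, exchanging `B'` for them in `T` would give a
  -- minimum cover with fewer vertices outside `S`, against `hmin`. The strict inequality leaves
  -- room for removing `a` from `A`.
  have hall : ∀ B' : Set V, B' ⊆ B \ {v} → B'.Nonempty →
      B'.ncard < {x ∈ A | ∃ b ∈ B', G.Adj b x}.ncard := by
    intro B' hB' hne
    by_contra! hle
    set N := {x ∈ A | ∃ b ∈ B', G.Adj b x} with hN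
    set T' := (T \ B') ∪ N with hT'
    have hcov : G.IsVertexCover T' := by
      have : ∀ x y, G.Adj x y → x ∈ T → x ∈ T' ∨ y ∈ T' := by
        intro x y hxy hx
        by_cases hxB : x ∈ B'
        · right
          have hxS : x ∉ S := (hB' hxB).1.2
          have hyS : y ∈ S := (hS hxy).resolve_left hxS
          by_cases hyT : y ∈ T
          · exact .inl ⟨hyT, fun h => (hB' h).1.2 hyS⟩
          · exact .inr ⟨⟨hyS, hyT⟩, x, hxB, hxy⟩
        · exact .inl (.inl ⟨hx, hxB⟩)
      intro x y hxy
      rcases hT.1 hxy with h | h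
      · exact this x y hxy h
      · exact (this y x hxy.symm h).symm
    have hT'card : T'.ncard ≤ T.ncard := by
      have h1 := Set.ncard_union_le (T \ B') N
      have h2 := Set.ncard_sdiff_add_ncard_of_subset (s := B') (t := T)
        fun x hx => (hB' hx).1.1
      rw [← hT'] at h1
      omega
    have hmem : G.IsMinimumVertexCover T' := by
      refine ⟨hcov, le_antisymm ?_ hcov.vertexCoverNum_le⟩
      rw [← hT.2, ← Set.Finite.cast_ncard_eq (Set.toFinite _),
        ← Set.Finite.cast_ncard_eq (Set.toFinite T)]
      exact_mod_cast hT'card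
    have hPT' := hP T' (fun x hx => .inl ⟨hx.2, fun h => (hB' h).1.2 hx.1⟩)
      (.inl ⟨hvT, fun h => (hB' h).2 rfl⟩) hmem
    have h1 := hmin T' hPT'
    have h2 : T' \ S = B \ B' := by
      ext x
      simp only [hT', hN, hA, hB, Set.mem_sdiff, Set.mem_union, Set.mem_ofPred_eq]
      tauto
    have h3 : B' ⊆ B := fun x hx => (hB' hx).1
    have h4 := Set.ncard_sdiff_add_ncard_of_subset h3
    have h5 : 0 < B'.ncard := by rwa [Set.ncard_pos]
    rw [h2] at h1
    omega
  obtain ⟨M, hMinj, hM⟩ := (Finset.all_card_le_biUnion_card_iff_exists_injective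
    (ι := ↥(B \ {v})) (fun b => (Finset.univ.filter fun x => x ∈ A \ {a} ∧ G.Adj b.1 x))).mp (by
      intro s
      rcases s.eq_empty_or_nonempty with rfl | hs
      · simp
      set B' : Set V := Subtype.val '' (s : Set ↥(B \ {v})) with hB'
      have h1 := hall B' (by rintro _ ⟨b, -, rfl⟩; exact b.2) (by simpa [hB'] using hs)
      have h2 : B'.ncard = s.card := by
        rw [hB', Set.ncard_image_of_injective _ Subtype.val_injective, Set.ncard_coe_finset]
      have h3 : (s.biUnion fun b => Finset.univ.filter fun x => x ∈ A \ {a} ∧ G.Adj b.1 x) =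
          {x ∈ A | ∃ b ∈ B', G.Adj b x}.toFinset.erase a := by
        ext x
        simp only [hB', Finset.mem_biUnion, Finset.mem_filter, Finset.mem_univ, true_and,
          Finset.mem_erase, Set.mem_toFinset, Set.mem_ofPred_eq, Set.mem_image, Set.mem_sdiff,
          Set.mem_singleton_iff, Finset.mem_coe]
        constructor
        · rintro ⟨b, hb, ⟨hx, hxa⟩, hbx⟩
          exact ⟨hxa, hx, b, ⟨b, hb, rfl⟩, hbx⟩
        · rintro ⟨hxa, hx, _, ⟨b, hb, rfl⟩, hbx⟩
          exact ⟨b, hb, ⟨hx, hxa⟩, hbx⟩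
      have h4 := Finset.pred_card_le_card_erase (s := {x ∈ A | ∃ b ∈ B', G.Adj b x}.toFinset)
        (a := a)
      rw [h3]
      rw [Set.ncard_eq_toFinset_card' {x ∈ A | ∃ b ∈ B', G.Adj b x}] at h1
      omega)
  set M' : V → V := fun x => if h : x ∈ B \ {v} then M ⟨x, h⟩ else x with hM'
  have hMv : ∀ x (h : x ∈ B \ {v}), M' x = M ⟨x, h⟩ := fun x h => by simp only [hM', dif_pos h]
  have hMprop : ∀ x ∈ B \ {v}, M' x ∈ A \ {a} ∧ G.Adj x (M' x) := by
    intro x hx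
    rw [hMv x hx]
    simpa using hM ⟨x, hx⟩
  have hmaps : Set.MapsTo M' (B \ {v}) (A \ {a}) := fun x hx => (hMprop x hx).1
  have hinj : Set.InjOn M' (B \ {v}) := by
    intro x hx y hy hxy
    rw [hMv x hx, hMv y hy] at hxy
    exact congrArg Subtype.val (hMinj hxy)
  have hbij : Set.BijOn M' (B \ {v}) (A \ {a}) := by
    refine ⟨hmaps, hinj, (Set.eq_of_subset_of_ncard_le hmaps.image_subset ?_).ge⟩
    rw [hinj.ncard_image, Set.ncard_sdiff_singleton_of_mem ha, Set.ncard_sdiff_singleton_of_mem (show v ∈ B from ⟨hvT, hvS⟩), hcard]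
  have : Nonempty V := ⟨v⟩
  have hinv := hbij.invOn_invFunOn
  have hg := hbij.symm hinv.symm
  refine ⟨Function.invFunOn M' (B \ {v}), hg, fun x hx => ?_⟩
  have := (hMprop _ (hg.mapsTo hx)).2.symm
  rwa [hinv.2 hx] at this

/-- The target is a minimum cover `T` through `v` and `X` that is as close to `S` as possible. A row
of guards shifts from some `a ∈ S \ T` through `S ∩ T` to `v`, and the rest of `S \ T` is matched
with the rest of `T \ S`. -/
theorem exists_defends_of_minimum [Finite V] (hS : G.IsMinimumVertexCover S) (hXS : X ⊆ S)
    (hconn : ∀ a ∈ S, ∀ b ∈ S, G.ReachIn S a b) (hu : u ∈ S) (hv : v ∉ S) (huv : G.Adj u v)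
    (hT : ∃ T, G.IsMinimumVertexCover T ∧ v ∈ T ∧ X ⊆ T) :
    ∃ T, (G.IsMinimumVertexCover T ∧ X ⊆ T) ∧ ∃ f, G.Defends u v S T f := by
  classical
  obtain ⟨T, ⟨hTm, hvT, hXT⟩, hmin⟩ := Set.exists_min_image
    {T | G.IsMinimumVertexCover T ∧ v ∈ T ∧ X ⊆ T} (fun T => (T \ S).ncard) (Set.toFinite _) hT
  have hST : S.encard = T.encard := hS.2.trans hTm.2.symm
  have hAne : (S \ T).Nonempty := by
    rw [Set.nonempty_iff_ne_empty, Ne, Set.sdiff_eq_empty]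
    intro h
    exact hv ((Set.toFinite S).eq_of_subset_of_encard_le h hST.ge ▸ hvT)
  obtain ⟨a₀, ha₀⟩ := hAne
  -- On a walk in `S` from `u` to `a₀`, the vertex `a` is the first one outside `T`; before it the
  -- walk lies in `S ∩ T`.
  obtain ⟨a, ha, hau⟩ : ∃ a ∈ S \ T, G.ReachIn (insert a (S ∩ T)) a u := by
    refine (hconn u hu a₀ ha₀.1).head_induction
      (P := fun u => ∃ a ∈ S \ T, G.ReachIn (insert a (S ∩ T)) a u)
      ⟨a₀, ha₀, .refl (by simp)⟩ ?_
    rintro x y hx - hxy - ⟨a, ha, hr⟩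
    by_cases hxT : x ∈ T
    · exact ⟨a, ha, hr.tail hxy.symm (.inr ⟨hx, hxT⟩)⟩
    · exact ⟨x, ⟨hx, hxT⟩, .refl (by simp)⟩
  obtain ⟨g, hg, hgadj⟩ := exists_matching (P := fun T => G.IsMinimumVertexCover T ∧ v ∈ T ∧ X ⊆ T)
    hST hS.1 hTm (fun T' h1 h2 h3 => ⟨h3, h2, fun x hx => h1 ⟨hXS hx, hXT hx⟩⟩)
    (fun T' h => hmin T' h) hvT hv ha
  obtain ⟨f, hf, hfadj, hfu⟩ := exists_shift hau (fun h => ha.2 h.2)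
    (by rintro (rfl | h); exacts [hv ha.1, hv h.1]) huv
  have hS' : S = insert a (S ∩ T) ∪ (S \ T) \ {a} := by
    ext x
    by_cases hxa : x = a
    · subst hxa; simp [ha.1]
    · simp [hxa]; tauto
  have hT' : T = insert v (S ∩ T) ∪ (T \ S) \ {v} := by
    ext x
    by_cases hxa : x = v
    · subst hxa; simp [hvT]
    · simp [hxa]; tauto
  refine ⟨T, ⟨hTm, hXT⟩, fun x => if x ∈ insert a (S ∩ T) then f x else g x, ?_, ?_, ?_⟩
  · have hdis : ∀ x ∈ (S \ T) \ {a}, x ∉ insert a (S ∩ T) := by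
      rintro x hx (rfl | h)
      exacts [hx.2 rfl, hx.1.2 h.2]
    have h1 : Set.BijOn (fun x => if x ∈ insert a (S ∩ T) then f x else g x)
        (insert a (S ∩ T)) (insert v (S ∩ T)) :=
      hf.congr fun x hx => (if_pos hx).symm
    have h2 : Set.BijOn (fun x => if x ∈ insert a (S ∩ T) then f x else g x)
        ((S \ T) \ {a}) ((T \ S) \ {v}) :=
      hg.congr fun x hx => (if_neg (hdis x hx)).symm
    have h3 : Disjoint (insert v (S ∩ T)) ((T \ S) \ {v}) := by
      rw [Set.disjoint_left]
      rintro x (rfl | h) h'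
      exacts [h'.2 rfl, h'.1.2 h.1]
    have := h1.union h2 (by
      rw [Set.injOn_union (Set.disjoint_left.mpr fun x hx hx' => hdis x hx' hx)]
      exact ⟨h1.injOn, h2.injOn, fun x hx y hy hxy =>
        Set.disjoint_left.mp h3 (h1.mapsTo hx) (hxy ▸ h2.mapsTo hy)⟩)
    rwa [← hS', ← hT'] at this
  · intro x hx
    by_cases hx' : x ∈ insert a (S ∩ T)
    · simp only [if_pos hx']
      exact hfadj x hx'
    · simp only [if_neg hx']
      refine .inr (hgadj x ⟨⟨hx, fun h => hx' (.inr ⟨hx, h⟩)⟩, fun h => hx' (.inl h)⟩)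
  · exact .inl ⟨hu, by simp only [if_pos hau.right_mem, hfu]⟩

/-- The minimum vertex covers that contain `X` form an eternal vertex cover class. -/
theorem eternalVertexCoverNum_eq_of_forall [Finite V]
    (hX : ∀ S, G.IsVertexCover S → X ⊆ S → ∀ a ∈ S, ∀ b ∈ S, G.ReachIn S a b)
    (hne : ∃ S, G.IsMinimumVertexCover S ∧ X ⊆ S)
    (h : ∀ v, ∃ S, G.IsMinimumVertexCover S ∧ v ∈ S ∧ X ⊆ S) :
    G.eternalVertexCoverNum = G.vertexCoverNum := by
  refine le_antisymm ?_ vertexCoverNum_le_eternalVertexCoverNum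
  obtain ⟨S, hS, hXS⟩ := hne
  rw [← hS.2]
  refine (isEternalVertexCoverClass_of (C := {S | G.IsMinimumVertexCover S ∧ X ⊆ S})
    (fun S hS => hS.1.1) (fun S hS T hT => hS.1.2.trans hT.1.2.symm) ?_).num_le ⟨hS, hXS⟩
  intro S hS u v huv hu hv
  exact exists_defends_of_minimum hS.1 hS.2 (hX S hS.1.1 hS.2) hu hv huv (h v)

theorem Preconnected.exists_adj_of_ne (hG : G.Preconnected) (h : u ≠ v) : ∃ w, G.Adj u w := by
  obtain ⟨p⟩ := hG u v
  cases p with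
  | nil => exact absurd rfl h
  | cons h _ => exact ⟨_, h⟩

/-- One guard more than a connected minimum vertex cover suffices. -/
theorem eternalVertexCoverNum_le_add_one [Finite V] [Nontrivial V] 
    (h : ∀ S, G.IsVertexCover S → ∀ a ∈ S, ∀ b ∈ S, G.ReachIn S a b) :
    G.eternalVertexCoverNum ≤ G.vertexCoverNum + 1 := by
  obtain ⟨S, hS, hcov⟩ := G.vertexCoverNum_exists
  have hne : ∃ x, x ∉ S := by
    by_contra! hall
    have := vertexCoverNum_lt_card (G := G)
    rw [← hS, Set.eq_univ_of_forall hall, Set.encard_univ] at this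
    exact lt_irrefl _ this
  obtain ⟨x₀, hx₀⟩ := hne
  rw [← hS, ← Set.encard_insert_of_notMem hx₀]
  -- The cover `S` stays occupied for ever, and each attack moves the position of the additional
  -- guard from `x` to `v` by shifting a row.
  refine (isEternalVertexCoverClass_of (C := {T | ∃ x ∉ S, T = insert x S})
    ?_ ?_ ?_).num_le ⟨x₀, hx₀, rfl⟩
  · rintro _ ⟨x, -, rfl⟩
    exact hcov.subset (Set.subset_insert _ _)
  · rintro _ ⟨x, hx, rfl⟩ _ ⟨y, hy, rfl⟩
    rw [Set.encard_insert_of_notMem hx, Set.encard_insert_of_notMem hy]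
  · rintro _ ⟨x, hx, rfl⟩ u v huv hu hv
    have hvS : v ∉ S := fun h => hv (.inr h)
    obtain ⟨f, hf, hfadj, hfu⟩ := exists_shift (h _ (hcov.subset (Set.subset_insert x S))
      x (by simp) u hu) hx hv huv
    exact ⟨_, ⟨v, hvS, rfl⟩, f, hf, hfadj, .inl ⟨hu, hfu⟩⟩

end SimpleGraph

/-! ### Connected vertex covers and the values of the eternal vertex cover number. -/

namespace SimpleGraph

variable {V : Type*} {G : SimpleGraph V} {S T X Z : Set V} {a u v : V}

theorem isLocallyConnected_iff : G.IsLocallyConnected ↔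
    ∀ x y z, G.Adj x y → G.Adj x z → G.ReachIn (G.neighborSet x) y z := by
  simp only [IsLocallyConnected, induce_preconnected_iff]
  exact ⟨fun h x y z hy hz => h x y hy z hz, fun h x y hy z hz => h x y z hy hz⟩

/-- A vertex cover induces a connected subgraph if walks can be rerouted around the vertices
outside of it. -/
theorem IsVertexCover.reachIn (hG : G.Preconnected) (hS : G.IsVertexCover S)
    (h : ∀ x ∉ S, ∀ y z, G.Adj x y → G.Adj x z → G.ReachIn (G.neighborSet x) y z) :
    ∀ a ∈ S, ∀ b ∈ S, G.ReachIn S a b := by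
  intro a ha b hb
  have hN : ∀ x ∉ S, G.neighborSet x ⊆ S := fun x hx y hxy => (hS hxy).resolve_left hx
  -- On the walk, a vertex outside `S` is represented by its neighbours, which all lie in `S` and
  -- are linked to each other.
  have key := (reachable_iff_reachIn_univ.mp (hG a b)).head_induction
    (P := fun x => (x ∈ S → G.ReachIn S x b) ∧ (x ∉ S → ∀ y, G.Adj x y → G.ReachIn S y b))
    ⟨fun _ => .refl hb, fun h => absurd hb h⟩ (by
      rintro x y - - hxy - ⟨h1, h2⟩
      refine ⟨fun hx => ?_, fun hx z hxz => ?_⟩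
      · by_cases hy : y ∈ S
        · exact .cons hx hxy (h1 hy)
        · exact h2 hy x hxy.symm
      · exact ((h x hx z y hxz hxy).mono (hN x hx)).trans (h1 (hN x hx hxy)))
  exact key.1 ha

theorem IsLocallyConnected.reachIn (hl : G.IsLocallyConnected) (hG : G.Preconnected)
    (hS : G.IsVertexCover S) : ∀ a ∈ S, ∀ b ∈ S, G.ReachIn S a b :=
  hS.reachIn hG fun x _ y z => isLocallyConnected_iff.mp hl x y z

/-- Without edges there are no attacks. This case is separate because the criterion by covers
through every vertex fails for it: the only cover through the vertex has size one. -/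
theorem eternalVertexCoverNum_of_subsingleton [Subsingleton V] [Nonempty V] :
    G.eternalVertexCoverNum = 0 := by
  have hadj : ∀ u v, ¬ G.Adj u v := fun u v h => h.ne (Subsingleton.elim u v)
  have hC : G.IsEternalVertexCoverClass {∅} :=
    ⟨fun S _ u v h => (hadj u v h).elim, by simp, fun S _ u v h => (hadj u v h).elim⟩
  simpa using hC.num_le (S := ∅) rfl

theorem IsLocallyConnected.eternalVertexCoverNum_eq_or [Finite V] (hl : G.IsLocallyConnected)
    (hG : G.Connected) : G.eternalVertexCoverNum = G.vertexCoverNum ∨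
      G.eternalVertexCoverNum = G.vertexCoverNum + 1 := by
  have := hG.nonempty
  rcases subsingleton_or_nontrivial V with hV | hV
  · exact .inl (by simp [eternalVertexCoverNum_of_subsingleton])
  · have h1 := eternalVertexCoverNum_le_add_one fun S hS => hl.reachIn hG.preconnected hS
    have h2 := G.vertexCoverNum_le_eternalVertexCoverNum
    rcases h2.eq_or_lt with h | h
    · exact .inl h.symm
    · exact .inr (h1.antisymm (Order.add_one_le_of_lt h))

/-- Every vertex is in some member of an eternal vertex cover class. -/
theorem IsEternalVertexCoverClass.exists_mem [Nontrivial V] {C : Set (Set V)}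
    (hC : G.IsEternalVertexCoverClass C) (hG : G.Preconnected) (hS : S ∈ C) (v : V) :
    ∃ T ∈ C, v ∈ T := by
  by_cases hv : v ∈ S
  · exact ⟨S, hS, hv⟩
  · obtain ⟨w, hw⟩ := exists_ne v
    obtain ⟨u, hu⟩ := hG.exists_adj_of_ne hw.symm
    -- An attack on an edge at the unoccupied vertex `v` forces a guard onto `v`.
    obtain ⟨T, hT, f, hf, -, hd⟩ := hC.defend S hS v u hu
    rcases hd with ⟨h, -⟩ | ⟨h, hfu⟩
    · exact absurd h hv
    · exact ⟨T, hT, hfu ▸ hf.mapsTo h⟩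

/-- The infimum is finite here, so it is attained; equal cardinality then makes every member of the
class a minimum cover. -/
theorem exists_eternalVertexCoverClass [Finite V]
    (h : G.eternalVertexCoverNum = G.vertexCoverNum) :
    ∃ C S, G.IsEternalVertexCoverClass C ∧ S ∈ C ∧ ∀ T ∈ C, G.IsMinimumVertexCover T := by
  have hne : Nonempty {S : Set V // G.IsEternalVertexCover S} := by
    by_contra hemp
    have : G.eternalVertexCoverNum = ⊤ := by
      simp only [eternalVertexCoverNum, iInf_eq_top]
      intro S hS
      exact (hemp ⟨S, hS⟩).elim
    exact vertexCoverNum_ne_top_of_finite (h.symm.trans this)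
  obtain ⟨⟨S, C, hC, hS⟩, hcard⟩ := ENat.exists_eq_iInf
    (fun S : {S : Set V // G.IsEternalVertexCover S} => S.1.encard)
  have hS' : S.encard = G.vertexCoverNum := by
    rw [← h, eternalVertexCoverNum, hcard, iInf_subtype]
  exact ⟨C, S, hC, hS, fun T hT => ⟨hC.isVertexCover T hT, (hC.encard_eq T hT S hS).trans hS'⟩⟩

/-- If an attack on an unoccupied vertex `x` of a minimum vertex cover is answered by a minimum
vertex cover, then a part of the graph that contains no guard moving to `x` and that is separated
by `x` keeps its number of guards, and the attacked part loses one. -/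
theorem Defends.encard_inter_add_one {f : V → V} {x y : V} {C : Set V}
    (hd : G.Defends x y S T f) (hx : x ∉ S) (hy : y ∈ C)
    (hsep : ∀ u v, G.Adj u v → u ∈ C → v ∈ C ∨ v = x) (hxC : x ∉ C) :
    (T ∩ C).encard + 1 = (S ∩ C).encard := by
  obtain ⟨hf, hmove, hd⟩ := hd
  obtain ⟨hyS, hfy⟩ : y ∈ S ∧ f y = x := by
    rcases hd with ⟨h, -⟩ | h
    · exact absurd h hx
    · exact h
  -- Guards can leave or enter `C` only by way of `x`. The guard on `y` goes to `x`, and none can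
  -- enter, since `x` is unoccupied.
  have himg : f '' (S ∩ C) = insert x (T ∩ C) := by
    ext t
    constructor
    · rintro ⟨s, ⟨hs, hsC⟩, rfl⟩
      rcases hmove s hs with h | h
      · rw [h]
        exact .inr ⟨h ▸ hf.mapsTo hs, hsC⟩
      · rcases hsep _ _ h hsC with h' | h'
        · exact .inr ⟨hf.mapsTo hs, h'⟩
        · exact .inl h'
    · rintro (rfl | ⟨ht, htC⟩)
      · exact ⟨y, ⟨hyS, hy⟩, hfy⟩
      · obtain ⟨s, hs, rfl⟩ := hf.surjOn ht
        refine ⟨s, ⟨hs, ?_⟩, rfl⟩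
        rcases hmove s hs with h | h
        · exact h ▸ htC
        · rcases hsep _ _ h.symm htC with h' | h'
          · exact h'
          · exact absurd (h' ▸ hs) hx
  rw [← (hf.injOn.mono Set.inter_subset_left).encard_image, himg,
    Set.encard_insert_of_notMem fun h => hxC h.2]

/-- The members of an eternal class of minimum vertex covers contain all cut vertices. -/
theorem IsEternalVertexCoverClass.isCutVertex_mem [Finite V] {C : Set (Set V)} {x : V}
    (hC : G.IsEternalVertexCoverClass C) (hmin : ∀ T ∈ C, G.IsMinimumVertexCover T)
    (hS : S ∈ C) (hx : G.IsCutVertex x) : x ∈ S := by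
  by_contra hxS
  obtain ⟨u, w, hu, hw, huw, hnot⟩ := isCutVertex_iff.mp hx
  set A : Set V := {y | G.ReachIn {x}ᶜ u y} with hA
  set B : Set V := {y | y ≠ x ∧ ¬ G.ReachIn {x}ᶜ u y} with hB
  have hsepA : ∀ p q, G.Adj p q → p ∈ A → q ∈ A ∨ q = x := by
    intro p q hpq hp
    by_cases hq : q = x
    · exact .inr hq
    · exact .inl (ReachIn.tail hp hpq hq)
  have hsepB : ∀ p q, G.Adj p q → p ∈ B → q ∈ B ∨ q = x := by
    intro p q hpq hp
    by_cases hq : q = x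
    · exact .inr hq
    · exact .inl ⟨hq, fun h => hp.2 (ReachIn.tail h hpq.symm hp.1)⟩
  have hxA : x ∉ A := fun h => ReachIn.right_mem h rfl
  have hxB : x ∉ B := fun h => h.1 rfl
  have huA : u ∈ A := ReachIn.refl hu
  have hwB : w ∈ B := ⟨hw, hnot⟩
  have hnbr : ∀ D : Set V, (∀ p q, G.Adj p q → p ∈ D → q ∈ D ∨ q = x) → ∀ p ∈ D, ∀ q ∉ D,
      G.Reachable p q → ∃ y ∈ D, G.Adj x y := by
    intro D hD p hp q hq hpq
    by_contra! hno
    have : q ∈ D := (reachable_iff_reachIn_univ.mp hpq).tail_induction (P := fun q => q ∈ D) hp (by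
      rintro s t - - hst - hs
      rcases hD s t hst hs with h | rfl
      · exact h
      · exact absurd hst.symm (hno s hs))
    exact hq this
  obtain ⟨y, hyA, hxy⟩ := hnbr A hsepA u huA w hnot huw
  obtain ⟨z, hzB, hxz⟩ := hnbr B hsepB w hwB u (fun h => h.2 huA) huw.symm
  obtain ⟨T₁, hT₁, f₁, hd₁⟩ := hC.defend S hS x y hxy
  obtain ⟨T₂, hT₂, f₂, hd₂⟩ := hC.defend S hS x z hxz
  have h1 := hd₁.encard_inter_add_one hxS hyA hsepA hxA
  have h2 := hd₂.encard_inter_add_one hxS hzB hsepB hxB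
  -- Each answer saves one guard on the attacked side. Both depleted sides together with `x` form a
  -- cover with one vertex fewer than `S`.
  set U : Set V := insert x ((T₁ ∩ A) ∪ (T₂ ∩ B)) with hU
  have hcov : G.IsVertexCover U := by
    intro p q hpq
    by_cases hp : p = x
    · exact .inl (.inl hp)
    by_cases hq : q = x
    · exact .inr (.inl hq)
    by_cases hpA : p ∈ A
    · have hqA : q ∈ A := (hsepA p q hpq hpA).resolve_right hq
      exact (hC.isVertexCover _ hT₁ hpq).imp (fun h => .inr (.inl ⟨h, hpA⟩))
        fun h => .inr (.inl ⟨h, hqA⟩)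
    · have hpB : p ∈ B := ⟨hp, hpA⟩
      have hqB : q ∈ B := (hsepB p q hpq hpB).resolve_right hq
      exact (hC.isVertexCover _ hT₂ hpq).imp (fun h => .inr (.inr ⟨h, hpB⟩))
        fun h => .inr (.inr ⟨h, hqB⟩)
  have hdisj : ∀ D E : Set V, Disjoint (D ∩ A) (E ∩ B) := by
    intro D E
    rw [Set.disjoint_left]
    exact fun p hp hp' => hp'.2.2 hp.2
  have hScard : S.encard = (S ∩ A).encard + (S ∩ B).encard := by
    rw [← Set.encard_union_eq (hdisj S S)]
    congr 1
    ext p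
    constructor
    · intro hp
      by_cases hpA : p ∈ A
      · exact .inl ⟨hp, hpA⟩
      · exact .inr ⟨hp, fun h => hxS (h ▸ hp), hpA⟩
    · rintro (h | h) <;> exact h.1
  have hUcard : U.encard = (T₁ ∩ A).encard + (T₂ ∩ B).encard + 1 := by
    rw [hU, Set.encard_insert_of_notMem, Set.encard_union_eq (hdisj _ _)]
    rintro (h | h)
    exacts [hxA h.2, hxB h.2]
  have hle : S.encard ≤ U.encard := (hmin S hS).2.trans_le hcov.vertexCoverNum_le
  rw [hScard, hUcard, ← h1, ← h2] at hle
  simp only [← Set.Finite.cast_ncard_eq (Set.toFinite _)] at hle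
  norm_cast at hle
  omega

theorem Connected.exists_not_isCutVertex [Finite V] (hG : G.Connected) :
    ∃ v, ¬ G.IsCutVertex v := by
  obtain ⟨v, hv⟩ := hG.exists_preconnected_induce_compl_singleton_of_finite
  exact ⟨v, fun ⟨u, w, hu, hw, _, h⟩ => h (hv ⟨u, hu⟩ ⟨w, hw⟩)⟩

/-- A vertex outside `S` is not a cut vertex, so its neighbours are joined by walks avoiding it, and
then within its neighbourhood. -/
theorem HasLocallyConnectedBlocks.reachIn [Finite V] (hb : G.HasLocallyConnectedBlocks)
    (hG : G.Preconnected) (hS : G.IsVertexCover S) (hX : ∀ x, G.IsCutVertex x → x ∈ S) :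
    ∀ a ∈ S, ∀ b ∈ S, G.ReachIn S a b := by
  refine hS.reachIn hG fun x hx y z hy hz => hasLocallyConnectedBlocks_iff.mp hb x y z hy hz ?_
  by_contra hnot
  exact hx (hX x (isCutVertex_iff.mpr ⟨y, z, hy.ne.symm, hz.ne.symm, hG y z, hnot⟩))

/-- The characterization of `evc = mvc` for graphs with locally connected blocks, with a condition
on all vertices. -/
theorem HasLocallyConnectedBlocks.eternalVertexCoverNum_eq_iff_forall [Finite V] [Nontrivial V]
    (hb : G.HasLocallyConnectedBlocks) (hG : G.Connected) :
    G.eternalVertexCoverNum = G.vertexCoverNum ↔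
      ∀ v : V, ∃ S : Set V, G.IsMinimumVertexCover S ∧ v ∈ S ∧ ∀ x, G.IsCutVertex x → x ∈ S := by
  constructor
  · intro h v
    obtain ⟨C, S, hC, hS, hmin⟩ := exists_eternalVertexCoverClass h
    obtain ⟨T, hT, hv⟩ := hC.exists_mem hG.preconnected hS v
    exact ⟨T, hmin T hT, hv, fun x hx => hC.isCutVertex_mem hmin hT hx⟩
  · intro h
    obtain ⟨v⟩ := hG.nonempty
    obtain ⟨S, hS, -, hXS⟩ := h v
    exact eternalVertexCoverNum_eq_of_forall (X := {x | G.IsCutVertex x})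
      (fun S hS hX => hb.reachIn hG.preconnected hS hX) ⟨S, hS, hXS⟩ h

theorem HasLocallyConnectedBlocks.eternalVertexCoverNum_eq_iff [Finite V] [Nontrivial V]
    (hb : G.HasLocallyConnectedBlocks) (hG : G.Connected) :
    G.eternalVertexCoverNum = G.vertexCoverNum ↔ ∀ v : V, ¬ G.IsCutVertex v →
      ∃ S : Set V, G.IsMinimumVertexCover S ∧ v ∈ S ∧ ∀ x, G.IsCutVertex x → x ∈ S := by
  rw [hb.eternalVertexCoverNum_eq_iff_forall hG]
  refine ⟨fun h v _ => h v, fun h v => ?_⟩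
  by_cases hv : G.IsCutVertex v
  -- A cover obtained for any vertex that is not a cut vertex contains all cut vertices, in
  -- particular `v`.
  · obtain ⟨w, hw⟩ := hG.exists_not_isCutVertex
    obtain ⟨S, hS, -, hX⟩ := h w hw
    exact ⟨S, hS, hX v hv, hX⟩
  · exact h v hv

/-- Local connectivity excludes a cut vertex `v` because the vertex cover `{v}ᶜ` is connected. This
lets the certificates for the blocks serve in (2) as well. -/
theorem Connected.isLocallyConnected_iff [Finite V] (hG : G.Connected) :
    G.IsLocallyConnected ↔ G.HasLocallyConnectedBlocks ∧ ∀ v, ¬ G.IsCutVertex v := by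
  rw [SimpleGraph.isLocallyConnected_iff, hasLocallyConnectedBlocks_iff]
  constructor
  · intro h
    refine ⟨fun x y z hy hz _ => h x y z hy hz, fun v hv => ?_⟩
    obtain ⟨u, w, hu, hw, -, hnot⟩ := isCutVertex_iff.mp hv
    exact hnot ((show G.IsVertexCover ({v}ᶜ : Set V) from fun p q hpq => by
      by_contra! hc
      simp only [Set.mem_compl_iff, Set.mem_singleton_iff, not_not] at hc
      exact hpq.ne (hc.1.trans hc.2.symm)).reachIn hG.preconnected (fun x _ y z => h x y z)
        u hu w hw)
  · rintro ⟨h, hcut⟩ x y z hy hz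
    refine h x y z hy hz ?_
    by_contra hnot
    exact hcut x (isCutVertex_iff.mpr ⟨y, z, hy.ne.symm, hz.ne.symm, hG.preconnected y z, hnot⟩)

/-- If `k` exceeds the vertex cover number, a roaming guard is available and any vertex can be added
to a minimum cover; if they are equal, the covers are minimum covers and form a class. The
right-hand side has a short certificate. -/
theorem IsLocallyConnected.eternalVertexCoverNum_le_iff [Finite V] [Nontrivial V]
    (hl : G.IsLocallyConnected) (hG : G.Connected) {k : ℕ} :
    G.eternalVertexCoverNum ≤ k ↔ ∀ v : V, ∃ S, G.IsVertexCover S ∧ v ∈ S ∧ S.encard ≤ k := by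
  have hconn : ∀ S, G.IsVertexCover S → ∀ a ∈ S, ∀ b ∈ S, G.ReachIn S a b :=
    fun S hS => hl.reachIn hG.preconnected hS
  constructor
  · intro h v
    rcases hl.eternalVertexCoverNum_eq_or hG with he | he
    · obtain ⟨C, S, hC, hS, hmin⟩ := exists_eternalVertexCoverClass he
      obtain ⟨T, hT, hv⟩ := hC.exists_mem hG.preconnected hS v
      exact ⟨T, (hmin T hT).1, hv, ((hmin T hT).2.trans he.symm).trans_le h⟩
    · obtain ⟨S, hS, hcov⟩ := G.vertexCoverNum_exists
      refine ⟨insert v S, hcov.subset (Set.subset_insert _ _), by simp, ?_⟩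
      refine (Set.encard_insert_le S v).trans ?_
      rwa [hS, ← he]
  · intro h
    obtain ⟨v⟩ := hG.nonempty
    have hle : G.vertexCoverNum ≤ k := by
      obtain ⟨S, hS, -, hk⟩ := h v
      exact hS.vertexCoverNum_le.trans hk
    rcases hle.eq_or_lt with he | he
    · have hmin : ∀ v, ∃ S, G.IsMinimumVertexCover S ∧ v ∈ S ∧ ∅ ⊆ S := by
        intro v
        obtain ⟨S, hS, hv, hk⟩ := h v
        exact ⟨S, ⟨hS, (hk.trans_eq he.symm).antisymm hS.vertexCoverNum_le⟩, hv, by simp⟩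
      rw [eternalVertexCoverNum_eq_of_forall (fun S hS _ => hconn S hS)
        ((hmin v).imp fun S h => ⟨h.1, h.2.2⟩) hmin]
      exact hle
    · exact (eternalVertexCoverNum_le_add_one hconn).trans (Order.add_one_le_of_lt he)

end SimpleGraph

/-! ### Structured programs for oracle machines -/

/-- Structured programs over stacks with alphabet `Γ`; the internal state is `Option Γ`. -/
inductive Prog (K Γ : Type) : Type
  /-- push a symbol that depends on the state -/
  | push (k : K) (f : Option Γ → Γ)
  /-- the popped symbol, if any, becomes the state -/
  | pop (k : K)
  /-- change the state -/
  | load (f : Option Γ → Option Γ)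
  /-- ask the oracle, and choose the new state according to the answer -/
  | ask (f : Bool → Option Γ)
  | seq (c d : Prog K Γ)
  | ite (p : Option Γ → Bool) (c d : Prog K Γ)
  | loop (p : Option Γ → Bool) (c : Prog K Γ)

namespace Prog

variable {K K' Γ : Type}

/-- The labels of the machine that executes a program, without the exit label. -/
def Lab : Prog K Γ → Type
  | push _ _ => Unit
  | pop _ => Unit
  | load _ => Unit
  -- `none` is the query label, and `some b` is the label reached after the answer `b`.
  | ask _ => Option Bool
  | seq c d => Lab c ⊕ Lab d
  | ite _ c d => Option (Lab c ⊕ Lab d)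
  | loop _ c => Option (Lab c)

theorem finite_lab (c : Prog K Γ) : Finite c.Lab := by
  induction c with
  | push | pop | load => exact inferInstanceAs (Finite Unit)
  | ask => exact inferInstanceAs (Finite (Option Bool))
  | seq c d hc hd => exact inferInstanceAs (Finite (c.Lab ⊕ d.Lab))
  | ite p c d hc hd => exact inferInstanceAs (Finite (Option (c.Lab ⊕ d.Lab)))
  | loop p c hc => exact inferInstanceAs (Finite (Option c.Lab))

/-- The label at which the execution starts. -/
def start : (c : Prog K Γ) → c.Lab
  | push _ _ => ()
  | pop _ => ()
  | load _ => ()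
  | ask _ => (none : Option Bool)
  | seq c _ => Sum.inl (start c)
  | ite _ c d => (none : Option (Lab c ⊕ Lab d))
  | loop _ c => (none : Option (Lab c))

/-- The machine code of a program whose labels are embedded by `emb`, with a given exit label. -/
def code {L : Type} : (c : Prog K Γ) → (emb : c.Lab → L) → (exit : L) → c.Lab →
    Turing.TM2.Stmt (fun _ : K => Γ) L (Option Γ)
  | push k f, _, exit, _ => .push k f (.goto fun _ => exit)
  | pop k, _, exit, _ => .pop k (fun _ s => s) (.goto fun _ => exit)
  | load f, _, exit, _ => .load f (.goto fun _ => exit)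
  | ask f, _, exit, l => .load (fun _ => f (Option.getD l false)) (.goto fun _ => exit)
  | seq c d, emb, exit, l =>
      Sum.elim (code c (fun l => emb (.inl l)) (emb (.inr (start d))))
        (code d (fun l => emb (.inr l)) exit) l
  | ite p c d, emb, exit, l =>
      Option.elim l
        (.branch p (.goto fun _ => emb (some (.inl (start c))))
          (.goto fun _ => emb (some (.inr (start d)))))
        (Sum.elim (code c (fun l => emb (some (.inl l))) exit)
          (code d (fun l => emb (some (.inr l))) exit))
  | loop p c, emb, exit, l =>
      Option.elim l
        (.branch p (.goto fun _ => emb (some (start c))) (.goto fun _ => exit))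
        (code c (fun l => emb (some l)) (emb none))

/-- The query labels of the machine code. -/
def queries {L : Type} : (c : Prog K Γ) → (emb : c.Lab → L) → c.Lab → Option (Bool → L)
  | push _ _, _, _ => none
  | pop _, _, _ => none
  | load _, _, _ => none
  | ask _, emb, l => Option.elim l (some fun b => emb (some b)) fun _ => none
  | seq c d, emb, l =>
      Sum.elim (queries c fun l => emb (.inl l)) (queries d fun l => emb (.inr l)) l
  | ite _ c d, emb, l =>
      Option.elim l none (Sum.elim (queries c fun l => emb (some (.inl l)))
        (queries d fun l => emb (some (.inr l))))
  | loop _ c, emb, l => Option.elim l none (queries c fun l => emb (some l))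

open Classical in
/-- `Exec A qk qs c v S t v' S'`: with the oracle `A`, query stack `qk` and reading `qs` of the
symbols on it, the program `c` leads from the state `v` and the stacks `S` to `v'` and `S'` in
`t` steps. -/
inductive Exec [DecidableEq K] (A : Set (List Bool)) (qk : K) (qs : Γ → Bool) :
    Prog K Γ → Option Γ → (K → List Γ) → ℕ → Option Γ → (K → List Γ) → Prop
  | push (k f v S) : Exec A qk qs (push k f) v S 1 v (Function.update S k (f v :: S k))
  | pop (k v S) : Exec A qk qs (pop k) v S 1 (S k).head? (Function.update S k (S k).tail)
  | load (f v S) : Exec A qk qs (load f) v S 1 (f v) S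
  | ask (f v S) : Exec A qk qs (ask f) v S 2 (f (decide ((S qk).map qs ∈ A)))
      (Function.update S qk [])
  | seq {c d v S t v' S' t' v'' S''} (h : Exec A qk qs c v S t v' S')
      (h' : Exec A qk qs d v' S' t' v'' S'') : Exec A qk qs (seq c d) v S (t + t') v'' S''
  | ite {p c d v S t v' S'} (h : Exec A qk qs (if p v then c else d) v S t v' S') :
      Exec A qk qs (ite p c d) v S (1 + t) v' S'
  | loop_false {p c v S} (hp : p v = false) : Exec A qk qs (loop p c) v S 1 v S
  | loop_true {p c v S t v' S' t' v'' S''} (hp : p v = true) (h : Exec A qk qs c v S t v' S')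
      (h' : Exec A qk qs (loop p c) v' S' t' v'' S'') :
      Exec A qk qs (loop p c) v S (1 + t + t') v'' S''

open Classical in
/-- One step of an oracle machine with given code. -/
noncomputable def step [DecidableEq K] {L : Type} (A : Set (List Bool)) (qk : K) (qs : Γ → Bool)
    (M : L → Turing.TM2.Stmt (fun _ : K => Γ) L (Option Γ)) (Q : L → Option (Bool → L)) :
    Turing.TM2.Cfg (fun _ : K => Γ) L (Option Γ) →
      Option (Turing.TM2.Cfg (fun _ : K => Γ) L (Option Γ))
  | ⟨none, _, _⟩ => none
  | ⟨some l, v, S⟩ =>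
    match Q l with
    | some next =>
      some ⟨some (next (decide ((S qk).map qs ∈ A))), v, Function.update S qk []⟩
    | none => some (Turing.TM2.stepAux (M l) v S)

/-- The machine is only assumed to agree with the code of `c` on the embedded labels, so that the
induction passes to parts of a program inside a larger one. -/
theorem iterate_step_of_exec [DecidableEq K] {A : Set (List Bool)} {qk : K} {qs : Γ → Bool} {c : Prog K Γ}
    {v v' : Option Γ} {S S' : K → List Γ} {t : ℕ} (h : Exec A qk qs c v S t v' S') {L : Type}
    (M : L → Turing.TM2.Stmt (fun _ : K => Γ) L (Option Γ)) (Q : L → Option (Bool → L))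
    (emb : c.Lab → L) (exit : L) (hM : ∀ l, M (emb l) = code c emb exit l)
    (hQ : ∀ l, Q (emb l) = queries c emb l) :
    (flip bind (step A qk qs M Q))^[t] (some ⟨some (emb c.start), v, S⟩) =
      some ⟨some exit, v', S'⟩ := by
  induction h generalizing exit with
  | push k f v S => simp [flip, step, hM, hQ, code, queries]
  | pop k v S => simp [flip, step, hM, hQ, code, queries]
  | load f v S => simp [flip, step, hM, hQ, code, queries]
  | ask f v S =>
    have h1 : Q (emb (start (ask f))) = some fun b => emb (some b) := hQ _
    have h2 : ∀ b : Bool, Q (emb (some b : Option Bool)) = none := fun b => hQ _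
    have h3 : ∀ b : Bool, M (emb (some b : Option Bool)) =
      .load (fun _ => f b) (.goto fun _ => exit) := fun b => hM _
    rw [show (2 : ℕ) = 1 + 1 from rfl, Function.iterate_add_apply]
    simp [flip, step, h1, h2, h3]
  | @seq c d v S t v' S' t' v'' S'' _ _ ih1 ih2 =>
    rw [Nat.add_comm, Function.iterate_add_apply]
    have h1 := ih1 (fun l => emb (.inl l)) (emb (.inr d.start)) (fun l => hM _) (fun l => hQ _)
    have h2 := ih2 (fun l => emb (.inr l)) exit (fun l => hM _) (fun l => hQ _)
    exact (congrArg _ h1).trans h2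
  | @ite p c d v S t v' S' _ ih =>
    rw [Nat.add_comm, Function.iterate_add_apply]
    have hq : Q (emb (start (ite p c d))) = none := hQ _
    have hm : M (emb (start (ite p c d))) =
      .branch p (.goto fun _ => emb (some (.inl (start c))))
          (.goto fun _ => emb (some (.inr (start d)))) := hM _
    by_cases hp : p v
    · have h2 := ih
      rw [if_pos hp] at h2
      have h3 := h2 (fun l => emb (some (.inl l))) exit (fun l => hM _) (fun l => hQ _)
      rw [← h3]
      simp [flip, step, hq, hm, hp]
    · have h2 := ih
      rw [if_neg hp] at h2
      have h3 := h2 (fun l => emb (some (.inr l))) exit (fun l => hM _) (fun l => hQ _)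
      rw [← h3]
      simp [flip, step, hq, hm, hp]
  | @loop_false p c v S hp =>
    have hq : Q (emb (start (loop p c))) = none := hQ _
    have hm : M (emb (start (loop p c))) =
      .branch p (.goto fun _ => emb (some (start c))) (.goto fun _ => exit) := hM _
    simp [flip, step, hq, hm, hp]
  | @loop_true p c v S t v' S' t' v'' S'' hp _ _ ih1 ih2 =>
    have hq : Q (emb (start (loop p c))) = none := hQ _
    have hm : M (emb (start (loop p c))) =
      .branch p (.goto fun _ => emb (some (start c))) (.goto fun _ => exit) := hM _
    have h1 := ih1 (fun l => emb (some l)) (emb (start (loop p c))) (fun l => hM _) (fun l => hQ _)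
    have h2 := ih2 emb exit hM hQ
    rw [Nat.add_comm, Nat.add_comm 1 t, Function.iterate_add_apply, Function.iterate_add_apply,
      ← h2, ← h1]
    simp [flip, step, hq, hm, hp]

/-- The stacks that a program uses. -/
def used : Prog K Γ → Set K
  | push k _ => {k}
  | pop k => {k}
  | load _ => ∅
  | ask _ => ∅
  | seq c d => used c ∪ used d
  | ite _ c d => used c ∪ used d
  | loop _ c => used c

theorem finite_used (c : Prog K Γ) : c.used.Finite := by
  induction c with
  | push | pop => exact Set.finite_singleton _
  | load | ask => exact Set.finite_empty
  | seq c d hc hd => exact hc.union hd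
  | ite p c d hc hd => exact hc.union hd
  | loop p c hc => exact hc

/-- Renaming the stacks of a program. -/
def map (f : K → K') : Prog K Γ → Prog K' Γ
  | push k g => push (f k) g
  | pop k => pop (f k)
  | load g => load g
  | ask g => ask g
  | seq c d => seq (map f c) (map f d)
  | ite p c d => ite p (map f c) (map f d)
  | loop p c => loop p (map f c)

/-- Programs are written over infinitely many stacks, while a machine has finitely many; renaming
restricts a program to the stacks that it uses. -/
theorem exec_map [DecidableEq K] [DecidableEq K'] {A : Set (List Bool)} {qk : K} {qs : Γ → Bool} {c : Prog K Γ}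
    {v v' : Option Γ} {S S' : K → List Γ} {t : ℕ} (h : Exec A qk qs c v S t v' S')
    (f : K → K') {U : Set K} (hf : Set.InjOn f U) (hc : c.used ⊆ U) (hq : qk ∈ U)
    (R : K' → List Γ) (hR : ∀ k ∈ U, R (f k) = S k) :
    ∃ R', Exec A (f qk) qs (c.map f) v R t v' R' ∧ ∀ k ∈ U, R' (f k) = S' k := by
  have key : ∀ (k : K) (x : List Γ) (S : K → List Γ) (R : K' → List Γ), k ∈ U →
      (∀ k ∈ U, R (f k) = S k) →
      ∀ j ∈ U, Function.update R (f k) x (f j) = Function.update S k x j := by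
    intro k x S R hk hR j hj
    by_cases h : j = k
    · subst h; simp
    · rw [Function.update_of_ne h, Function.update_of_ne fun h' => h (hf hj hk h'), hR j hj]
  induction h generalizing R with
  | push k g v S =>
    have hk : k ∈ U := hc rfl
    refine ⟨_, .push _ _ _ _, ?_⟩
    rw [hR k hk]
    exact key _ _ _ _ hk hR
  | pop k v S =>
    have hk : k ∈ U := hc rfl
    rw [← hR k hk]
    exact ⟨_, .pop _ _ _, key _ _ _ _ hk hR⟩
  | load g v S => exact ⟨_, .load _ _ _, hR⟩
  | ask g v S =>
    rw [← hR qk hq]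
    exact ⟨_, .ask _ _ _, key _ _ _ _ hq hR⟩
  | seq _ _ ih1 ih2 =>
    obtain ⟨R₁, h1, hR₁⟩ := ih1 (fun k hk => hc (.inl hk)) R hR
    obtain ⟨R₂, h2, hR₂⟩ := ih2 (fun k hk => hc (.inr hk)) R₁ hR₁
    exact ⟨R₂, .seq h1 h2, hR₂⟩
  | @ite p c d v S t v' S' _ ih =>
    obtain ⟨R₁, h1, hR₁⟩ := ih (fun k hk => hc (by split_ifs at hk; exacts [.inl hk, .inr hk])) R hR
    refine ⟨R₁, .ite ?_, hR₁⟩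
    split_ifs at h1 ⊢ <;> exact h1
  | loop_false hp => exact ⟨R, .loop_false hp, hR⟩
  | loop_true hp _ _ ih1 ih2 =>
    obtain ⟨R₁, h1, hR₁⟩ := ih1 hc R hR
    obtain ⟨R₂, h2, hR₂⟩ := ih2 hc R₁ hR₁
    exact ⟨R₂, .loop_true hp h1 h2, hR₂⟩

open Classical in
/-- A program that decides `L` yields an oracle machine that decides `L`. -/
theorem inPWithOracle [DecidableEq K] {α : Type} [Finite Γ] {A : Set (List Bool)} {L : Set (List α)}
    (c : Prog K Γ) (ik qk : K) (is : α → Γ) (qs : Γ → Bool) (p : Polynomial ℕ)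
    (h : ∀ w : List α, ∃ v S, ∃ t ≤ p.eval w.length,
      Exec A qk qs c none (Function.update (fun _ => []) ik (w.map is)) t v S ∧
        (v.isSome ↔ w ∈ L)) : InPWithOracle A L := by
  set U : Set K := c.used ∪ {ik, qk} with hU
  have hUfin : U.Finite := c.finite_used.union (by simp)
  have hik : ik ∈ U := .inr (.inl rfl)
  have hqk : qk ∈ U := .inr (.inr rfl)
  -- The value outside `U` is arbitrary: such stacks do not occur in `c`.
  let f : K → U := fun k => if h : k ∈ U then ⟨k, h⟩ else ⟨ik, hik⟩
  have hfU : ∀ k (h : k ∈ U), f k = ⟨k, h⟩ := fun k h => dif_pos h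
  have hf : Set.InjOn f U := by
    intro k hk j hj hkj
    rw [hfU k hk, hfU j hj] at hkj
    exact congrArg Subtype.val hkj
  let d : Prog U Γ := c.map f
  have : Finite U := hUfin
  have : Finite d.Lab := d.finite_lab
  let Pr : Option d.Lab → Turing.TM2.Stmt (fun _ : U => Γ) (Option d.Lab) (Option Γ) :=
    fun l => Option.elim l .halt (code d some none)
  let Qu : Option d.Lab → Option (Bool → Option d.Lab) :=
    fun l => Option.elim l none (queries d some)
  let M : OracleMachine α :=
    { K := U
      Γ := fun _ => Γ
      Λ := Option d.Lab
      σ := Option Γ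
      inputStack := f ik
      inputSymbol := is
      queryStack := f qk
      querySymbol := qs
      startLabel := some d.start
      startState := none
      program := Pr
      query := Qu
      accept := Option.isSome }
  -- The additional step executes the halting statement at the exit label.
  refine ⟨M, p + 1, fun w => ?_⟩
  obtain ⟨v, S, t, ht, hexec, hv⟩ := h w
  obtain ⟨R, hR, -⟩ := exec_map hexec f hf Set.subset_union_left hqk
    (Function.update (fun _ => []) (f ik) (w.map is)) (by
      intro k hk
      by_cases h : k = ik
      · subst h; simp
      · rw [Function.update_of_ne h, Function.update_of_ne fun h' => h (hf hk hik h')])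
  have hrun := iterate_step_of_exec hR Pr Qu some none (fun _ => rfl) (fun _ => rfl)
  have hstep : M.step A = step A (f qk) qs Pr Qu := by
    funext ⟨l, v, S⟩
    cases l with
    | none => rfl
    | some l =>
      simp only [OracleMachine.step, step]
      rcases hq : Qu l with _ | next
      · have hq' : M.query l = none := hq
        simp only [hq']
        rfl
      · have hq' : M.query l = some next := hq
        simp only [hq']
        rfl
  refine ⟨v, R, ⟨⟨⟨t + 1, ?_⟩, by simpa using ht⟩⟩, hv⟩
  rw [hstep, Nat.add_comm, Function.iterate_add_apply]
  exact (congrArg _ hrun).trans (by simp [flip, step, Pr, Qu])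

end Prog

/-! ### Programs on unary registers and a read-only tape -/

/-- The stacks of a register program: the tape with the input is the pair of `input` and `scratch`,
and the registers contain numbers in unary. -/
inductive Stk : Type
  | input
  | scratch
  | query
  | reg (i : ℕ)
  deriving DecidableEq

/-- The memory of a register program: the position of the head on the tape, the query stack and
the registers. -/
@[ext]
structure Mem (α : Type) : Type where
  pos : ℕ
  query : List (Option α)
  reg : ℕ → ℕ

namespace Mem

variable {α : Type}

/-- Changing the value of a register. -/
def set (m : Mem α) (x n : ℕ) : Mem α := { m with reg := Function.update m.reg x n }

/-- The stacks that represent a memory if the word `w` is on the tape. -/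
def stk (w : List α) (m : Mem α) : Stk → List (Option α)
  | .input => (w.drop m.pos).map some
  -- Positions beyond the end of the word leave entries `none`, so that moving back restores the
  -- input stack exactly.
  | .scratch => ((List.range m.pos).map fun i => w[i]?).reverse
  | .query => m.query
  | .reg i => List.replicate (m.reg i) none

@[simp] theorem pos_set (m : Mem α) (x n : ℕ) : (m.set x n).pos = m.pos := rfl

@[simp] theorem query_set (m : Mem α) (x n : ℕ) : (m.set x n).query = m.query := rfl

theorem reg_set (m : Mem α) (x n y : ℕ) : (m.set x n).reg y = if y = x then n else m.reg y := by
  simp [set, Function.update_apply]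

@[simp] theorem reg_set_self (m : Mem α) (x n : ℕ) : (m.set x n).reg x = n := by
  simp [set]

theorem reg_set_of_ne (m : Mem α) {x y : ℕ} (n : ℕ) (h : y ≠ x) :
    (m.set x n).reg y = m.reg y := by
  simp [set, h]

@[simp] theorem set_self (m : Mem α) (x : ℕ) : m.set x (m.reg x) = m := by
  simp [set]

theorem update_stk_reg (w : List α) (m : Mem α) (x n : ℕ) :
    Function.update (m.stk w) (.reg x) (List.replicate n none) = (m.set x n).stk w := by
  funext k
  cases k with
  | reg i =>
    by_cases h : i = x
    · subst h; simp [stk]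
    · simp [stk, h, reg_set]
  | _ => rfl

end Mem

namespace Prog

open Mem

section

variable {K Γ : Type} [DecidableEq K] {A : Set (List Bool)} {qk : K} {qs : Γ → Bool} {k : K}
  {v v' : Option Γ} {S S' : K → List Γ}

theorem exec_push {f : Option Γ → Γ} (h : Function.update S k (f v :: S k) = S') :
    Exec A qk qs (push k f) v S 1 v S' :=
  h ▸ .push _ _ _ _

theorem exec_pop (h : (S k).head? = v') (h' : Function.update S k (S k).tail = S') :
    Exec A qk qs (pop k) v S 1 v' S' :=
  h ▸ h' ▸ .pop _ _ _

theorem exec_load_id (h : S = S') : Exec A qk qs (load id) v S 1 v S' :=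
  h ▸ .load id _ _

end

variable {α : Type} {A : Set (List Bool)} {qs : Option α → Bool} {w : List α}
  {c d : Prog Stk (Option α)} {m m' m'' : Mem α} {T T' : ℕ}

/-- With the word `w` on the tape, the program leads from the memory `m` to `m'` in at most `T`
steps. -/
def Runs (A : Set (List Bool)) (qs : Option α → Bool) (w : List α) (c : Prog Stk (Option α))
    (m : Mem α) (T : ℕ) (m' : Mem α) : Prop :=
  ∀ v, ∃ v', ∃ t ≤ T, Exec A .query qs c v (m.stk w) t v' (m'.stk w)

theorem Runs.mono (h : Runs A qs w c m T m') (hT : T ≤ T') : Runs A qs w c m T' m' := by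
  intro v
  obtain ⟨v', t, ht, h⟩ := h v
  exact ⟨v', t, ht.trans hT, h⟩

theorem Runs.seq (h : Runs A qs w c m T m') (h' : Runs A qs w d m' T' m'') :
    Runs A qs w (c.seq d) m (T + T') m'' := by
  intro v
  obtain ⟨v', t, ht, h⟩ := h v
  obtain ⟨v'', t', ht', h'⟩ := h' v'
  exact ⟨v'', _, Nat.add_le_add ht ht', .seq h h'⟩

/-- Do nothing. -/
def skip : Prog Stk (Option α) := load id

/-- Increment a register. -/
def inc (x : ℕ) : Prog Stk (Option α) := push (.reg x) fun _ => none

/-- Decrement a register. -/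
def dec (x : ℕ) : Prog Stk (Option α) := pop (.reg x)

/-- Decrement the register `x` until it is zero, and execute `c` each time. -/
def forReg (x : ℕ) (c : Prog Stk (Option α)) : Prog Stk (Option α) :=
  seq (pop (.reg x)) (loop Option.isSome (seq c (pop (.reg x))))

theorem runs_skip : Runs A qs w skip m 1 m :=
  fun v => ⟨v, 1, le_rfl, .load _ _ _⟩

theorem runs_inc (x : ℕ) : Runs A qs w (inc x) m 1 (m.set x (m.reg x + 1)) := by
  intro v
  refine ⟨v, 1, le_rfl, ?_⟩
  rw [← update_stk_reg, List.replicate_succ]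
  exact .push _ _ _ _

theorem exec_pop_reg (x : ℕ) (v : Option (Option α)) :
    Exec A .query qs (pop (.reg x)) v (m.stk w) 1 (m.stk w (.reg x)).head?
      ((m.set x (m.reg x - 1)).stk w) := by
  rw [← update_stk_reg, ← List.tail_replicate]
  exact .pop _ _ _

theorem runs_dec (x : ℕ) : Runs A qs w (dec x) m 1 (m.set x (m.reg x - 1)) :=
  fun v => ⟨_, 1, le_rfl, exec_pop_reg x v⟩

/-- `st i` is the memory before round `i`; the body starts with `x` already decremented. A round
costs a test, the body and a pop, and the first pop and the last test account for the final `2`. -/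
theorem runs_forReg {x : ℕ} (n : ℕ) (st : ℕ → Mem α) (hx : ∀ i ≤ n, (st i).reg x = n - i)
    (hc : ∀ i < n, Runs A qs w c ((st i).set x (n - i - 1)) T (st (i + 1))) :
    Runs A qs w (forReg x c) (st 0) (n * (T + 2) + 2) (st n) := by
  have key : ∀ j ≤ n, ∃ v', ∃ t ≤ j * (T + 2) + 1,
      Exec A .query qs (loop Option.isSome (seq c (pop (.reg x))))
        (((st (n - j)).stk w (.reg x)).head?)
        (((st (n - j)).set x ((st (n - j)).reg x - 1)).stk w) t v' ((st n).stk w) := by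
    intro j hj
    induction j with
    | zero =>
      have h0 : (st n).reg x = 0 := by simpa using hx n le_rfl
      have h1 : (st n).set x ((st n).reg x - 1) = st n := by
        conv_rhs => rw [← set_self (st n) x]
        rw [h0]
      have h2 : (st n).stk w (.reg x) = [] := by simp [stk, h0]
      refine ⟨none, 1, by simp, ?_⟩
      rw [Nat.sub_zero, h1, h2]
      exact .loop_false rfl
    | succ j ih =>
      have hr : (st (n - (j + 1))).reg x = j + 1 := by rw [hx _ (by omega)]; omega
      have hh : ((st (n - (j + 1))).stk w (.reg x)).head? = some none := by
        simp [stk, hr, List.replicate_succ]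
      obtain ⟨v₁, t₁, ht₁, h₁⟩ := hc (n - (j + 1)) (by omega) (some none)
      rw [show n - (j + 1) + 1 = n - j by omega, show n - (n - (j + 1)) - 1 = j by omega] at h₁
      obtain ⟨v₂, t₂, ht₂, h₂⟩ := ih (by omega)
      refine ⟨v₂, 1 + (t₁ + 1) + t₂, by rw [Nat.succ_mul]; omega, ?_⟩
      rw [hh, hr]
      exact .loop_true rfl (.seq h₁ (exec_pop_reg x v₁)) h₂
  intro v
  obtain ⟨v', t, ht, h⟩ := key n le_rfl
  rw [Nat.sub_self] at h
  exact ⟨v', 1 + t, by omega, .seq (exec_pop_reg x v) h⟩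

/-- Set a register to zero. -/
def clear (x : ℕ) : Prog Stk (Option α) := forReg x skip

theorem runs_clear (x : ℕ) : Runs A qs w (clear x) m (m.reg x * 3 + 2) (m.set x 0) := by
  have := runs_forReg (A := A) (qs := qs) (w := w) (c := skip) (T := 1) (x := x) (m.reg x)
    (fun i => m.set x (m.reg x - i)) (fun i _ => by simp) (fun i hi => by
      have : (m.set x (m.reg x - i)).set x (m.reg x - i - 1) = m.set x (m.reg x - (i + 1)) := by
        ext j <;> simp [reg_set, Nat.sub_sub]
        grind
      rw [this]
      exact runs_skip)
  simpa [clear] using this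

/-- Add the register `x` to the register `y` and set `x` to zero. -/
def move (x y : ℕ) : Prog Stk (Option α) := forReg x (inc y)

theorem runs_move {x y : ℕ} (h : x ≠ y) :
    Runs A qs w (move x y) m (m.reg x * 3 + 2) ((m.set y (m.reg y + m.reg x)).set x 0) := by
  have := runs_forReg (A := A) (qs := qs) (w := w) (c := inc y) (T := 1) (x := x) (m.reg x)
    (fun i => (m.set y (m.reg y + i)).set x (m.reg x - i)) (fun i _ => by simp) (fun i hi => by
      refine (congrArg _ ?_).mp (runs_inc y)
      ext j <;> simp [reg_set]
      grind)
  have h0 : (m.set y (m.reg y + 0)).set x (m.reg x - 0) = m := by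
    ext j <;> simp
  rw [h0] at this
  simpa [move] using this

/-- Add the register `x` to the register `y`, with an auxiliary register `z`. -/
def copy (x y z : ℕ) : Prog Stk (Option α) := seq (forReg x (seq (inc y) (inc z))) (move z x)

theorem runs_copy {x y z : ℕ} (hxy : x ≠ y) (hxz : x ≠ z) (hyz : y ≠ z) (hz : m.reg z = 0) :
    Runs A qs w (copy x y z) m (m.reg x * 7 + 4) (m.set y (m.reg y + m.reg x)) := by
  have h1 := runs_forReg (A := A) (qs := qs) (w := w) (c := seq (inc y) (inc z)) (T := 2)
    (x := x) (m.reg x)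
    (fun i => ((m.set y (m.reg y + i)).set x (m.reg x - i)).set z i)
    (fun i _ => by simp [reg_set, hxz]) (fun i hi => by
      refine (congrArg _ ?_).mp ((runs_inc y).seq (runs_inc z))
      ext j <;> simp [reg_set]
      grind)
  have h2 := runs_move (A := A) (qs := qs) (w := w)
    (m := ((m.set y (m.reg y + m.reg x)).set x (m.reg x - m.reg x)).set z (m.reg x)) hxz.symm
  have h0 : ((m.set y (m.reg y + 0)).set x (m.reg x - 0)).set z 0 = m := by
    ext j <;> simp [reg_set]
    grind
  rw [h0] at h1
  have h3 := h1.seq h2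
  refine ((congrArg _ ?_).mp h3).mono ?_
  · ext j <;> simp [reg_set]
    grind
  · simp only [reg_set_self]
    omega

/-- Move the head to the right. -/
def advance : Prog Stk (Option α) := seq (pop .input) (push .scratch Option.join)

/-- Move the head to the left. -/
def back : Prog Stk (Option α) :=
  seq (pop .scratch) (ite (fun v => v.join.isSome) (push .input Option.join) skip)

theorem update_stk_advance (m : Mem α) : Function.update (Function.update (m.stk w) .input
    (m.stk w .input).tail) .scratch (w[m.pos]? :: m.stk w .scratch) =
      ({ m with pos := m.pos + 1 } : Mem α).stk w := by
  funext k
  cases k with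
  | input => simp [stk]
  | scratch => simp [stk, List.range_succ]
  | query => rfl
  | reg i => rfl

theorem runs_advance : Runs A qs w advance m 2 { m with pos := m.pos + 1 } := by
  intro v
  refine ⟨_, 2, le_rfl, .seq (t := 1) (t' := 1) (.pop _ _ _) (exec_push ?_)⟩
  rw [← update_stk_advance]
  congr 1
  simp [stk]
  rcases w[m.pos]? <;> rfl

theorem runs_back : Runs A qs w back { m with pos := m.pos + 1 } 3 m := by
  intro v
  have h1 : ({ m with pos := m.pos + 1 } : Mem α).stk w .scratch =
      w[m.pos]? :: m.stk w .scratch := by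
    simp [stk, List.range_succ]
  refine ⟨some (w[m.pos]?), 3, le_rfl, .seq (t := 1) (t' := 2)
    (v' := some (w[m.pos]?)) (S' := Function.update (({ m with pos := m.pos + 1 } : Mem α).stk w)
      .scratch (m.stk w .scratch)) ?_ (.ite (t := 1) ?_)⟩
  · exact exec_pop (by rw [h1]; rfl) (by rw [h1]; rfl)
  · rcases hw : w[m.pos]? with _ | a
    · rw [if_neg (by simp)]
      apply exec_load_id
      rw [List.getElem?_eq_none_iff] at hw
      funext k
      cases k with
      | input => simp [stk, List.drop_eq_nil_of_le hw, List.drop_eq_nil_of_le (hw.trans (Nat.le_succ _))]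
      | _ => rfl
    · rw [if_pos (by simp)]
      apply exec_push
      obtain ⟨hlt, ha⟩ := List.getElem?_eq_some_iff.mp hw
      funext k
      cases k with
      | input => simp [stk, List.drop_eq_getElem_cons hlt, ha]
      | _ => rfl

open Classical in
/-- Test whether the letter at the head is `a`. If it is, increment the register `y`. -/
noncomputable def testLetter (a : α) (y : ℕ) : Prog Stk (Option α) :=
  seq (pop .input) (seq (ite (fun v => decide (v = some (some a))) (inc y) skip)
    (ite (fun v => v.join.isSome) (push .input Option.join) skip))

open Classical in
theorem runs_testLetter (a : α) (y : ℕ) : Runs A qs w (testLetter a y) m 5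
    (m.set y (m.reg y + if w[m.pos]? = some a then 1 else 0)) := by
  intro v
  set m' := m.set y (m.reg y + if w[m.pos]? = some a then 1 else 0) with hm'
  have h1 : (m.stk w .input).head? = w[m.pos]?.map some := by simp [stk]
  refine ⟨w[m.pos]?.map some, 5, le_rfl, .seq (t := 1) (t' := 4)
    (v' := w[m.pos]?.map some) (S' := Function.update (m.stk w) .input (m.stk w .input).tail) ?_
    (.seq (t := 2) (t' := 2) (v' := w[m.pos]?.map some)
      (S' := Function.update (m'.stk w) .input (m.stk w .input).tail)
      (.ite (t := 1) ?_) (.ite (t := 1) ?_))⟩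
  · rw [← h1]
    exact .pop _ _ _
  · by_cases hw : w[m.pos]? = some a
    · rw [if_pos (by simp [hw])]
      apply exec_push
      rw [hm', if_pos hw, ← update_stk_reg, Function.update_comm (by simp), List.replicate_succ]
      simp [stk]
    · have hw' : ¬ (w[m.pos]?.map some = some (some a)) := by
        rcases h : w[m.pos]? with _ | b
        · simp
        · simpa [h] using hw
      rw [if_neg (by simpa using hw')]
      have : m' = m := by simp [hm', hw]
      rw [this]
      exact .load _ _ _
  · have h2 : m'.stk w .input = m.stk w .input := rfl
    rcases hw : w[m.pos]? with _ | b
    · rw [if_neg (by simp)]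
      apply exec_load_id
      rw [List.getElem?_eq_none_iff] at hw
      have h3 : m.stk w .input = [] := by simp [stk, List.drop_eq_nil_of_le hw]
      rw [h3, List.tail_nil, ← h3, ← h2, Function.update_eq_self]
    · rw [if_pos (by simp)]
      apply exec_push
      obtain ⟨hlt, hb⟩ := List.getElem?_eq_some_iff.mp hw
      have h3 : m.stk w .input = some b :: (m.stk w .input).tail := by
        simp [stk, List.drop_eq_getElem_cons hlt, hb]
      simp only [Function.update_self, Function.update_idem]
      conv_rhs => rw [← Function.update_eq_self (f := m'.stk w) (a := Stk.input), h2, h3]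
      rfl

/-- Increment the register `y` if `a` is the letter at the position given by the register `x`, and
set `x` to zero; `z` is an auxiliary register. -/
noncomputable def readLetter (a : α) (x y z : ℕ) : Prog Stk (Option α) :=
  seq (forReg x (seq advance (inc z))) (seq (testLetter a y) (forReg z back))

-- The register `z` records how far the head has moved, so that it can return to the first letter.
open Classical in
theorem runs_readLetter (a : α) {x y z : ℕ} (hxy : x ≠ y) (hxz : x ≠ z) (hyz : y ≠ z)
    (hm : m.pos = 0) (hz : m.reg z = 0) :
    Runs A qs w (readLetter a x y z) m (m.reg x * 10 + 9)
      ((m.set y (m.reg y + if w[m.reg x]? = some a then 1 else 0)).set x 0) := by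
  have h1 := runs_forReg (A := A) (qs := qs) (w := w) (c := seq advance (inc z)) (T := 3)
    (x := x) (m.reg x)
    (fun i => { (m.set x (m.reg x - i)).set z i with pos := i })
    (fun i _ => by simp [reg_set, hxz]) (fun i hi => by
      refine (congrArg _ ?_).mp (runs_advance.seq (runs_inc z))
      ext j
      · simp
      · simp
      · simp only [reg_set]
        grind)
  have h2 := runs_testLetter (A := A) (qs := qs) (w := w) a y
    (m := { (m.set x (m.reg x - m.reg x)).set z (m.reg x) with pos := m.reg x })
  set b := if w[m.reg x]? = some a then 1 else 0 with hb
  have h3 := runs_forReg (A := A) (qs := qs) (w := w) (c := back) (T := 3)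
    (x := z) (m.reg x)
    (fun i => { ((m.set y (m.reg y + b)).set x 0).set z (m.reg x - i) with pos := m.reg x - i })
    (fun i _ => by simp) (fun i hi => by
      have := runs_back (A := A) (qs := qs) (w := w)
        (m := { ((m.set y (m.reg y + b)).set x 0).set z (m.reg x - (i + 1)) with
          pos := m.reg x - (i + 1) })
      refine (congrArg (fun m₁ => Runs A qs w back m₁ 3 _) ?_).mp this
      ext j
      · simp
        omega
      · simp
      · simp only [reg_set]
        grind)
  have h4 := h1.seq (h2.seq ((congrArg (fun m₁ => Runs A qs w (forReg z back) m₁ _ _) ?_).mp h3))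
  · have h0 : ({ (m.set x (m.reg x - 0)).set z 0 with pos := 0 } : Mem α) = m := by
      ext j
      · simp [hm]
      · simp
      · simp only [reg_set]
        grind
    rw [h0] at h4
    refine ((congrArg _ ?_).mp h4).mono (by omega)
    ext j
    · simp [hm]
    · simp
    · simp only [reg_set]
      grind
  · ext j
    · simp
    · simp
    · simp only [reg_set]
      grind

end Prog

/-! ### Bounded arithmetic terms and their evaluation in polynomial time -/

/-- Arithmetic terms about a word. The binder `sum t b` gives the next free number to its
variable. -/
inductive ATerm (α : Type) : Type
  | var (k : ℕ)
  | one
  | add (a b : ATerm α)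
  | sub (a b : ATerm α)
  | mul (a b : ATerm α)
  | sum (t b : ATerm α)
  | letter (a : α) (t : ATerm α)

namespace ATerm

variable {α : Type}

open Classical in
/-- The value of a term for the word `w` and the values `e` of the variables. -/
noncomputable def eval (w : List α) : ATerm α → List ℕ → ℕ
  | var k, e => e.getD k 0
  | one, _ => 1
  | add a b, e => eval w a e + eval w b e
  | sub a b, e => eval w a e - eval w b e
  | mul a b, e => eval w a e * eval w b e
  | sum t b, e => ∑ i ∈ Finset.range (eval w t e), eval w b (e ++ [i])
  | letter a t, e => if w[eval w t e]? = some a then 1 else 0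

open Prog

/-- A program that evaluates a term. The variables are in the registers `env`, the registers from
`d` on are free, and the value goes to the register `d`. -/
noncomputable def compile : ATerm α → List ℕ → ℕ → Prog Stk (Option α)
  | var k, env, d => Option.elim env[k]? skip fun x => copy x d (d + 1)
  | one, _, d => inc d
  | add a b, env, d => seq (compile a env d) (seq (compile b env (d + 1)) (move (d + 1) d))
  | sub a b, env, d =>
      seq (compile a env d) (seq (compile b env (d + 1)) (forReg (d + 1) (dec d)))
  | mul a b, env, d => seq (compile a env (d + 1))
      (forReg (d + 1) (seq (compile b env (d + 2)) (move (d + 2) d)))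
  | sum t b, env, d => seq (compile t env (d + 1)) (seq
      (forReg (d + 1)
        (seq (compile b (env ++ [d + 2]) (d + 3)) (seq (move (d + 3) d) (inc (d + 2)))))
      (clear (d + 2)))
  | letter a t, env, d => seq (compile t env (d + 1)) (readLetter a (d + 1) d (d + 2))

theorem map_reg_set {m : Mem α} {env : List ℕ} {d x n : ℕ} (henv : ∀ i ∈ env, i < d)
    (hx : d ≤ x) : env.map (m.set x n).reg = env.map m.reg :=
  List.map_congr_left fun i hi => m.reg_set_of_ne n (by have := henv i hi; omega)

/-- Correctness and polynomial running time of the evaluation of terms. -/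
theorem compile_runs (t : ATerm α) : ∃ q : Polynomial ℕ, ∀ (A : Set (List Bool))
    (qs : Option α → Bool) (w : List α) (M : ℕ) (env : List ℕ) (d : ℕ) (m : Mem α), m.pos = 0 →
    (∀ i ∈ env, i < d) → (∀ j, d ≤ j → m.reg j = 0) → (∀ i ∈ env, m.reg i ≤ M) →
    t.eval w (env.map m.reg) ≤ q.eval M ∧
      Runs A qs w (t.compile env d) m (q.eval M) (m.set d (t.eval w (env.map m.reg))) := by
  induction t with
  | var k =>
    refine ⟨7 * Polynomial.X + 4, fun A qs w M env d m hp henv hfree hM => ?_⟩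
    rcases hk : env[k]? with _ | x
    · simp only [compile, eval, hk, List.getD_eq_getElem?_getD, List.getElem?_map, Option.map_none,
        Option.getD_none, Option.elim_none]
      have : m.set d 0 = m := by rw [← hfree d le_rfl, Mem.set_self]
      rw [this]
      exact ⟨Nat.zero_le _, runs_skip.mono (by simp)⟩
    · have hx : x ∈ env := List.mem_of_getElem? hk
      have hxd := henv x hx
      have hxM := hM x hx
      simp only [compile, eval, hk, List.getD_eq_getElem?_getD, List.getElem?_map, Option.map_some,
        Option.getD_some, Option.elim_some]
      have := runs_copy (A := A) (qs := qs) (w := w) (m := m) (x := x) (y := d) (z := d + 1)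
        (by omega) (by omega) (by omega) (hfree _ (by omega))
      rw [hfree d le_rfl, zero_add] at this
      refine ⟨by simp; omega, this.mono (by simp; omega)⟩
  | one =>
    refine ⟨1, fun A qs w M env d m hp henv hfree hM => ?_⟩
    have := runs_inc (A := A) (qs := qs) (w := w) (m := m) d
    rw [hfree d le_rfl] at this
    simpa [compile, eval] using this
  | add a b iha ihb =>
    obtain ⟨qa, ha⟩ := iha
    obtain ⟨qb, hb⟩ := ihb
    -- The value of `b` is at most `qb`, so moving it costs `3 * qb + 2` in addition to its
    -- evaluation.
    refine ⟨qa + 4 * qb + 2, fun A qs w M env d m hp henv hfree hM => ?_⟩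
    obtain ⟨hva, hra⟩ := ha A qs w M env d m hp henv hfree hM
    set va := a.eval w (env.map m.reg) with hva'
    have henv' : ∀ i ∈ env, i < d + 1 := fun i hi => (henv i hi).trans (Nat.lt_succ_self d)
    obtain ⟨hvb, hrb⟩ := hb A qs w M env (d + 1) (m.set d va) hp henv'
      (fun j hj => by rw [Mem.reg_set_of_ne _ _ (by omega)]; exact hfree j (by omega))
      (fun i hi => by rw [Mem.reg_set_of_ne _ _ (henv i hi).ne]; exact hM i hi)
    rw [map_reg_set henv le_rfl] at hvb hrb
    set vb := b.eval w (env.map m.reg) with hvb'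
    have hmv := runs_move (A := A) (qs := qs) (w := w) (m := (m.set d va).set (d + 1) vb)
      (x := d + 1) (y := d) (by omega)
    refine ⟨by simp [eval]; omega, ((congrArg _ ?_).mp (hra.seq (hrb.seq hmv))).mono ?_⟩
    · have := hfree (d + 1) (by omega)
      ext j <;> simp [Mem.reg_set, eval]
      grind
    · simp
      omega
  | sub a b iha ihb =>
    obtain ⟨qa, ha⟩ := iha
    obtain ⟨qb, hb⟩ := ihb
    refine ⟨qa + 4 * qb + 2, fun A qs w M env d m hp henv hfree hM => ?_⟩
    obtain ⟨hva, hra⟩ := ha A qs w M env d m hp henv hfree hM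
    set va := a.eval w (env.map m.reg) with hva'
    have henv' : ∀ i ∈ env, i < d + 1 := fun i hi => (henv i hi).trans (Nat.lt_succ_self d)
    obtain ⟨hvb, hrb⟩ := hb A qs w M env (d + 1) (m.set d va) hp henv'
      (fun j hj => by rw [Mem.reg_set_of_ne _ _ (by omega)]; exact hfree j (by omega))
      (fun i hi => by rw [Mem.reg_set_of_ne _ _ (henv i hi).ne]; exact hM i hi)
    rw [map_reg_set henv le_rfl] at hvb hrb
    set vb := b.eval w (env.map m.reg) with hvb'
    have hmv := runs_forReg (A := A) (qs := qs) (w := w) (c := dec d) (T := 1) (x := d + 1) vb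
      (fun i => (m.set d (va - i)).set (d + 1) (vb - i)) (fun i _ => by simp) (fun i hi => by
        refine (congrArg _ ?_).mp (runs_dec d)
        ext j <;> simp [Mem.reg_set]
        grind)
    refine ⟨by simp [eval]; omega, ((congrArg _ ?_).mp (hra.seq (hrb.seq hmv))).mono ?_⟩
    · have := hfree (d + 1) (by omega)
      ext j <;> simp [Mem.reg_set, eval]
      grind
    · simp
      omega
  | mul a b iha ihb =>
    obtain ⟨qa, ha⟩ := iha
    obtain ⟨qb, hb⟩ := ihb
    -- There are at most `qa` rounds. Each evaluates `b` anew and adds its value to the register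
    -- `d`, in `4 * qb + 2` steps, with two more for the loop.
    refine ⟨qa + qa * (4 * qb + 4) + 2, fun A qs w M env d m hp henv hfree hM => ?_⟩
    have henv' : ∀ i ∈ env, i < d + 1 := fun i hi => (henv i hi).trans (Nat.lt_succ_self d)
    obtain ⟨hva, hra⟩ := ha A qs w M env (d + 1) m hp henv' (fun j hj => hfree j (by omega)) hM
    set va := a.eval w (env.map m.reg) with hva'
    have hvb := (hb A qs w M env (d + 2) m hp (fun i hi => by have := henv i hi; omega)
      (fun j hj => hfree j (by omega)) hM).1
    set vb := b.eval w (env.map m.reg) with hvb'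
    have hfor := runs_forReg (A := A) (qs := qs) (w := w)
      (c := seq (b.compile env (d + 2)) (move (d + 2) d)) (T := 4 * qb.eval M + 2) (x := d + 1) va
      (fun i => (m.set d (i * vb)).set (d + 1) (va - i)) (fun i _ => by simp) (fun i hi => by
        set m' := ((m.set d (i * vb)).set (d + 1) (va - i)).set (d + 1) (va - i - 1) with hm'
        have hmap : env.map m'.reg = env.map m.reg := by
          rw [hm', map_reg_set henv (by omega), map_reg_set henv (by omega), map_reg_set henv le_rfl]
        obtain ⟨-, hrb⟩ := hb A qs w M env (d + 2) m' hp
          (fun i hi => by have := henv i hi; omega)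
          (fun j hj => by
            simp only [hm', Mem.reg_set]
            rw [if_neg (by omega), if_neg (by omega), if_neg (by omega)]
            exact hfree j (by omega))
          (fun i hi => by
            have := henv i hi
            simp only [hm', Mem.reg_set]
            rw [if_neg (by omega), if_neg (by omega), if_neg (by omega)]
            exact hM i hi)
        rw [hmap] at hrb
        refine ((congrArg _ ?_).mp (hrb.seq (runs_move (by omega)))).mono ?_
        · have := hfree (d + 2) (by omega)
          ext j <;> simp [Mem.reg_set, hm']
          grind
        · simp
          omega)
    have h0 : (m.set d (0 * vb)).set (d + 1) (va - 0) = m.set (d + 1) va := by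
      have := hfree d le_rfl
      ext j <;> simp [Mem.reg_set]
      grind
    rw [h0] at hfor
    have hmulle : va * (4 * qb.eval M + 4) ≤ qa.eval M * (4 * qb.eval M + 4) :=
      Nat.mul_le_mul_right _ hva
    have hmulle' : va * vb ≤ qa.eval M * (4 * qb.eval M + 4) :=
      Nat.mul_le_mul hva (by omega)
    have hexp : va * (4 * qb.eval M + 2 + 2) = va * (4 * qb.eval M + 4) := by ring
    refine ⟨?_, ((congrArg _ ?_).mp (hra.seq hfor)).mono ?_⟩
    · simp only [eval, ← hva', ← hvb', Polynomial.eval_add, Polynomial.eval_mul,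
        Polynomial.eval_ofNat]
      omega
    · have := hfree (d + 1) (by omega)
      simp only [eval, ← hva', ← hvb']
      ext j <;> simp [Mem.reg_set]
      grind
    · simp only [Polynomial.eval_add, Polynomial.eval_mul, Polynomial.eval_ofNat]
      omega
  | sum a b iha ihb =>
    obtain ⟨qa, ha⟩ := iha
    obtain ⟨qb, hb⟩ := ihb
    -- The bound variable stays below the value of `a`, so the body is evaluated with variables at
    -- most `M + qa.eval M`, whence the composition.
    refine ⟨qa + qa * (4 * qb.comp (Polynomial.X + qa) + 10) + 4,
      fun A qs w M env d m hp henv hfree hM => ?_⟩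
    have henv' : ∀ i ∈ env, i < d + 1 := fun i hi => (henv i hi).trans (Nat.lt_succ_self d)
    obtain ⟨hva, hra⟩ := ha A qs w M env (d + 1) m hp henv' (fun j hj => hfree j (by omega)) hM
    set va := a.eval w (env.map m.reg) with hva'
    set B := qb.eval (M + qa.eval M) with hB
    set f : ℕ → ℕ := fun i => b.eval w (env.map m.reg ++ [i]) with hf
    have hb' : ∀ i s v, i < va → _ := fun i s v hi => hb A qs w (M + qa.eval M) (env ++ [d + 2])
      (d + 3) (((m.set d s).set (d + 1) v).set (d + 2) i) hp
      (fun i hi => by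
        rcases List.mem_append.mp hi with hi | hi
        · have := henv i hi; omega
        · simp at hi; omega)
      (fun j hj => by
        simp only [Mem.reg_set]
        rw [if_neg (by omega), if_neg (by omega), if_neg (by omega)]
        exact hfree j (by omega))
      (fun j hj => by
        simp only [Mem.reg_set]
        rcases List.mem_append.mp hj with hj | hj
        · have := henv j hj
          have := hM j hj
          rw [if_neg (by omega), if_neg (by omega), if_neg (by omega)]
          omega
        · simp at hj
          rw [if_pos hj]
          omega)
    have hmap : ∀ i s v, (env ++ [d + 2]).map (((m.set d s).set (d + 1) v).set (d + 2) i).reg =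
        env.map m.reg ++ [i] := by
      intro i s v
      rw [List.map_append, map_reg_set henv (by omega), map_reg_set henv (by omega),
        map_reg_set henv le_rfl]
      simp
    have hfB : ∀ i < va, f i ≤ B := by
      intro i hi
      have := (hb' i 0 0 hi).1
      rwa [hmap] at this
    have hfor := runs_forReg (A := A) (qs := qs) (w := w)
      (c := seq (b.compile (env ++ [d + 2]) (d + 3)) (seq (move (d + 3) d) (inc (d + 2))))
      (T := 4 * B + 3) (x := d + 1) va
      (fun i => ((m.set d (∑ j ∈ Finset.range i, f j)).set (d + 1) (va - i)).set (d + 2) i)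
      (fun i _ => by simp [Mem.reg_set]) (fun i hi => by
        set s := ∑ j ∈ Finset.range i, f j with hs
        obtain ⟨-, hrb⟩ := hb' i s (va - i - 1) hi
        rw [hmap] at hrb
        set m' := ((m.set d s).set (d + 1) (va - i - 1)).set (d + 2) i with hm'
        have hm'' : (((m.set d s).set (d + 1) (va - i)).set (d + 2) i).set (d + 1) (va - i - 1) =
            m' := by
          ext j <;> simp [Mem.reg_set, hm']
          grind
        rw [hm'']
        have hfi := hfB i hi
        refine ((congrArg _ ?_).mp
          (hrb.seq ((runs_move (x := d + 3) (y := d) (by omega)).seq (runs_inc (d + 2))))).mono ?_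
        · have := hfree (d + 3) (by omega)
          rw [Finset.sum_range_succ, ← hs]
          change _ = (((m.set d (s + f i)).set (d + 1) (va - (i + 1))).set (d + 2) (i + 1))
          ext j <;> simp [Mem.reg_set, hm']
          grind
        · simp only [Mem.reg_set_self]
          change B + ((f i) * 3 + 2 + 1) ≤ _
          omega)
    have h0 : ((m.set d (∑ j ∈ Finset.range 0, f j)).set (d + 1) (va - 0)).set (d + 2) 0 =
        m.set (d + 1) va := by
      have := hfree d le_rfl
      have := hfree (d + 2) (by omega)
      ext j <;> simp [Mem.reg_set]
      grind
    rw [h0] at hfor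
    have hmulle : va * (4 * B + 10) ≤ qa.eval M * (4 * B + 10) := Nat.mul_le_mul_right _ hva
    have hsum : ∑ j ∈ Finset.range va, f j ≤ va * B := by
      have := Finset.sum_le_card_nsmul (Finset.range va) f B
        (fun i hi => hfB i (Finset.mem_range.mp hi))
      simpa using this
    have hexp : va * (4 * B + 10) = 4 * (va * B) + 10 * va := by ring
    have hexp' : va * (4 * B + 3 + 2) = 4 * (va * B) + 5 * va := by ring
    refine ⟨?_, ((congrArg _ ?_).mp (hra.seq (hfor.seq (runs_clear (d + 2))))).mono ?_⟩
    · simp only [eval, Polynomial.eval_add, Polynomial.eval_mul, Polynomial.eval_comp,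
        Polynomial.eval_X, Polynomial.eval_ofNat, ← hB]
      change ∑ j ∈ Finset.range va, f j ≤ _
      omega
    · have := hfree (d + 1) (by omega)
      have := hfree (d + 2) (by omega)
      change _ = m.set d (∑ j ∈ Finset.range va, f j)
      ext j <;> simp [Mem.reg_set]
      grind
    · simp only [Mem.reg_set_self, Polynomial.eval_add, Polynomial.eval_mul, Polynomial.eval_comp,
        Polynomial.eval_X, Polynomial.eval_ofNat, ← hB]
      omega
  | letter a t ih =>
    obtain ⟨q, h⟩ := ih
    refine ⟨11 * q + 10, fun A qs w M env d m hp henv hfree hM => ?_⟩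
    have henv' : ∀ i ∈ env, i < d + 1 := fun i hi => (henv i hi).trans (Nat.lt_succ_self d)
    obtain ⟨hv, hr⟩ := h A qs w M env (d + 1) m hp henv' (fun j hj => hfree j (by omega)) hM
    set v := t.eval w (env.map m.reg) with hv'
    have hread := runs_readLetter (A := A) (qs := qs) (w := w) (m := m.set (d + 1) v) a
      (x := d + 1) (y := d) (z := d + 2) (by omega) (by omega) (by omega) hp
      (by rw [Mem.reg_set_of_ne _ _ (by omega)]; exact hfree _ (by omega))
    rw [Mem.reg_set_self, Mem.reg_set_of_ne _ _ (by omega), hfree d le_rfl, zero_add] at hread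
    refine ⟨?_, ((congrArg _ ?_).mp (hr.seq hread)).mono ?_⟩
    · simp only [eval]
      split_ifs <;> simp
    · have := hfree (d + 1) (by omega)
      have := hfree d le_rfl
      simp only [eval, ← hv']
      ext j <;> simp [Mem.reg_set]
      grind
    · simp
      omega

end ATerm

/-! ### The length of the input, and languages in `P` defined by terms. -/

namespace Prog

variable {α : Type} {A : Set (List Bool)} {qs : Option α → Bool} {w : List α} {m : Mem α}

/-- Advance to the end of the tape, and add the number of steps to the register `x`. -/
def measure (x : ℕ) : Prog Stk (Option α) :=
  seq (pop .input) (loop Option.isSome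
    (seq (push .scratch Option.join) (seq (inc x) (pop .input))))

theorem exec_measure (x : ℕ) (hm : m.pos = 0) (v : Option (Option α)) :
    Exec A .query qs (measure x) v (m.stk w) (4 * w.length + 2) none
      (({ m with pos := w.length } : Mem α).set x (m.reg x + w.length) |>.stk w) := by
  set st : ℕ → Mem α := fun i => ({ m with pos := i } : Mem α).set x (m.reg x + i) with hst
  have key : ∀ j ≤ w.length, Exec A .query qs
      (loop Option.isSome (seq (push .scratch Option.join) (seq (inc x) (pop .input))))
      ((st (w.length - j)).stk w .input).head?
      (Function.update ((st (w.length - j)).stk w) .input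
        ((st (w.length - j)).stk w .input).tail) (4 * j + 1) none ((st w.length).stk w) := by
    intro j hj
    induction j with
    | zero =>
      have h0 : (st w.length).stk w .input = [] := by simp [Mem.stk, hst]
      rw [Nat.sub_zero, h0, List.tail_nil, ← h0, Function.update_eq_self, h0]
      exact .loop_false rfl
    | succ j ih =>
      set i := w.length - (j + 1) with hi
      have hsucc : w.length - j = i + 1 := by omega
      rw [hsucc] at ih
      have hlt : i < w.length := by omega
      have hin : (st i).stk w .input = some w[i] :: (w.drop (i + 1)).map some := by
        change (w.drop i).map some = _
        rw [List.drop_eq_getElem_cons hlt]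
        rfl
      have hhead : ((st i).stk w .input).head? = some (some w[i]) := by rw [hin]; rfl
      have hadv := update_stk_advance (w := w) (st i)
      have hget : w[(st i).pos]? = some w[i] := List.getElem?_eq_getElem hlt
      rw [hget] at hadv
      rw [hhead, show 4 * (j + 1) + 1 = 1 + (1 + (1 + 1)) + (4 * j + 1) by omega]
      refine .loop_true rfl (.seq (exec_push hadv) (.seq (exec_push ?_) (exec_pop rfl rfl)))
        (ih (by omega))
      have : (st (i + 1)) = ({ st i with pos := (st i).pos + 1 } : Mem α).set x
          ((st i).reg x + 1) := by
        simp only [hst, Mem.set]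
        simp [add_assoc]
      rw [this, ← Mem.update_stk_reg, List.replicate_succ]
      rfl
  have h := key w.length le_rfl
  have h0 : st (w.length - w.length) = m := by
    ext j <;> simp [hst, hm]
  rw [h0] at h
  rw [show 4 * w.length + 2 = 1 + (4 * w.length + 1) by omega]
  exact .seq (.pop _ _ _) h

theorem stk_zero (w : List α) : Function.update (fun _ => []) Stk.input (w.map some) =
    (⟨0, [], fun _ => 0⟩ : Mem α).stk w := by
  funext k
  cases k <;> rfl

/-- Put the length of the word on the tape into the register `0`. -/
def measureLength : Prog Stk (Option α) :=
  seq (measure 0) (seq (copy 0 1 2) (forReg 1 back))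

theorem runs_measureLength : Runs A qs w measureLength ⟨0, [], fun _ => 0⟩ (16 * w.length + 8)
    ((⟨0, [], fun _ => 0⟩ : Mem α).set 0 w.length) := by
  set m₀ : Mem α := ⟨0, [], fun _ => 0⟩ with hm₀
  set n := w.length with hn
  set m₁ : Mem α := ({ m₀ with pos := n } : Mem α).set 0 n with hm₁
  have h1 : Runs A qs w (measure 0) m₀ (4 * n + 2) m₁ := by
    intro v
    have := exec_measure (A := A) (qs := qs) (w := w) (m := m₀) 0 rfl v
    rw [show m₀.reg 0 + w.length = n by simp [hm₀, hn]] at this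
    exact ⟨_, _, le_rfl, this⟩
  have h2 := runs_copy (A := A) (qs := qs) (w := w) (m := m₁) (x := 0) (y := 1)
    (z := 2) (by omega) (by omega) (by omega) rfl
  have h3 := runs_forReg (A := A) (qs := qs) (w := w) (c := back) (T := 3) (x := 1) n
    (fun i => { (m₁.set 1 (n - i)) with pos := n - i }) (fun i _ => by simp) (fun i hi => by
      have := runs_back (A := A) (qs := qs) (w := w)
        (m := { (m₁.set 1 (n - (i + 1))) with pos := n - (i + 1) })
      refine (congrArg (fun m₁ => Runs _ _ w back m₁ 3 _) ?_).mp this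
      ext j
      · simp
        omega
      · simp
      · simp only [Mem.reg_set]
        grind)
  have e1 : m₁.set 1 (m₁.reg 1 + m₁.reg 0) = { (m₁.set 1 (n - 0)) with pos := n - 0 } := by
    ext j <;> simp [hm₁, hm₀, Mem.reg_set]
  have e2 : ({ (m₁.set 1 (n - n)) with pos := n - n } : Mem α) = m₀.set 0 n := by
    ext j <;> simp [hm₁, hm₀, Mem.reg_set]
    grind
  have e3 : m₁.reg 0 = n := by simp [hm₁]
  rw [e1, e3] at h2
  rw [e2] at h3
  exact (h1.seq (h2.seq h3)).mono (by omega)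

end Prog

open Prog in
/-- Conditions given by arithmetic terms are decidable in polynomial time. -/
theorem ATerm.inP {α : Type} [Finite α] (t : ATerm α) :
    InP {w : List α | t.eval w [w.length] ≠ 0} := by
  obtain ⟨q, hq⟩ := t.compile_runs
  -- The value ends up in the register `1`; the last pop leaves a symbol in the state exactly if the
  -- value is not zero.
  refine Prog.inPWithOracle (seq measureLength (seq (t.compile [0] 1) (pop (.reg 1))))
    .input .query some (fun _ => false) (16 * Polynomial.X + q + 20) fun w => ?_
  set m₀ : Mem α := ⟨0, [], fun _ => 0⟩ with hm₀
  have h1 := hq ∅ (fun _ => false) w w.length [0] 1 (m₀.set 0 w.length) rfl (by simp)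
    (fun j hj => by rw [Mem.reg_set_of_ne _ _ (by omega)]) (by simp)
  rw [show [0].map (m₀.set 0 w.length).reg = [w.length] by simp] at h1
  obtain ⟨v₁, t₁, ht₁, h₁⟩ := runs_measureLength (A := ∅) (qs := fun _ => false) (w := w) none
  obtain ⟨v₂, t₂, ht₂, h₂⟩ := h1.2 v₁
  rw [stk_zero]
  refine ⟨_, _, _, ?_, .seq h₁ (.seq h₂ (.pop _ _ _)), ?_⟩
  · simp
    omega
  · rw [Set.mem_ofPred_eq]
    simp only [Mem.stk, Mem.reg_set_self]
    rcases t.eval w [w.length] with _ | k <;> simp [List.replicate_succ]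

/-! ### A search that asks two queries for each bound -/

namespace Prog

variable {A : Set (List Bool)} {w : List Bool} {m : Mem Bool}

/-- How the symbols on the query stack are read: unary digits are read as `true`. -/
def readSymbol (s : Option Bool) : Bool := s.getD true

/-- Move the head to the left, and copy the letter to the query stack. -/
def backCopy : Prog Stk (Option Bool) :=
  seq (pop .scratch) (seq (push .input Option.join) (push .query Option.join))

theorem runs_backCopy (h : m.pos < w.length) : Runs A readSymbol w backCopy
    { m with pos := m.pos + 1 } 3 { m with query := some w[m.pos] :: m.query } := by
  intro v
  have h1 : ({ m with pos := m.pos + 1 } : Mem Bool).stk w .scratch =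
      some w[m.pos] :: m.stk w .scratch := by
    simp [Mem.stk, List.range_succ, List.getElem?_eq_getElem h]
  refine ⟨some (some w[m.pos]), 3, le_rfl, .seq (t := 1) (t' := 2)
    (v' := some (some w[m.pos])) (S' := Function.update (({ m with pos := m.pos + 1 } : Mem Bool).stk w)
      .scratch (m.stk w .scratch)) ?_ (.seq (t := 1) (t' := 1)
      (v' := some (some w[m.pos])) (S' := m.stk w) ?_ ?_)⟩
  · exact exec_pop (by rw [h1]; rfl) (by rw [h1]; rfl)
  · apply exec_push
    funext k
    cases k with
    | input =>
      change some w[m.pos] :: (w.drop (m.pos + 1)).map some = (w.drop m.pos).map some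
      rw [List.drop_eq_getElem_cons h]
      rfl
    | _ => rfl
  · apply exec_push
    funext k
    cases k <;> rfl

theorem runs_push_query (s : Option Bool) : Runs A readSymbol w (push .query fun _ => s) m 1
    { m with query := s :: m.query } := by
  refine fun v => ⟨v, 1, le_rfl, exec_push ?_⟩
  funext k
  cases k <;> rfl

/-- Ask the oracle about the word on the tape, followed by `b`, `false` and as many digits `true` as the
register `1` says. The register `0` contains the length of the word. -/
def askWord (b : Bool) : Prog Stk (Option Bool) :=
  seq (copy 0 4 5) (seq (forReg 4 advance) (seq (copy 1 4 5) (seq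
    (forReg 4 (push .query fun _ => none)) (seq (push .query fun _ => some false) (seq
      (push .query fun _ => some b) (seq (copy 0 4 5) (seq (forReg 4 backCopy)
        (ask fun b => if b then some none else none))))))))

-- The first letter must be on top, so the query is written from its end: the digits, the separator,
-- `b`, and then the word while the head returns to the left. Asking empties the query stack, so the
-- memory is restored.
open Classical in
theorem exec_askWord (b : Bool) {n k : ℕ} (hn : n = w.length) (hk : k ≤ n) (h0 : m.reg 0 = n)
    (h1 : m.reg 1 = k) (h4 : m.reg 4 = 0) (h5 : m.reg 5 = 0) (hp : m.pos = 0) (hq : m.query = [])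
    (v : Option (Option Bool)) : ∃ t ≤ 40 * n + 40, Exec A .query readSymbol (askWord b) v (m.stk w) t
      (if w ++ b :: false :: List.replicate k true ∈ A then some none else none) (m.stk w) := by
  have hcopy0 := runs_copy (A := A) (qs := readSymbol) (w := w) (m := m) (x := 0) (y := 4) (z := 5)
    (by omega) (by omega) (by omega) h5
  rw [h0, h4, zero_add] at hcopy0
  have hadv := runs_forReg (A := A) (qs := readSymbol) (w := w) (c := advance) (T := 2) (x := 4) n
    (fun i => { m.set 4 (n - i) with pos := i }) (fun i _ => by simp) (fun i hi => by
      refine (congrArg _ ?_).mp runs_advance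
      ext j <;> simp [Mem.reg_set]
      grind)
  set m₁ : Mem Bool := { m with pos := n } with hm₁
  have e1 : ({ m.set 4 (n - 0) with pos := 0 } : Mem Bool) = m.set 4 n := by
    ext j <;> simp [hp]
  have e2 : ({ m.set 4 (n - n) with pos := n } : Mem Bool) = m₁ := by
    ext j <;> simp [hm₁, Mem.reg_set]
    grind
  rw [e1, e2] at hadv
  have hcopy1 := runs_copy (A := A) (qs := readSymbol) (w := w) (m := m₁) (x := 1) (y := 4) (z := 5)
    (by omega) (by omega) (by omega) h5
  rw [show m₁.reg 1 = k from h1, show m₁.reg 4 = 0 from h4, zero_add] at hcopy1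
  have hdig := runs_forReg (A := A) (qs := readSymbol) (w := w)
    (c := push .query fun _ => none) (T := 1) (x := 4) k
    (fun i => { m₁.set 4 (k - i) with query := List.replicate i none }) (fun i _ => by simp)
    (fun i hi => by
      refine (congrArg _ ?_).mp (runs_push_query none)
      ext j
      · simp
      · simp [List.replicate_succ]
      · simp only [Mem.reg_set]
        grind)
  set m₂ : Mem Bool := { m₁ with query := List.replicate k none } with hm₂
  have e3 : ({ m₁.set 4 (k - 0) with query := List.replicate 0 none } : Mem Bool) = m₁.set 4 k := by
    ext j <;> simp [hm₁, hq]
  have e4 : ({ m₁.set 4 (k - k) with query := List.replicate k none } : Mem Bool) = m₂ := by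
    ext j <;> simp [hm₂, Mem.reg_set]
    have : m₁.reg 4 = 0 := h4
    grind
  rw [e3, e4] at hdig
  set m₃ : Mem Bool := { m₁ with query := some b :: some false :: List.replicate k none } with hm₃
  have hsep : Runs A readSymbol w (push .query fun _ => some false) m₂ 1
      { m₁ with query := some false :: List.replicate k none } := runs_push_query (some false)
  have hbit : Runs A readSymbol w (push .query fun _ => some b)
      { m₁ with query := some false :: List.replicate k none } 1 m₃ := runs_push_query (some b)
  have hcopy2 := runs_copy (A := A) (qs := readSymbol) (w := w) (m := m₃) (x := 0) (y := 4) (z := 5)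
    (by omega) (by omega) (by omega) h5
  rw [show m₃.reg 0 = n from h0, show m₃.reg 4 = 0 from h4, zero_add] at hcopy2
  have hback := runs_forReg (A := A) (qs := readSymbol) (w := w) (c := backCopy) (T := 3) (x := 4) n
    (fun i => { m₃.set 4 (n - i) with
      pos := n - i
      query := (w.drop (n - i)).map some ++ some b :: some false :: List.replicate k none })
    (fun i _ => by simp) (fun i hi => by
      have := runs_backCopy (A := A) (w := w) (m := { m₃.set 4 (n - (i + 1)) with
        pos := n - (i + 1)
        query := (w.drop (n - i)).map some ++ some b :: some false :: List.replicate k none })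
        (show n - (i + 1) < w.length by omega)
      have hdrop : w.drop (n - (i + 1)) = w[n - (i + 1)] :: w.drop (n - i) := by
        rw [List.drop_eq_getElem_cons (by omega), show n - (i + 1) + 1 = n - i by omega]
      rw [hdrop]
      refine (congrArg (fun m₁ => Runs _ _ w backCopy m₁ 3 _) ?_).mp this
      ext j
      · simp
        omega
      · simp
      · simp only [Mem.reg_set]
        grind)
  set m₄ : Mem Bool := { m with query := w.map some ++ some b :: some false :: List.replicate k none } with hm₄
  have e5 : ({ m₃.set 4 (n - 0) with
      pos := n - 0
      query := (w.drop (n - 0)).map some ++ some b :: some false :: List.replicate k none } : Mem Bool) =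
      m₃.set 4 n := by
    ext j <;> simp [hm₃, hm₁, hn]
  have e6 : ({ m₃.set 4 (n - n) with
      pos := n - n
      query := (w.drop (n - n)).map some ++ some b :: some false :: List.replicate k none } : Mem Bool) = m₄ := by
    ext j <;> simp [hm₃, hm₁, hm₄, hp, Mem.reg_set]
    grind
  rw [e5, e6] at hback
  have hask : ∀ v, Exec A .query readSymbol (ask fun b => if b then some none else none) v
      (m₄.stk w) 2 (if w ++ b :: false :: List.replicate k true ∈ A then some none else none) (m.stk w) := by
    intro v
    have hword : (m₄.stk w .query).map readSymbol = w ++ b :: false :: List.replicate k true := by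
      have : readSymbol ∘ some = id := rfl
      simp [Mem.stk, hm₄, this, readSymbol]
    have hS : Function.update (m₄.stk w) .query [] = m.stk w := by
      funext x
      cases x with
      | query => simp [Mem.stk, hq]
      | _ => rfl
    have := Exec.ask (A := A) (qk := Stk.query) (qs := readSymbol)
      (fun b => if b then some (none : Option Bool) else none) v (m₄.stk w)
    rw [hword, hS] at this
    simpa using this
  obtain ⟨v₁, t₁, ht₁, h₁⟩ := hcopy0 v
  obtain ⟨v₂, t₂, ht₂, h₂⟩ := hadv v₁
  obtain ⟨v₃, t₃, ht₃, h₃⟩ := hcopy1 v₂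
  obtain ⟨v₄, t₄, ht₄, h₄⟩ := hdig v₃
  obtain ⟨v₄', t₄', ht₄', h₄'⟩ := hsep v₄
  obtain ⟨v₅, t₅, ht₅, h₅⟩ := hbit v₄'
  obtain ⟨v₆, t₆, ht₆, h₆⟩ := hcopy2 v₅
  obtain ⟨v₇, t₇, ht₇, h₇⟩ := hback v₆
  refine ⟨_, ?_, .seq h₁ (.seq h₂ (.seq h₃ (.seq h₄ (.seq h₄' (.seq h₅ (.seq h₆
    (.seq h₇ (hask v₇))))))))⟩
  omega

/-- Ask two queries, and count in the register `2` how often the answers are "yes" and "no". -/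
def askTwice : Prog Stk (Option Bool) :=
  seq (askWord false) (ite Option.isSome
    (seq (askWord true) (ite Option.isSome skip (inc 2))) skip)

open Classical in
theorem runs_askTwice {n k : ℕ} (hn : n = w.length) (hk : k ≤ n) (h0 : m.reg 0 = n)
    (h1 : m.reg 1 = k) (h4 : m.reg 4 = 0) (h5 : m.reg 5 = 0) (hp : m.pos = 0) (hq : m.query = []) :
    Runs A readSymbol w askTwice m (80 * n + 90) (m.set 2 (m.reg 2 +
      if w ++ false :: false :: List.replicate k true ∈ A ∧ w ++ true :: false :: List.replicate k true ∉ A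
        then 1 else 0)) := by
  intro v
  obtain ⟨t₁, ht₁, h₁⟩ := exec_askWord (A := A) false hn hk h0 h1 h4 h5 hp hq v
  by_cases hA : w ++ false :: false :: List.replicate k true ∈ A
  · rw [if_pos hA] at h₁
    obtain ⟨t₂, ht₂, h₂⟩ := exec_askWord (A := A) true hn hk h0 h1 h4 h5 hp hq (some none)
    by_cases hB : w ++ true :: false :: List.replicate k true ∈ A
    · rw [if_pos hB] at h₂
      obtain ⟨v₃, t₃, ht₃, h₃⟩ := runs_skip (A := A) (qs := readSymbol) (w := w) (m := m) (some none)
      rw [if_neg (by tauto), add_zero, Mem.set_self]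
      exact ⟨v₃, _, by omega, .seq h₁ (.ite (.seq h₂ (.ite h₃)))⟩
    · rw [if_neg hB] at h₂
      obtain ⟨v₃, t₃, ht₃, h₃⟩ := runs_inc (A := A) (qs := readSymbol) (w := w) (m := m) 2 none
      rw [if_pos ⟨hA, hB⟩]
      exact ⟨v₃, _, by omega, .seq h₁ (.ite (.seq h₂ (.ite h₃)))⟩
  · rw [if_neg hA] at h₁
    obtain ⟨v₃, t₃, ht₃, h₃⟩ := runs_skip (A := A) (qs := readSymbol) (w := w) (m := m) none
    rw [if_neg (by tauto), add_zero, Mem.set_self]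
    exact ⟨v₃, _, by omega, .seq h₁ (.ite h₃)⟩

end Prog

open Prog in
open Classical in
theorem inPWithOracle_of_two_queries (A : Set (List Bool)) :
    InPWithOracle A {w : List Bool | ∃ k ≤ w.length, w ++ false :: false :: List.replicate k true ∈ A ∧
      w ++ true :: false :: List.replicate k true ∉ A} := by
  -- The register `1` contains `k`, the register `2` counts the successes, and the register `3`
  -- counts the remaining rounds, `n + 1` in total because `k = n` is included.
  refine Prog.inPWithOracle (seq measureLength (seq (copy 0 3 4) (seq (inc 3)
    (seq (forReg 3 (seq askTwice (inc 1))) (pop (.reg 2))))))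
    .input .query some readSymbol (200 * (Polynomial.X + 1) * (Polynomial.X + 1)) fun w => ?_
  set n := w.length with hn
  set m₀ : Mem Bool := ⟨0, [], fun _ => 0⟩ with hm₀
  set f : ℕ → ℕ := fun k => if w ++ false :: false :: List.replicate k true ∈ A ∧
      w ++ true :: false :: List.replicate k true ∉ A then 1 else 0 with hf
  have hcopy := runs_copy (A := A) (qs := readSymbol) (w := w) (m := m₀.set 0 n) (x := 0) (y := 3)
    (z := 4) (by omega) (by omega) (by omega) rfl
  have hloop := runs_forReg (A := A) (qs := readSymbol) (w := w) (c := seq askTwice (inc 1))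
    (T := 80 * n + 91) (x := 3) (n + 1)
    (fun k => (((m₀.set 0 n).set 2 (∑ i ∈ Finset.range k, f i)).set 1 k).set 3 (n + 1 - k))
    (fun k _ => by simp) (fun k hk => by
      set m := ((((m₀.set 0 n).set 2 (∑ i ∈ Finset.range k, f i)).set 1 k).set 3 (n + 1 - k)).set 3
        (n + 1 - k - 1) with hm
      have h1 := runs_askTwice (A := A) (w := w) (m := m) (k := k) hn (by omega)
        (by simp [hm, Mem.reg_set]) (by simp [hm, Mem.reg_set]) (by simp [hm, hm₀, Mem.reg_set])
        (by simp [hm, hm₀, Mem.reg_set]) rfl rfl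
      refine ((congrArg _ ?_).mp (h1.seq (runs_inc 1)))
      rw [Finset.sum_range_succ]
      have e : m.reg 2 = ∑ i ∈ Finset.range k, f i := by simp [hm, Mem.reg_set]
      change ((m.set 2 (m.reg 2 + f k)).set 1 _) = _
      rw [e]
      ext j <;> simp [hm, hm₀, Mem.reg_set]
      grind)
  obtain ⟨v₁, t₁, ht₁, h₁⟩ := runs_measureLength (A := A) (qs := readSymbol) (w := w) none
  obtain ⟨v₂, t₂, ht₂, h₂⟩ := hcopy v₁
  obtain ⟨v₃, t₃, ht₃, h₃⟩ := runs_inc (A := A) (qs := readSymbol) (w := w)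
    (m := (m₀.set 0 n).set 3 ((m₀.set 0 n).reg 3 + (m₀.set 0 n).reg 0)) 3 v₂
  have e : ((m₀.set 0 n).set 3 ((m₀.set 0 n).reg 3 + (m₀.set 0 n).reg 0)).set 3
      (((m₀.set 0 n).set 3 ((m₀.set 0 n).reg 3 + (m₀.set 0 n).reg 0)).reg 3 + 1) =
      (((m₀.set 0 n).set 2 (∑ i ∈ Finset.range 0, f i)).set 1 0).set 3 (n + 1 - 0) := by
    ext j <;> simp [hm₀, Mem.reg_set]
    grind
  rw [e] at h₃
  obtain ⟨v₄, t₄, ht₄, h₄⟩ := hloop v₃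
  rw [stk_zero]
  refine ⟨_, _, _, ?_, .seq h₁ (.seq h₂ (.seq h₃ (.seq h₄ (.pop _ _ _)))), ?_⟩
  · have e0 : (m₀.set 0 n).reg 0 = n := by simp
    rw [e0] at ht₂
    simp only [Polynomial.eval_mul, Polynomial.eval_add, Polynomial.eval_X, Polynomial.eval_one,
      Polynomial.eval_ofNat]
    nlinarith
  · have e2 : ((((m₀.set 0 n).set 2 (∑ i ∈ Finset.range (n + 1), f i)).set 1 (n + 1)).set 3
        (n + 1 - (n + 1))).reg 2 = ∑ i ∈ Finset.range (n + 1), f i := by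
      simp [Mem.reg_set]
    have e3 : (∑ i ∈ Finset.range (n + 1), f i) ≠ 0 ↔ ∃ k ≤ n,
        w ++ false :: false :: List.replicate k true ∈ A ∧ w ++ true :: false :: List.replicate k true ∉ A := by
      simp only [ne_eq, Finset.sum_eq_zero_iff, Finset.mem_range, hf, Nat.lt_succ_iff]
      push Not
      simp
    rw [Set.mem_ofPred_eq, ← e3]
    simp only [Mem.stk, e2]
    rcases (∑ i ∈ Finset.range (n + 1), f i) with _ | k <;> simp [List.replicate_succ]

/-! ### Certificates for connectivity, local connectivity of the blocks, and binary digits -/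

namespace SimpleGraph

variable {V : Type*} {G : SimpleGraph V} {S : Set V}

/-- If in each class of the relation `E` at most one vertex of `S` has no smaller neighbour in `S`,
then the classes are connected. -/
theorem reachIn_of_order [Finite V] {R E : V → V → Prop} (htrans : ∀ a b c, R a b → R b c → R a c)
    (hirr : ∀ a, ¬ R a a) (hsymm : ∀ a b, E a b → E b a)
    (hE : ∀ a b, b ∈ S → ∀ c ∈ S, E a b → G.Adj b c → E a c)
    (h : ∀ y ∈ S, ∀ z ∈ S, E y z → y ≠ z →
      (∃ u ∈ S, G.Adj u y ∧ R u y) ∨ ∃ u ∈ S, G.Adj u z ∧ R u z) :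
    ∀ y ∈ S, ∀ z ∈ S, E y z → G.ReachIn S y z := by
  have : IsTrans V R := ⟨htrans⟩
  have : Std.Irrefl R := ⟨hirr⟩
  have hwf : WellFounded R := Finite.wellFounded_of_trans_of_irrefl R
  -- Nested descent along `R`: whichever of `y` and `z` has a smaller neighbour in `S` is replaced
  -- by it, and it stays in its class.
  intro y
  induction y using hwf.induction with
  | _ y ihy =>
    intro hy z
    induction z using hwf.induction with
    | _ z ihz =>
      intro hz hyz
      by_cases hne : y = z
      · subst hne
        exact .refl hy
      · rcases h y hy z hz hyz hne with ⟨u, hu, huy, hR⟩ | ⟨u, hu, huz, hR⟩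
        · exact .cons hy huy.symm
            (ihy u hR hu z hz (hsymm _ _ (hE _ _ hy _ hu (hsymm _ _ hyz) huy.symm)))
        · exact (ihz u hR hu (hE _ _ hz _ hu hyz huz.symm)).tail huz hz

/-- An order in which each component of `S` has exactly one vertex without a smaller neighbour. -/
theorem exists_order (G : SimpleGraph V) (S : Set V) : ∃ R : V → V → Prop,
    (∀ a b c, R a b → R b c → R a c) ∧ (∀ a, ¬ R a a) ∧
      ∀ y z, G.ReachIn S y z → y ≠ z →
        (∃ u ∈ S, G.Adj u y ∧ R u y) ∨ ∃ u ∈ S, G.Adj u z ∧ R u z := by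
  classical
  set H := G.induce S
  -- `r` picks a root of each component, and the order compares distances to the roots. Every vertex
  -- but the root has a neighbour closer to it.
  let r : S → S := fun y => (H.connectedComponentMk y).out
  have hr : ∀ y, H.Reachable y (r y) := fun y =>
    (ConnectedComponent.exact (H.connectedComponentMk y).out_eq).symm
  have hadj : ∀ y u, H.Adj u y → r u = r y := fun y u h => by
    simp only [r, ConnectedComponent.sound h.reachable]
  have key : ∀ y : S, y ≠ r y → ∃ u : S, H.Adj u y ∧ H.dist u (r u) < H.dist y (r y) := by
    have aux : ∀ (y t : S) (p : H.Walk y t), y ≠ t → p.length = H.dist y t →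
        ∃ u : S, H.Adj u y ∧ H.dist u t < H.dist y t := by
      rintro y t (_ | ⟨h, q⟩) hy hp
      · exact absurd rfl hy
      · refine ⟨_, h.symm, ?_⟩
        rw [← hp, Walk.length_cons]
        exact Nat.lt_succ_of_le (dist_le q)
    intro y hy
    obtain ⟨p, hp⟩ := (hr y).exists_walk_length_eq_dist
    obtain ⟨u, hu, hlt⟩ := aux y (r y) p hy hp
    exact ⟨u, hu, by rwa [hadj y u hu]⟩
  refine ⟨fun a b => ∃ (ha : a ∈ S) (hb : b ∈ S),
    H.dist ⟨a, ha⟩ (r ⟨a, ha⟩) < H.dist ⟨b, hb⟩ (r ⟨b, hb⟩), ?_, ?_, ?_⟩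
  · rintro a b c ⟨ha, hb, h⟩ ⟨_, hc, h'⟩
    exact ⟨ha, hc, h.trans h'⟩
  · rintro a ⟨ha, hb, h⟩
    exact lt_irrefl _ h
  · intro y z hyz hne
    have hy := hyz.left_mem
    have hz := hyz.right_mem
    by_cases h : (⟨y, hy⟩ : S) = r ⟨y, hy⟩
    · by_cases h' : (⟨z, hz⟩ : S) = r ⟨z, hz⟩
      · have : r ⟨y, hy⟩ = r ⟨z, hz⟩ := 
          have hyz' : H.Reachable ⟨y, hy⟩ ⟨z, hz⟩ := by
            rw [induce_reachable_iff]
            exact hyz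
          congrArg Quot.out (ConnectedComponent.sound hyz')
        rw [this, ← h'] at h
        exact absurd (congrArg Subtype.val h) hne
      · obtain ⟨u, hu, hlt⟩ := key _ h'
        exact .inr ⟨u, u.2, hu, u.2, hz, hlt⟩
    · obtain ⟨u, hu, hlt⟩ := key _ h
      exact .inl ⟨u, u.2, hu, u.2, hy, hlt⟩

/-- A certificate for the connectivity of a graph. -/
def ConnectedCert (G : SimpleGraph V) (R : V → V → Prop) : Prop :=
  (∀ a b c, R a b → R b c → R a c) ∧ (∀ a, ¬ R a a) ∧
    ∀ y z, y ≠ z → (∃ u, G.Adj u y ∧ R u y) ∨ ∃ u, G.Adj u z ∧ R u z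

theorem preconnected_iff_exists_connectedCert [Finite V] :
    G.Preconnected ↔ ∃ R, G.ConnectedCert R := by
  constructor
  · intro h
    obtain ⟨R, h1, h2, h3⟩ := G.exists_order Set.univ
    exact ⟨R, h1, h2, fun y z hne => by
      simpa using h3 y z (reachable_iff_reachIn_univ.mp (h y z)) hne⟩
  · rintro ⟨R, h1, h2, h3⟩ y z
    rw [reachable_iff_reachIn_univ]
    exact reachIn_of_order (S := Set.univ) (E := fun _ _ => True) h1 h2 (fun _ _ h => h) (fun _ _ _ _ _ _ _ => trivial)
      (fun y _ z _ _ hne => by simpa using h3 y z hne) y trivial z trivial trivial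

/-- A certificate for the local connectivity of the blocks of a graph: `E x` is the relation of
being joined by a walk avoiding `x`, and `O x` is an order that shows that vertices in the
neighbourhood of `x` that are related by `E x` are connected in the neighbourhood. -/
def BlocksCert (G : SimpleGraph V) (E O : V → V → V → Prop) : Prop :=
  (∀ x y, y ≠ x → E x y y) ∧ (∀ x y z, E x y z → E x z y) ∧
    (∀ x y z u, u ≠ x → E x y z → G.Adj z u → E x y u) ∧
    (∀ x a b c, O x a b → O x b c → O x a c) ∧ (∀ x a, ¬ O x a a) ∧
    ∀ x y z, G.Adj x y → G.Adj x z → E x y z → y ≠ z →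
      (∃ u, G.Adj x u ∧ G.Adj u y ∧ O x u y) ∨ ∃ u, G.Adj x u ∧ G.Adj u z ∧ O x u z

variable {E O : V → V → V → Prop}

theorem BlocksCert.of_reachIn (h : G.BlocksCert E O) {x y z : V} (hyz : G.ReachIn {x}ᶜ y z) :
    E x y z :=
  hyz.tail_induction (P := fun z => E x y z) (h.1 x y hyz.left_mem)
    fun a b _ hb hab _ ih => h.2.2.1 x y a b hb ih hab

theorem BlocksCert.reachIn_neighborSet [Finite V] (h : G.BlocksCert E O) {x y z : V}
    (hy : G.Adj x y) (hz : G.Adj x z) (hyz : E x y z) : G.ReachIn (G.neighborSet x) y z := by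
  obtain ⟨h1, h2, h3, h4, h5, h6⟩ := h
  refine reachIn_of_order (h4 x) (h5 x) (h2 x)
    (fun a b _ c hc hab hbc => h3 x a b c (Adj.ne hc).symm hab hbc) ?_ y hy z hz hyz
  intro y hy z hz hyz hne
  exact h6 x y z hy hz hyz hne

/-- A walk from `y` to `x` arrives at a neighbour of `x` just before its first visit to `x`. -/
theorem Preconnected.exists_reachIn_neighborSet (hG : G.Preconnected) {x y : V} (hy : y ≠ x) :
    ∃ z, G.Adj x z ∧ G.ReachIn {x}ᶜ y z := by
  have := (reachable_iff_reachIn_univ.mp (hG y x)).head_induction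
    (P := fun y => y ≠ x → ∃ z, G.Adj x z ∧ G.ReachIn {x}ᶜ y z) (fun h => absurd rfl h) (by
      rintro a b - - hab - ih ha
      by_cases hb : b = x
      · subst hb
        exact ⟨a, hab.symm, .refl ha⟩
      · obtain ⟨z, hz, hr⟩ := ih hb
        exact ⟨z, hz, .cons ha hab hr⟩)
  exact this hy

/-- The closure conditions only prevent `E x` from being too small. It cannot be too large either:
`y` and `z` reach neighbours of `x` without meeting `x`, these are again related by `E x`, and the
order `O x` links them in the neighbourhood, which avoids `x`. Hence a certificate determines the
cut vertices. -/
theorem BlocksCert.reachIn [Finite V] (h : G.BlocksCert E O) (hG : G.Preconnected) {x y z : V}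
    (hy : y ≠ x) (hz : z ≠ x) (hyz : E x y z) : G.ReachIn {x}ᶜ y z := by
  obtain ⟨y', hy', hyr⟩ := hG.exists_reachIn_neighborSet hy
  obtain ⟨z', hz', hzr⟩ := hG.exists_reachIn_neighborSet hz
  have key : ∀ a b c, E x a b → G.ReachIn {x}ᶜ b c → E x a c := fun a b c hab hbc =>
    hbc.tail_induction (P := fun c => E x a c) hab
      fun s t _ ht hst _ ih => h.2.2.1 x a s t ht ih hst
  have h1 : E x y z' := key _ _ _ hyz hzr
  have h2 : E x z' y' := key _ _ _ (h.2.1 _ _ _ h1) hyr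
  have h3 := (h.reachIn_neighborSet hz' hy' h2).mono
    (fun u (hu : G.Adj x u) => show u ∈ ({x}ᶜ : Set V) from hu.ne.symm)
  exact hyr.trans (h3.symm.trans hzr.symm)

theorem BlocksCert.hasLocallyConnectedBlocks [Finite V] (h : G.BlocksCert E O) :
    G.HasLocallyConnectedBlocks :=
  hasLocallyConnectedBlocks_iff.mpr fun _ _ _ hy hz hyz =>
    h.reachIn_neighborSet hy hz (h.of_reachIn hyz)

theorem BlocksCert.isCutVertex_iff [Finite V] (h : G.BlocksCert E O) (hG : G.Preconnected)
    {x : V} : G.IsCutVertex x ↔ ∃ y z, y ≠ x ∧ z ≠ x ∧ ¬ E x y z := by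
  rw [SimpleGraph.isCutVertex_iff]
  constructor
  · rintro ⟨y, z, hy, hz, -, hnot⟩
    exact ⟨y, z, hy, hz, fun h' => hnot (h.reachIn hG hy hz h')⟩
  · rintro ⟨y, z, hy, hz, hnot⟩
    exact ⟨y, z, hy, hz, hG y z, fun h' => hnot (h.of_reachIn h')⟩

theorem HasLocallyConnectedBlocks.exists_blocksCert [Finite V] (h : G.HasLocallyConnectedBlocks) :
    ∃ E O, G.BlocksCert E O := by
  rw [hasLocallyConnectedBlocks_iff] at h
  choose O h1 h2 h3 using fun x => G.exists_order (G.neighborSet x)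
  refine ⟨fun x => G.ReachIn {x}ᶜ, O, fun x y hy => .refl hy, fun x y z h => h.symm,
    fun x y z u hu h hzu => h.tail hzu hu, h1, h2, fun x y z hy hz hyz hne => ?_⟩
  exact h3 x y z (h x y z hy hz hyz) hne

end SimpleGraph

/-- This is the propagation of the carry. It determines the digits of `m + 1` from those of `m` by a
bounded formula. -/
theorem Nat.testBit_add_one_iff (m b : ℕ) :
    (((m + 1).testBit b = true ↔ ¬ m.testBit b = true) ↔ ∀ b' < b, m.testBit b' = true) := by
  induction b generalizing m with
  | zero =>
    simp only [Nat.testBit_zero, decide_eq_true_eq, Nat.not_lt_zero, false_imp_iff, implies_true,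
      iff_true]
    omega
  | succ b ih =>
    have hsplit : (∀ b' < b + 1, m.testBit b' = true) ↔
        m % 2 = 1 ∧ ∀ b' < b, (m / 2).testBit b' = true := by
      constructor
      · intro h
        refine ⟨by simpa [Nat.testBit_zero] using h 0 (by omega), fun b' hb' => ?_⟩
        rw [← Nat.testBit_succ]
        exact h _ (by omega)
      · rintro ⟨h0, h⟩ b' hb'
        rcases b' with _ | b'
        · simpa [Nat.testBit_zero] using h0
        · rw [Nat.testBit_succ]
          exact h _ (by omega)
    rw [hsplit, Nat.testBit_succ, Nat.testBit_succ]
    rcases Nat.mod_two_eq_zero_or_one m with h | h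
    · rw [show (m + 1) / 2 = m / 2 by omega]
      simp [h]
    · rw [show (m + 1) / 2 = m / 2 + 1 by omega, ih]
      simp [h]

/-- A certificate for the binary digits of the numbers below `n`. -/
def DigitsCert (n : ℕ) (D : ℕ → ℕ → Prop) : Prop :=
  (∀ b < n, ¬ D 0 b) ∧
    ∀ m < n, m + 1 < n → ∀ b < n, ((D (m + 1) b ↔ ¬ D m b) ↔ ∀ b' < b, D m b')

theorem DigitsCert.iff_testBit {n : ℕ} {D : ℕ → ℕ → Prop} (h : DigitsCert n D) :
    ∀ m < n, ∀ b < n, D m b ↔ m.testBit b = true := by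
  intro m hm
  induction m with
  | zero => intro b hb; simpa using h.1 b hb
  | succ m ih =>
    intro b hb
    have h1 := h.2 m (by omega) hm b hb
    have h2 := Nat.testBit_add_one_iff m b
    have h3 : (∀ b' < b, D m b') ↔ ∀ b' < b, m.testBit b' = true :=
      forall₂_congr fun b' hb' => ih (by omega) b' (by omega)
    have h4 := ih (by omega) b hb
    tauto

theorem digitsCert_testBit (n : ℕ) : DigitsCert n fun m b => m.testBit b = true :=
  ⟨fun b _ => by simp, fun m _ _ b _ => Nat.testBit_add_one_iff m b⟩

/-- The most significant digit is the last one and must not be zero; the empty list stands for zero.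
-/
theorem Nat.eq_bits_iff (l : List Bool) :
    (∃ k : ℕ, l = k.bits) ↔ ∀ h : l ≠ [], l.getLast h = true := by
  induction l with
  | nil => simpa using ⟨0, by simp⟩
  | cons b t ih =>
    constructor
    · rintro ⟨k, hk⟩ _
      have hpos : k ≠ 0 := by
        rintro rfl
        simp at hk
      have hbd := Nat.bit_bodd_div2 k
      have hodd : k.div2 = 0 → k.bodd = true := by
        intro h0
        by_contra hb
        rw [h0, Bool.eq_false_iff.mpr hb] at hbd
        exact hpos hbd.symm
      rw [← hbd, Nat.bits_append_bit _ _ hodd] at hk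
      obtain ⟨rfl, ht⟩ := List.cons.inj hk
      rcases t with _ | ⟨c, t⟩
      · have h0 : k.div2 = 0 := by
          have hlen := Nat.size_eq_bits_len k.div2
          rw [← ht] at hlen
          exact Nat.size_eq_zero.mp hlen.symm
        simpa using hodd h0
      · simpa using ih.mp ⟨_, ht⟩ (by simp)
    · intro h
      rcases t with _ | ⟨c, t⟩
      · have : b = true := by simpa using h (by simp)
        subst this
        exact ⟨1, by simp⟩
      · obtain ⟨k, hk⟩ := ih.mpr fun _ => by simpa using h (by simp)
        refine ⟨Nat.bit b k, ?_⟩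
        rw [Nat.bits_append_bit, hk]
        rintro rfl
        simp at hk

/-! ### Bounded formulas, and graphs with certificates written as words -/

namespace ATerm

variable {α : Type}

/-- A term is read as a formula: it holds if its value is not zero. -/
def Holds (w : List α) (t : ATerm α) (e : List ℕ) : Prop := t.eval w e ≠ 0

/-- Negation. -/
def not (t : ATerm α) : ATerm α := sub one t

/-- Conjunction. -/
def and (s t : ATerm α) : ATerm α := mul s t

/-- Disjunction. -/
def or (s t : ATerm α) : ATerm α := add s t

/-- Implication. -/
def imp (s t : ATerm α) : ATerm α := or (not s) t

/-- Equivalence. -/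
def iff (s t : ATerm α) : ATerm α := and (imp s t) (imp t s)

/-- The order. -/
def lt (s t : ATerm α) : ATerm α := sub t s

/-- Equality. -/
def eq (s t : ATerm α) : ATerm α := and (not (lt s t)) (not (lt t s))

/-- Bounded universal quantification. -/
def all (t b : ATerm α) : ATerm α := not (sum t (not b))

/-- Bounded existential quantification. -/
def ex (t b : ATerm α) : ATerm α := sum t b

/-- Numerals. -/
def num : ℕ → ATerm α
  | 0 => sub one one
  | k + 1 => add (num k) one

section

variable (w : List α) (s t b : ATerm α) (e : List ℕ)

@[simp] theorem holds_not : Holds w (not t) e ↔ ¬ Holds w t e := by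
  simp only [Holds, not, eval]; omega

@[simp] theorem holds_and : Holds w (and s t) e ↔ Holds w s e ∧ Holds w t e := by
  simp only [Holds, and, eval, mul_ne_zero_iff]

@[simp] theorem holds_or : Holds w (or s t) e ↔ Holds w s e ∨ Holds w t e := by
  simp only [Holds, or, eval]; omega

@[simp] theorem holds_imp : Holds w (imp s t) e ↔ (Holds w s e → Holds w t e) := by
  simp only [imp, holds_or, holds_not]; tauto

@[simp] theorem holds_iff : Holds w (iff s t) e ↔ (Holds w s e ↔ Holds w t e) := by
  simp only [iff, holds_and, holds_imp]; tauto

@[simp] theorem holds_lt : Holds w (lt s t) e ↔ s.eval w e < t.eval w e := by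
  simp only [Holds, lt, eval]; omega

@[simp] theorem holds_eq : Holds w (eq s t) e ↔ s.eval w e = t.eval w e := by
  simp only [eq, holds_and, holds_not, holds_lt]; omega

@[simp] theorem holds_ex :
    Holds w (ex t b) e ↔ ∃ i < t.eval w e, Holds w b (e ++ [i]) := by
  simp [Holds, ex, eval, Finset.sum_eq_zero_iff]

@[simp] theorem holds_all :
    Holds w (all t b) e ↔ ∀ i < t.eval w e, Holds w b (e ++ [i]) := by
  have := holds_ex w t (not b) e
  simp only [ex, holds_not] at this
  rw [all, holds_not, this]
  push Not
  rfl

@[simp] theorem eval_num (k : ℕ) : (num k : ATerm α).eval w e = k := by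
  induction k with
  | zero => simp [num, eval]
  | succ k ih => simp [num, eval, ih]

@[simp] theorem holds_letter (a : α) :
    Holds w (letter a t) e ↔ w[t.eval w e]? = some a := by
  simp [Holds, eval]

end

end ATerm

theorem forall_lt_iff_forall_fin {n : ℕ} {p : ℕ → Prop} : (∀ i < n, p i) ↔ ∀ i : Fin n, p i := by
  simp [Fin.forall_iff]

theorem exists_lt_iff_exists_fin {n : ℕ} {p : ℕ → Prop} : (∃ i < n, p i) ↔ ∃ i : Fin n, p i := by
  simp [Fin.exists_iff]

/-! #### Reading the encoding of a graph -/

theorem encodeGraph_eq {n : ℕ} (G : SimpleGraph (Fin n)) [DecidableRel G.Adj] :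
    encodeGraph G = List.replicate n true ++ false ::
      List.ofFn fun p : Fin (n * n) => decide (G.Adj p.divNat p.modNat) := by
  rw [encodeGraph, List.ofFn_mul, List.flatMap_def, ← List.ofFn_eq_map]
  congr 4
  funext i
  rw [← List.ofFn_eq_map]
  congr 1
  funext j
  have hn : 0 < n := i.pos
  have h1 : (⟨i * n + j, by nlinarith [i.2, j.2]⟩ : Fin (n * n)).divNat = i := by
    ext
    simp [Fin.coe_divNat, Nat.add_comm, Nat.add_mul_div_right _ _ hn, Nat.div_eq_of_lt j.2]
  have h2 : (⟨i * n + j, by nlinarith [i.2, j.2]⟩ : Fin (n * n)).modNat = j := by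
    ext
    simp [Fin.coe_modNat, Nat.add_comm, Nat.mod_eq_of_lt j.2]
  simp only [h1, h2]
  congr

@[simp] theorem length_encodeGraph {n : ℕ} (G : SimpleGraph (Fin n)) :
    (encodeGraph G).length = n + 1 + n * n := by
  classical
  rw [encodeGraph_eq]
  simp
  omega

theorem getElem?_encodeGraph_of_lt {n p : ℕ} (G : SimpleGraph (Fin n)) (hp : p < n) :
    (encodeGraph G)[p]? = some true := by
  rw [encodeGraph, List.getElem?_append_left (by simpa using hp)]
  simp [hp]

theorem getElem?_encodeGraph_self {n : ℕ} (G : SimpleGraph (Fin n)) :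
    (encodeGraph G)[n]? = some false := by
  rw [encodeGraph, List.getElem?_append_right (by simp)]
  simp

theorem getElem?_encodeGraph_add {n : ℕ} (G : SimpleGraph (Fin n)) [DecidableRel G.Adj]
    (i j : Fin n) : (encodeGraph G)[n + 1 + (i * n + j)]? = some (decide (G.Adj i j)) := by
  have hn : 0 < n := i.pos
  have hlt : (i * n + j : ℕ) < n * n := by nlinarith [i.2, j.2]
  have h1 : (⟨i * n + j, hlt⟩ : Fin (n * n)).divNat = i := by
    ext
    simp [Fin.coe_divNat, Nat.add_comm, Nat.add_mul_div_right _ _ hn, Nat.div_eq_of_lt j.2]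
  have h2 : (⟨i * n + j, hlt⟩ : Fin (n * n)).modNat = j := by
    ext
    simp [Fin.coe_modNat, Nat.add_comm, Nat.mod_eq_of_lt j.2]
  rw [encodeGraph_eq, List.getElem?_append_right (by simp; omega), List.length_replicate,
    show n + 1 + (i * n + j) - n = (i * n + j : ℕ) + 1 by omega, List.getElem?_cons_succ,
    List.getElem?_eq_getElem (by simpa using hlt), List.getElem_ofFn, h1, h2]

/-- The unary prefix determines `n`, hence the length of the code, so the code is self-delimiting.
-/
theorem encodeGraph_append_injective {n : ℕ} {G : SimpleGraph (Fin n)} {l : List Bool} {n' : ℕ}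
    {G' : SimpleGraph (Fin n')} {l' : List Bool} (h : encodeGraph G ++ l = encodeGraph G' ++ l') :
    ∃ hn : n = n', hn ▸ G = G' ∧ l = l' := by
  classical
  have hle : ∀ {n n' : ℕ} {G : SimpleGraph (Fin n)} {l : List Bool} {G' : SimpleGraph (Fin n')}
      {l' : List Bool}, encodeGraph G ++ l = encodeGraph G' ++ l' → ¬ n < n' := by
    intro n n' G l G' l' h hlt
    have h1 := getElem?_encodeGraph_of_lt G' hlt
    have h2 := getElem?_encodeGraph_self G
    rw [← List.getElem?_append_left (l₂ := l') (by simp; omega), ← h,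
      List.getElem?_append_left (by simp; omega), h2] at h1
    simp at h1
  obtain rfl : n = n' := by
    have := hle h
    have := hle h.symm
    omega
  obtain ⟨h1, h2⟩ := List.append_inj h (by simp)
  refine ⟨rfl, ?_, h2⟩
  ext i j
  have h3 := getElem?_encodeGraph_add G i j
  rw [h1, getElem?_encodeGraph_add G' i j] at h3
  simpa using h3.symm

/-! #### Graphs with certificates -/

/-- An entry of the adjacency matrix. -/
def AdjAt (w : List (Bool ⊕ Bool)) (n i j : ℕ) : Prop := w[n + 1 + (i * n + j)]? = some (.inl true)

/-- An entry of the list that follows the graph. -/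
def TailAt (w : List (Bool ⊕ Bool)) (n b : ℕ) : Prop := w[n + 1 + n * n + b]? = some (.inl true)

/-- An entry of the certificate. -/
def CertAt (w : List (Bool ⊕ Bool)) (n L a i j l : ℕ) : Prop :=
  w[n + 1 + n * n + L + (((a * n + i) * n + j) * n + l)]? = some (.inr true)

/-- The word `w` consists of the code of the graph `G`, the list `l` and the certificate `T`. -/
structure Describes (w : List (Bool ⊕ Bool)) {n : ℕ} (G : SimpleGraph (Fin n)) (l : List Bool)
    (T : ℕ → ℕ → ℕ → ℕ → Prop) : Prop where
  pos : 0 < n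
  adj : ∀ i j : Fin n, AdjAt w n i j ↔ G.Adj i j
  tail : ∀ b, TailAt w n b ↔ l[b]? = some true
  cert : ∀ a < 5, ∀ i j k : Fin n, CertAt w n l.length a i j k ↔ T a i j k

namespace ATerm

/-- The formula for `AdjAt`. The number of vertices is the variable `1`. -/
def adj (i j : ATerm (Bool ⊕ Bool)) : ATerm (Bool ⊕ Bool) :=
  letter (.inl true) (add (add (var 1) one) (add (mul i (var 1)) j))

/-- The formula for `TailAt`. -/
def tail (b : ATerm (Bool ⊕ Bool)) : ATerm (Bool ⊕ Bool) :=
  letter (.inl true) (add (add (add (var 1) one) (mul (var 1) (var 1))) b)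

/-- The formula for `CertAt`. The length of the list is the variable `2`. -/
def cert (a i j l : ATerm (Bool ⊕ Bool)) : ATerm (Bool ⊕ Bool) :=
  letter (.inr true) (add (add (add (add (var 1) one) (mul (var 1) (var 1))) (var 2))
    (add (mul (add (mul (add (mul a (var 1)) i) (var 1)) j) (var 1)) l))

section

variable (w : List (Bool ⊕ Bool)) (a b i j l : ATerm (Bool ⊕ Bool)) (e : List ℕ)

@[simp] theorem holds_adj :
    Holds w (adj i j) e ↔ AdjAt w (e.getD 1 0) (i.eval w e) (j.eval w e) := by
  simp only [adj, holds_letter, eval, AdjAt]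

@[simp] theorem holds_tail : Holds w (tail b) e ↔ TailAt w (e.getD 1 0) (b.eval w e) := by
  simp only [tail, holds_letter, eval, TailAt]

@[simp] theorem holds_cert : Holds w (cert a i j l) e ↔
    CertAt w (e.getD 1 0) (e.getD 2 0) (a.eval w e) (i.eval w e) (j.eval w e) (l.eval w e) := by
  simp only [cert, holds_letter, eval, CertAt]

end

/-- The word starts with the code of a graph with `var 1 > 0` vertices, which is followed by a list
of length `var 2` and a non-empty certificate. -/
def parse : ATerm (Bool ⊕ Bool) :=
  and (lt (num 0) (var 1)) (and (all (var 1) (letter (.inl true) (var 3)))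
    (and (letter (.inl false) (var 1))
    (and (all (add (mul (var 1) (var 1)) (var 2)) (or
      (letter (.inl true) (add (add (var 1) one) (var 3)))
      (letter (.inl false) (add (add (var 1) one) (var 3)))))
    (and (or
      (letter (.inr true) (add (add (add (var 1) one) (mul (var 1) (var 1))) (var 2)))
      (letter (.inr false) (add (add (add (var 1) one) (mul (var 1) (var 1))) (var 2))))
    (and (all (var 1) (all (var 1) (imp (adj (var 3) (var 4)) (adj (var 4) (var 3)))))
      (all (var 1) (not (adj (var 3) (var 3)))))))))

theorem holds_parse (w : List (Bool ⊕ Bool)) (N n L : ℕ) : Holds w parse [N, n, L] ↔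
    0 < n ∧ (∀ i < n, w[i]? = some (.inl true)) ∧ w[n]? = some (.inl false) ∧
      (∀ i < n * n + L, w[n + 1 + i]? = some (.inl true) ∨ w[n + 1 + i]? = some (.inl false)) ∧
      (w[n + 1 + n * n + L]? = some (.inr true) ∨ w[n + 1 + n * n + L]? = some (.inr false)) ∧
      (∀ i < n, ∀ j < n, AdjAt w n i j → AdjAt w n j i) ∧ ∀ i < n, ¬ AdjAt w n i i := by
  simp [parse, eval]

end ATerm

section

variable (x y : List Bool)

theorem getElem?_inl_iff (p : ℕ) (b : Bool) :
    (x.map Sum.inl ++ y.map Sum.inr : List (Bool ⊕ Bool))[p]? = some (.inl b) ↔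
      x[p]? = some b := by
  rw [List.getElem?_append]
  split_ifs with h
  · simp
  · rw [List.getElem?_eq_none (l := x) (by simpa using h)]
    simp

theorem getElem?_inr_iff (p : ℕ) (b : Bool) :
    (x.map Sum.inl ++ y.map Sum.inr : List (Bool ⊕ Bool))[p]? = some (.inr b) ↔
      x.length ≤ p ∧ y[p - x.length]? = some b := by
  rw [List.getElem?_append]
  split_ifs with h
  · simp at h ⊢
    omega
  · simp at h ⊢
    simp [h]

theorem exists_describes_of_holds_parse {N n L : ℕ}
    (h : ATerm.Holds (x.map Sum.inl ++ y.map Sum.inr) ATerm.parse [N, n, L]) :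
    ∃ (G : SimpleGraph (Fin n)) (l : List Bool) (T : ℕ → ℕ → ℕ → ℕ → Prop),
      Describes (x.map Sum.inl ++ y.map Sum.inr) G l T ∧ l.length = L ∧ x = encodeGraph G ++ l := by
  classical
  set w : List (Bool ⊕ Bool) := x.map Sum.inl ++ y.map Sum.inr with hw
  rw [ATerm.holds_parse] at h
  obtain ⟨hn, h1, h2, h3, h4, h5, h6⟩ := h
  simp only [hw, getElem?_inl_iff] at h1 h2 h3
  -- The boundary between input and certificate is fixed from both sides: a certificate letter at
  -- this position bounds `x` from above, and the input letters before it bound `x` from below.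
  have hle : x.length ≤ n + 1 + n * n + L := by
    simp only [hw, getElem?_inr_iff] at h4
    exact h4.elim And.left And.left
  have hge : n + 1 + n * n + L ≤ x.length := by
    by_contra hlt
    have hnx : n < x.length := (List.getElem?_eq_some_iff.mp h2).1
    have := h3 (x.length - (n + 1)) (by omega)
    rw [show n + 1 + (x.length - (n + 1)) = x.length by omega] at this
    simp at this
  let G : SimpleGraph (Fin n) :=
    { Adj := fun i j => AdjAt w n i j
      symm := ⟨fun i j => h5 i i.2 j j.2⟩
      loopless := ⟨fun i => h6 i i.2⟩ }
  have hG : x.take (n + 1 + n * n) = encodeGraph G := by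
    apply List.ext_getElem?
    intro p
    by_cases hp : p < n + 1 + n * n
    · rw [List.getElem?_take_of_lt hp]
      rcases lt_trichotomy p n with h | rfl | h
      · rw [h1 p h, getElem?_encodeGraph_of_lt G h]
      · rw [h2, getElem?_encodeGraph_self]
      · obtain ⟨q, rfl⟩ := Nat.exists_eq_add_of_le (Nat.succ_le_of_lt h)
        have hq : q < n * n := by omega
        have hq' : q = (⟨q / n, Nat.div_lt_of_lt_mul hq⟩ : Fin n) * n +
            (⟨q % n, Nat.mod_lt _ hn⟩ : Fin n) := by
          simp [Nat.div_add_mod']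
        rw [Nat.succ_eq_add_one, hq', getElem?_encodeGraph_add G, ← hq']
        have hadj : G.Adj ⟨q / n, Nat.div_lt_of_lt_mul hq⟩ ⟨q % n, Nat.mod_lt _ hn⟩ ↔
            x[n + 1 + q]? = some true := by
          change w[n + 1 + (q / n * n + q % n)]? = _ ↔ _
          rw [Nat.div_add_mod', hw, getElem?_inl_iff]
        rcases h3 q (by omega) with h | h
        · rw [h, decide_eq_true (hadj.mpr h)]
        · rw [h, decide_eq_false]
          rw [hadj, h]
          simp
    · rw [List.getElem?_eq_none (by simp; omega), List.getElem?_eq_none (by simp; omega)]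
  refine ⟨G, x.drop (n + 1 + n * n), CertAt w n L, ⟨hn, fun i j => Iff.rfl, fun b => ?_,
    fun a _ i j k => ?_⟩, by simp; omega, by rw [← hG, List.take_append_drop]⟩
  · rw [TailAt, hw, getElem?_inl_iff, List.getElem?_drop]
  · rw [List.length_drop, show x.length - (n + 1 + n * n) = L by omega]

end

/-- A certificate as a list. -/
noncomputable def certList (n : ℕ) (T : ℕ → ℕ → ℕ → ℕ → Prop) : List Bool :=
  open Classical in (List.range (5 * n * n * n)).map fun p =>
    decide (T (p / n / n / n) (p / n / n % n) (p / n % n) (p % n))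

theorem getElem?_certList {n : ℕ} (T : ℕ → ℕ → ℕ → ℕ → Prop) {a i j k : ℕ} (ha : a < 5)
    (hi : i < n) (hj : j < n) (hk : k < n) :
    (certList n T)[((a * n + i) * n + j) * n + k]? = some true ↔ T a i j k := by
  have hn : 0 < n := by omega
  have hlt : ∀ {s M t : ℕ}, s < M → t < n → s * n + t < M * n := fun {s M t} hs ht => by
    calc s * n + t < s * n + n := by omega
      _ = (s + 1) * n := by ring
      _ ≤ M * n := Nat.mul_le_mul_right n hs
  have hdiv : ∀ {s t : ℕ}, t < n → (s * n + t) / n = s := fun {s t} ht => by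
    rw [Nat.add_comm, Nat.add_mul_div_right _ _ hn, Nat.div_eq_of_lt ht, Nat.zero_add]
  have hmod : ∀ {s t : ℕ}, t < n → (s * n + t) % n = t := fun {s t} ht => by
    rw [Nat.add_comm, Nat.add_mul_mod_self_right, Nat.mod_eq_of_lt ht]
  rw [certList, List.getElem?_map, List.getElem?_range (hlt (hlt (hlt ha hi) hj) hk)]
  simp [hdiv hk, hdiv hj, hdiv hi, hmod hk, hmod hj, hmod hi]

section

variable {n : ℕ} (G : SimpleGraph (Fin n)) (l : List Bool) (T : ℕ → ℕ → ℕ → ℕ → Prop)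

theorem getElem?_inr_certList {a i j k : ℕ} (ha : a < 5) (hi : i < n) (hj : j < n) (hk : k < n) :
    CertAt ((encodeGraph G ++ l).map Sum.inl ++ (certList n T).map Sum.inr) n l.length a i j k ↔
      T a i j k := by
  rw [CertAt, getElem?_inr_iff, List.length_append, length_encodeGraph, Nat.add_sub_cancel_left,
    getElem?_certList T ha hi hj hk]
  exact and_iff_right (Nat.le_add_right _ _)

theorem describes_encodeGraph (hn : 0 < n) :
    Describes ((encodeGraph G ++ l).map Sum.inl ++ (certList n T).map Sum.inr) G l T := by
  classical
  refine ⟨hn, fun i j => ?_, fun b => ?_, fun a ha i j k =>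
    getElem?_inr_certList G l T ha i.2 j.2 k.2⟩
  · have hlt : (i * n + j : ℕ) < n * n := by nlinarith [i.2, j.2]
    rw [AdjAt, getElem?_inl_iff, List.getElem?_append_left (by simpa using by omega),
      getElem?_encodeGraph_add]
    simp
  · rw [TailAt, getElem?_inl_iff, List.getElem?_append_right (by simp), length_encodeGraph,
      Nat.add_sub_cancel_left]

theorem holds_parse_encodeGraph (hn : 0 < n) (N : ℕ) :
    ATerm.Holds ((encodeGraph G ++ l).map Sum.inl ++ (certList n T).map Sum.inr) ATerm.parse
      [N, n, l.length] := by
  have hD := describes_encodeGraph G l T hn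
  have hlen : (encodeGraph G ++ l).length = n + 1 + n * n + l.length := by simp
  rw [ATerm.holds_parse]
  refine ⟨hn, fun i hi => ?_, ?_, fun i hi => ?_, ?_, fun i hi j hj => ?_, fun i hi => ?_⟩
  · rw [getElem?_inl_iff, List.getElem?_append_left (by simp; omega),
      getElem?_encodeGraph_of_lt G hi]
  · rw [getElem?_inl_iff, List.getElem?_append_left (by simp; omega), getElem?_encodeGraph_self]
  · rw [getElem?_inl_iff, getElem?_inl_iff, List.getElem?_eq_getElem (by omega)]
    simp only [Option.some.injEq]
    exact Bool.eq_false_or_eq_true _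
  · have hlt : 0 < (certList n T).length := by
      simp [certList, hn]
    rw [getElem?_inr_iff, getElem?_inr_iff, hlen, Nat.sub_self, List.getElem?_eq_getElem hlt]
    simp only [Option.some.injEq, le_refl, true_and]
    exact Bool.eq_false_or_eq_true _
  · rw [hD.adj ⟨i, hi⟩ ⟨j, hj⟩, hD.adj ⟨j, hj⟩ ⟨i, hi⟩]
    exact fun h => h.symm
  · rw [hD.adj ⟨i, hi⟩ ⟨i, hi⟩]
    exact G.irrefl

end

/-- A property of graphs, followed by lists, with certificates that is expressed by a bounded
formula yields a language in `NP`. -/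
theorem inNP_of_holds (t : ATerm (Bool ⊕ Bool))
    (P : ∀ n : ℕ, SimpleGraph (Fin n) → List Bool → (ℕ → ℕ → ℕ → ℕ → Prop) → Prop)
    (h : ∀ (w : List (Bool ⊕ Bool)) (N n : ℕ) (G : SimpleGraph (Fin n)) (l : List Bool)
      (T : ℕ → ℕ → ℕ → ℕ → Prop), Describes w G l T → (t.Holds w [N, n, l.length] ↔ P n G l T)) :
    InNP {x | ∃ (n : ℕ) (G : SimpleGraph (Fin n)) (l : List Bool), 0 < n ∧ (∃ T, P n G l T) ∧
      x = encodeGraph G ++ l} := by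
  -- The variable `0` is the length of the whole word; the number of vertices and the length of the
  -- list are found by bounded quantification as the variables `1` and `2`. The certificate consists
  -- of five tables of `n ^ 3` bits.
  refine ⟨_, 5 * Polynomial.X ^ 3, ATerm.inP (.ex (.var 0) (.ex (.add (.var 0) .one)
    (.and .parse t))), fun x => ?_⟩
  change _ ↔ ∃ y : List Bool, _ ∧ ATerm.Holds _ _ _
  simp only [ATerm.holds_ex, ATerm.holds_and, ATerm.eval, List.cons_append,
    List.nil_append, List.getD_cons_zero]
  constructor
  · rintro ⟨n, G, l, hn, ⟨T, hT⟩, rfl⟩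
    refine ⟨certList n T, ?_, n, ?_, l.length, ?_, holds_parse_encodeGraph G l T hn _,
      (h _ _ _ _ _ _ (describes_encodeGraph G l T hn)).mpr hT⟩
    · simp only [certList, List.length_map, List.length_range, Polynomial.eval_mul,
        Polynomial.eval_ofNat, Polynomial.eval_pow, Polynomial.eval_X, List.length_append,
        length_encodeGraph]
      calc 5 * n * n * n = 5 * n ^ 3 := by ring
        _ ≤ _ := Nat.mul_le_mul_left 5 (Nat.pow_le_pow_left (by omega) 3)
    · simp; omega
    · simp; omega
  · rintro ⟨y, -, n, -, L, -, hp, ht⟩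
    obtain ⟨G, l, T, hD, rfl, hx⟩ := exists_describes_of_holds_parse x y hp
    exact ⟨n, G, l, hD.pos, ⟨T, (h _ _ _ _ _ _ hD).mp ht⟩, hx⟩

/-! ### The formulas for the eternal vertex cover problems -/

/-- The tables `2`, `3` and `4` encode relations with two arguments, kept in the slice with first
index `0`. -/
theorem Describes.cert_zero {w : List (Bool ⊕ Bool)} {n : ℕ} {G : SimpleGraph (Fin n)}
    {l : List Bool} {T : ℕ → ℕ → ℕ → ℕ → Prop} (h : Describes w G l T) {a : ℕ} (ha : a < 5)
    (j k : Fin n) : CertAt w n l.length a 0 j k ↔ T a 0 j k :=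
  h.cert a ha ⟨0, h.pos⟩ j k

namespace ATerm

/-- The formula for a connectivity certificate, with the order `cert 2 0`. -/
def connected : ATerm (Bool ⊕ Bool) :=
  let R := cert (num 2) (num 0)
  let n := var 1
  let witness := fun y => ex n (and (adj (var 5) y) (R (var 5) y))
  and (all n (all n (all n
      (imp (R (var 3) (var 4)) (imp (R (var 4) (var 5)) (R (var 3) (var 5)))))))
    (and (all n (not (R (var 3) (var 3))))
      (all n (all n (imp (not (eq (var 3) (var 4))) (or (witness (var 3)) (witness (var 4)))))))

/-- The formula for a certificate of the local connectivity of the blocks, with the relations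
`cert 0 x` and the orders `cert 1 x`. -/
def blocks : ATerm (Bool ⊕ Bool) :=
  let E := cert (num 0)
  let O := cert (num 1)
  let n := var 1
  let x := var 3
  let y := var 4
  let z := var 5
  let u := var 6
  let witness := fun y => ex n (and (adj x u) (and (adj u y) (O x u y)))
  and (all n (all n (imp (not (eq y x)) (E x y y))))
    (and (all n (all n (all n (imp (E x y z) (E x z y)))))
    (and (all n (all n (all n (all n
      (imp (not (eq u x)) (imp (E x y z) (imp (adj z u) (E x y u))))))))
    (and (all n (all n (all n (all n (imp (O x y z) (imp (O x z u) (O x y u)))))))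
    (and (all n (all n (not (O x y y))))
      (all n (all n (all n (imp (adj x y) (imp (adj x z) (imp (E x y z)
        (imp (not (eq y z)) (or (witness y) (witness z)))))))))))))

/-- The formula for a certificate of binary digits, with the digits `cert 4 0`. -/
def digits : ATerm (Bool ⊕ Bool) :=
  let D := cert (num 4) (num 0)
  let n := var 1
  and (all n (not (D (num 0) (var 3))))
    (all n (imp (lt (add (var 3) one) n) (all n (iff
      (iff (D (add (var 3) one) (var 4)) (not (D (var 3) (var 4))))
      (all (var 4) (D (var 3) (var 5)))))))

/-- The sets `cert 3 0 v` are vertex covers. -/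
def covers : ATerm (Bool ⊕ Bool) :=
  let S := cert (num 3) (num 0)
  let n := var 1
  all n (all n (all n (imp (adj (var 4) (var 5)) (or (S (var 3) (var 4)) (S (var 3) (var 5))))))

/-- The set `cert 3 0 v` contains `v`. -/
def coversSelf : ATerm (Bool ⊕ Bool) :=
  all (var 1) (cert (num 3) (num 0) (var 3) (var 3))

/-- The relation `cert 0 x` relates any two vertices other than `x`. -/
def noCut : ATerm (Bool ⊕ Bool) :=
  let n := var 1
  all n (all n (all n (imp (not (eq (var 4) (var 3))) (imp (not (eq (var 5) (var 3)))
    (cert (num 0) (var 3) (var 4) (var 5))))))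

/-- The set `cert 3 0 v` contains all `x` such that the relation `cert 0 x` does not relate any two
vertices other than `x`. -/
def coversCut : ATerm (Bool ⊕ Bool) :=
  let n := var 1
  all n (all n (all n (all n (imp (not (eq (var 5) (var 4))) (imp (not (eq (var 6) (var 4)))
    (imp (not (cert (num 0) (var 4) (var 5) (var 6))) (cert (num 3) (num 0) (var 3) (var 4))))))))

/-- The cardinality of the set `cert 3 0 v`, where `k` is the next free variable. -/
def size (v : ATerm (Bool ⊕ Bool)) (k : ℕ) : ATerm (Bool ⊕ Bool) :=
  sum (var 1) (cert (num 3) (num 0) v (var k))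

/-- The cardinalities of the sets `cert 3 0 v` are at most the number with the binary digits
`tail`. -/
def sizeLe : ATerm (Bool ⊕ Bool) :=
  let n := var 1
  all n (all n (imp (lt (var 4) (size (var 3) 5)) (not (and (lt (var 2) (add n one))
    (all n (iff (cert (num 4) (num 0) (var 4) (var 5)) (tail (var 5))))))))

section

variable {w : List (Bool ⊕ Bool)} {n : ℕ} {G : SimpleGraph (Fin n)} {l : List Bool}
  {T : ℕ → ℕ → ℕ → ℕ → Prop} (h : Describes w G l T) (N : ℕ)

include h

theorem holds_connected : Holds w connected [N, n, l.length] ↔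
    G.ConnectedCert fun i j => T 2 0 i j := by
  simp only [connected, holds_and, holds_all, holds_imp, holds_not, holds_or, holds_ex, holds_eq,
    holds_cert, holds_adj, eval, eval_num, List.cons_append, List.nil_append,
    List.getD_cons_succ, List.getD_cons_zero, forall_lt_iff_forall_fin, exists_lt_iff_exists_fin,
    h.adj, h.cert_zero (a := 2) (by norm_num), Fin.val_inj]
  rfl

theorem holds_blocks : Holds w blocks [N, n, l.length] ↔
    G.BlocksCert (fun i j k => T 0 i j k) fun i j k => T 1 i j k := by
  simp only [blocks, holds_and, holds_all, holds_imp, holds_not, holds_or, holds_ex, holds_eq,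
    holds_cert, holds_adj, eval, eval_num, List.cons_append, List.nil_append,
    List.getD_cons_succ, List.getD_cons_zero, forall_lt_iff_forall_fin, exists_lt_iff_exists_fin,
    h.adj, h.cert 0 (by norm_num), h.cert 1 (by norm_num), Fin.val_inj]
  rfl

theorem holds_digits : Holds w digits [N, n, l.length] ↔ DigitsCert n (T 4 0) := by
  simp only [digits, holds_and, holds_all, holds_imp, holds_not, holds_iff, holds_lt,
    holds_cert, eval, eval_num, List.cons_append, List.nil_append,
    List.getD_cons_succ, List.getD_cons_zero]
  have hc : ∀ {j k : ℕ}, j < n → k < n → (CertAt w n l.length 4 0 j k ↔ T 4 0 j k) :=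
    fun {j k} hj hk => h.cert_zero (by norm_num) ⟨j, hj⟩ ⟨k, hk⟩
  refine and_congr (forall₂_congr fun b hb => not_congr (hc h.pos hb))
    (forall₄_congr fun m hm hm' b => forall_congr' fun hb => iff_congr
      (iff_congr (hc hm' hb) (not_congr (hc hm hb)))
      (forall₂_congr fun b' hb' => hc hm (hb'.trans hb)))

theorem holds_covers : Holds w covers [N, n, l.length] ↔
    ∀ v : Fin n, G.IsVertexCover {i | T 3 0 v i} := by
  simp only [covers, holds_all, holds_imp, holds_or,
    holds_cert, holds_adj, eval, eval_num, List.cons_append, List.nil_append,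
    List.getD_cons_succ, List.getD_cons_zero, forall_lt_iff_forall_fin,
    h.adj, h.cert_zero (a := 3) (by norm_num)]
  rfl

theorem holds_covers_self : Holds w coversSelf [N, n, l.length] ↔ ∀ v : Fin n, T 3 0 v v := by
  simp only [coversSelf, holds_all, holds_cert, eval, eval_num, List.cons_append, List.nil_append,
    List.getD_cons_succ, List.getD_cons_zero, forall_lt_iff_forall_fin,
    h.cert_zero (a := 3) (by norm_num)]

theorem holds_no_cut : Holds w noCut [N, n, l.length] ↔
    ∀ x y z : Fin n, y ≠ x → z ≠ x → T 0 x y z := by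
  simp only [noCut, holds_all, holds_imp, holds_not, holds_eq, holds_cert, eval, eval_num,
    List.cons_append, List.nil_append, List.getD_cons_succ, List.getD_cons_zero,
    forall_lt_iff_forall_fin, h.cert 0 (by norm_num), Fin.val_inj, ne_eq]

theorem holds_covers_cut : Holds w coversCut [N, n, l.length] ↔
    ∀ v x y z : Fin n, y ≠ x → z ≠ x → ¬ T 0 x y z → T 3 0 v x := by
  simp only [coversCut, holds_all, holds_imp, holds_not, holds_eq, holds_cert, eval, eval_num,
    List.cons_append, List.nil_append, List.getD_cons_succ, List.getD_cons_zero,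
    forall_lt_iff_forall_fin, h.cert 0 (by norm_num), h.cert_zero (a := 3) (by norm_num),
    Fin.val_inj, ne_eq]

/-- The summation variable takes the next free number, which is the length of the environment; `hk`
says that `k` is this number. -/
theorem eval_size (v : ATerm (Bool ⊕ Bool)) (k : ℕ) (e : List ℕ) (hk : k = 3 + e.length)
    (i : Fin n) (hv : ∀ j, v.eval w (N :: n :: l.length :: e ++ [j]) = i) :
    (size v k).eval w (N :: n :: l.length :: e) = {j : Fin n | T 3 0 i j}.ncard := by
  classical
  have hlast : ∀ j, (var k : ATerm (Bool ⊕ Bool)).eval w (N :: n :: l.length :: e ++ [j]) = j := by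
    intro j
    subst hk
    rw [eval, List.getD_append_right _ _ _ _ (by simp; omega)]
    simp [show 3 + e.length - (e.length + 1 + 1 + 1) = 0 by omega]
  have hcert : ∀ j : ℕ, (cert (num 3) (num 0) v (var k)).eval w (N :: n :: l.length :: e ++ [j]) =
      if CertAt w n l.length 3 0 i j then 1 else 0 := by
    intro j
    have h1 := holds_cert w (num 3) (num 0) v (var k) (N :: n :: l.length :: e ++ [j])
    rw [hv, hlast, eval_num, eval_num] at h1
    by_cases hc : CertAt w n l.length 3 0 i j
    · have h2 := h1.mpr hc
      rw [if_pos hc]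
      unfold Holds cert at *
      rw [eval] at h2 ⊢
      simpa using h2
    · rw [if_neg hc]
      by_contra h2
      exact hc (h1.mp h2)
  have hn : (var 1 : ATerm (Bool ⊕ Bool)).eval w (N :: n :: l.length :: e) = n := rfl
  rw [size, eval, hn, Finset.sum_congr rfl fun j _ => hcert j, Finset.sum_range,
    Finset.sum_boole, Set.ncard_eq_toFinset_card']
  simp only [h.cert_zero (a := 3) (by norm_num), Nat.cast_id]
  congr 1
  ext
  simp

/-- A number given in binary can be too large for the value of a term. Instead of evaluating it, the
formula excludes that a number `m` below the size of a cover has these digits. -/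
theorem holds_size_le : Holds w sizeLe [N, n, l.length] ↔
    ∀ v m : Fin n, (m : ℕ) < {i : Fin n | T 3 0 v i}.ncard →
      ¬ (l.length ≤ n ∧ ∀ b : Fin n, T 4 0 m b ↔ l[(b : ℕ)]? = some true) := by
  simp only [sizeLe, holds_all, holds_imp, holds_not, holds_and, holds_iff, holds_lt, holds_cert,
    holds_tail, eval, eval_num,
    List.cons_append, List.nil_append, List.getD_cons_succ, List.getD_cons_zero,
    forall_lt_iff_forall_fin, h.cert_zero (a := 4) (by norm_num), h.tail, Nat.lt_succ_iff]
  refine forall₂_congr fun v m => ?_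
  rw [eval_size h N (var 3) 5 [v, m] rfl v fun j => rfl]

end

/-- The formula for `evc G ≤ k`, where `G` is connected and locally connected and `k` has the binary
digits `tail`. -/
def eternalCoverLe : ATerm (Bool ⊕ Bool) :=
  and connected (and (imp (lt (num 0) (var 2)) (tail (sub (var 2) one))) (and blocks (and noCut
    (and covers (and coversSelf (and digits (or (eq (var 1) one) sizeLe)))))))

/-- The formula for the oracle: the list has the digits `b`, `0` and a number `k` in unary. If `b = 0`,
each vertex is in a vertex cover of at most `k` vertices that contains all cut vertices, and if `b = 1`,
there is a vertex cover of fewer than `k` vertices. -/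
def coverQuery : ATerm (Bool ⊕ Bool) :=
  and (lt one (var 2)) (and (not (tail one))
    (and (all (var 2) (imp (lt one (var 3)) (tail (var 3)))) (and covers (or
    (and (not (tail (num 0))) (and (lt one (var 1)) (and connected (and blocks (and coversSelf
      (and coversCut (all (var 1) (lt (add (size (var 3) 4) one) (var 2)))))))))
    (and (tail (num 0)) (lt (add (add (size (num 0) 3) one) one) (var 2)))))))

section

variable {w : List (Bool ⊕ Bool)} {n : ℕ} {G : SimpleGraph (Fin n)} {l : List Bool}
  {T : ℕ → ℕ → ℕ → ℕ → Prop} (h : Describes w G l T) (N : ℕ)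

include h

theorem holds_eternalCoverLe : Holds w eternalCoverLe [N, n, l.length] ↔
    (G.ConnectedCert fun i j => T 2 0 i j) ∧
    (0 < l.length → l[l.length - 1]? = some true) ∧
    (G.BlocksCert (fun i j k => T 0 i j k) fun i j k => T 1 i j k) ∧
    (∀ x y z : Fin n, y ≠ x → z ≠ x → T 0 x y z) ∧
    (∀ v : Fin n, G.IsVertexCover {i | T 3 0 v i}) ∧
    (∀ v : Fin n, T 3 0 v v) ∧ DigitsCert n (T 4 0) ∧
    (n = 1 ∨ ∀ v m : Fin n, (m : ℕ) < {i : Fin n | T 3 0 v i}.ncard →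
      ¬ (l.length ≤ n ∧ ∀ b : Fin n, T 4 0 m b ↔ l[(b : ℕ)]? = some true)) := by
  simp only [eternalCoverLe, holds_and, holds_or, holds_imp, holds_lt, holds_eq, holds_tail,
    holds_connected h, holds_blocks h, holds_no_cut h, holds_covers h, holds_covers_self h,
    holds_digits h, holds_size_le h, eval, eval_num, List.getD_cons_succ, List.getD_cons_zero,
    h.tail]

/-- A list with the digits `b`, `0` and `k` in unary has length `k + 2`, so the two comparisons with
the length mean "at most `k`" and "less than `k`". -/
theorem holds_coverQuery : Holds w coverQuery [N, n, l.length] ↔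
    1 < l.length ∧ ¬ l[1]? = some true ∧ (∀ b < l.length, 1 < b → l[b]? = some true) ∧
    (∀ v : Fin n, G.IsVertexCover {i | T 3 0 v i}) ∧
    ((¬ l[0]? = some true ∧ 1 < n ∧
      (G.ConnectedCert fun i j => T 2 0 i j) ∧
      (G.BlocksCert (fun i j k => T 0 i j k) fun i j k => T 1 i j k) ∧
      (∀ v : Fin n, T 3 0 v v) ∧
      (∀ v x y z : Fin n, y ≠ x → z ≠ x → ¬ T 0 x y z → T 3 0 v x) ∧
      ∀ v : Fin n, {i : Fin n | T 3 0 v i}.ncard + 1 < l.length) ∨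
    (l[0]? = some true ∧ {i : Fin n | T 3 0 0 i}.ncard + 1 + 1 < l.length)) := by
  have h0 := eval_size h N (num 0) 3 [] rfl ⟨0, h.pos⟩ fun j => eval_num _ _ _
  have h1 : ∀ v : Fin n, (size (var 3) 4).eval w [N, n, l.length, v] = _ := fun v =>
    eval_size h N (var 3) 4 [v] rfl v fun j => rfl
  simp only [coverQuery, holds_and, holds_or, holds_imp, holds_lt, holds_not, holds_tail, holds_all,
    holds_connected h, holds_blocks h, holds_covers h, holds_covers_self h,
    holds_covers_cut h, eval, eval_num, List.getD_cons_succ, List.getD_cons_zero,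
    List.cons_append, List.nil_append, h.tail, h0]
  rw [forall_lt_iff_forall_fin (n := n)]
  simp only [h1]

end

end ATerm

theorem exists_certificate {n : ℕ} (E O : Fin n → Fin n → Fin n → Prop) (R S : Fin n → Fin n → Prop)
    (D : ℕ → ℕ → Prop) : ∃ T : ℕ → ℕ → ℕ → ℕ → Prop,
      (∀ i j k : Fin n, T 0 i j k ↔ E i j k) ∧ (∀ i j k : Fin n, T 1 i j k ↔ O i j k) ∧
      (∀ j k : Fin n, T 2 0 j k ↔ R j k) ∧ (∀ j k : Fin n, T 3 0 j k ↔ S j k) ∧ T 4 0 = D := by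
  refine ⟨fun a i j k => match a with
    | 0 => ∃ x y z : Fin n, (x : ℕ) = i ∧ (y : ℕ) = j ∧ (z : ℕ) = k ∧ E x y z
    | 1 => ∃ x y z : Fin n, (x : ℕ) = i ∧ (y : ℕ) = j ∧ (z : ℕ) = k ∧ O x y z
    | 2 => ∃ y z : Fin n, (y : ℕ) = j ∧ (z : ℕ) = k ∧ R y z
    | 3 => ∃ y z : Fin n, (y : ℕ) = j ∧ (z : ℕ) = k ∧ S y z
    | _ => D j k, ?_, ?_, ?_, ?_, rfl⟩ <;> intros <;> simp [Fin.val_inj]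

/-! ### The two languages -/

theorem Nat.getElem?_bits_eq_some_true_iff (k b : ℕ) :
    k.bits[b]? = some true ↔ k.testBit b = true := by
  rw [Nat.testBit_eq_inth, List.getI_eq_getElem?_getD]
  rcases k.bits[b]? with _ | _ | _ <;> simp

theorem Nat.lt_length_bits_iff (k n : ℕ) : k.bits.length ≤ n ↔ k < 2 ^ n := by
  rw [Nat.size_eq_bits_len, Nat.size_le]

theorem exists_eq_bits_iff_getElem? (l : List Bool) :
    (∃ k : ℕ, l = k.bits) ↔ (0 < l.length → l[l.length - 1]? = some true) := by
  rw [Nat.eq_bits_iff, List.length_pos_iff]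
  refine forall_congr' fun h => ?_
  rw [← List.getLast?_eq_getElem?, List.getLast?_eq_getLast_of_ne_nil h, Option.some.injEq]

/-- The alternative `n = 1` is needed because the cover through a single vertex has size one,
whereas no guard is needed. -/
theorem eternalVertexCoverNum_le_bits_iff {n : ℕ} (hn : 0 < n) (G : SimpleGraph (Fin n))
    (l : List Bool) :
    (∃ T : ℕ → ℕ → ℕ → ℕ → Prop, (G.ConnectedCert fun i j => T 2 0 i j) ∧
      (0 < l.length → l[l.length - 1]? = some true) ∧
      (G.BlocksCert (fun i j k => T 0 i j k) fun i j k => T 1 i j k) ∧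
      (∀ x y z : Fin n, y ≠ x → z ≠ x → T 0 x y z) ∧
      (∀ v : Fin n, G.IsVertexCover {i | T 3 0 v i}) ∧
      (∀ v : Fin n, T 3 0 v v) ∧ DigitsCert n (T 4 0) ∧
      (n = 1 ∨ ∀ v m : Fin n, (m : ℕ) < {i : Fin n | T 3 0 v i}.ncard →
        ¬ (l.length ≤ n ∧ ∀ b : Fin n, T 4 0 m b ↔ l[(b : ℕ)]? = some true))) ↔
    ∃ k : ℕ, G.Connected ∧ G.IsLocallyConnected ∧ G.eternalVertexCoverNum ≤ k ∧ l = k.bits := by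
  have : Nonempty (Fin n) := ⟨⟨0, hn⟩⟩
  constructor
  · rintro ⟨T, hR, hl, hB, hcut, hcov, hself, hD, hS⟩
    have hpre : G.Preconnected := SimpleGraph.preconnected_iff_exists_connectedCert.mpr ⟨_, hR⟩
    have hG : G.Connected := ⟨hpre⟩
    have hloc : G.IsLocallyConnected := by
      refine hG.isLocallyConnected_iff.mpr ⟨hB.hasLocallyConnectedBlocks, fun v hv => ?_⟩
      obtain ⟨y, z, hy, hz, hE⟩ := (hB.isCutVertex_iff hpre).mp hv
      exact hE (hcut v y z hy hz)
    obtain ⟨k, rfl⟩ := (exists_eq_bits_iff_getElem? l).mpr hl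
    refine ⟨k, hG, hloc, ?_, rfl⟩
    rcases hS with rfl | hS
    · rw [SimpleGraph.eternalVertexCoverNum_of_subsingleton]
      exact bot_le
    · by_cases h1 : n = 1
      · subst h1
        rw [SimpleGraph.eternalVertexCoverNum_of_subsingleton]
        exact bot_le
      have : Nontrivial (Fin n) := Fin.nontrivial_iff_two_le.mpr (by omega)
      rw [hloc.eternalVertexCoverNum_le_iff hG]
      refine fun v => ⟨_, hcov v, hself v, ?_⟩
      rw [← Set.Finite.cast_ncard_eq (Set.toFinite _), Nat.cast_le]
      by_contra hlt
      have hle := Set.ncard_le_card {i : Fin n | T 3 0 v i}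
      rw [Nat.card_eq_fintype_card, Fintype.card_fin] at hle
      -- A cover has at most `n` vertices, so a bound exceeded by it is below `n` and its digits
      -- occur in the table.
      have hk : k < n := by omega
      refine hS v ⟨k, hk⟩ (by simpa using hlt) ⟨?_, fun b => ?_⟩
      · exact (Nat.lt_length_bits_iff k n).mpr (hk.trans Nat.lt_two_pow_self)
      · rw [Nat.getElem?_bits_eq_some_true_iff]
        exact hD.iff_testBit k hk b b.2
  · rintro ⟨k, hG, hloc, hle, rfl⟩
    obtain ⟨hB, hcut⟩ := hG.isLocallyConnected_iff.mp hloc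
    obtain ⟨R, hR⟩ := SimpleGraph.preconnected_iff_exists_connectedCert.mp hG.preconnected
    obtain ⟨E, O, hEO⟩ := hB.exists_blocksCert
    obtain ⟨S, hS, hSv, hSk⟩ : ∃ S : Fin n → Set (Fin n), (∀ v, G.IsVertexCover (S v)) ∧
        (∀ v, v ∈ S v) ∧ (n = 1 ∨ ∀ v, (S v).encard ≤ k) := by
      by_cases h1 : n = 1
      · exact ⟨fun _ => Set.univ, fun v a b _ => .inl trivial, fun v => trivial, .inl h1⟩
      · have : Nontrivial (Fin n) := Fin.nontrivial_iff_two_le.mpr (by omega)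
        choose S h2 h3 h4 using (hloc.eternalVertexCoverNum_le_iff hG).mp hle
        exact ⟨S, h2, h3, .inr h4⟩
    obtain ⟨T, h0, h1, h2, h3, h4⟩ := exists_certificate E O R (fun v i => i ∈ S v)
      fun m b => m.testBit b = true
    refine ⟨T, ?_⟩
    simp only [h0, h1, h2, h3, h4, Set.ofPred_mem_eq]
    refine ⟨hR, (exists_eq_bits_iff_getElem? _).mp ⟨k, rfl⟩, hEO, fun x y z hy hz => ?_, hS, hSv,
      digitsCert_testBit n, hSk.imp_right fun hSk v m hm ⟨hlen, hb⟩ => ?_⟩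
    · by_contra hE
      exact hcut x ((hEO.isCutVertex_iff hG.preconnected).mpr ⟨y, z, hy, hz, hE⟩)
    · have hmk : (m : ℕ) = k := by
        apply Nat.eq_of_testBit_eq
        intro b
        by_cases hbn : b < n
        · have := hb ⟨b, hbn⟩
          rw [Nat.getElem?_bits_eq_some_true_iff] at this
          exact Bool.eq_iff_iff.mpr this
        -- From the position `n` on, the digits of both numbers vanish, as both are below `2 ^ n`.
        · have hpow : 2 ^ n ≤ 2 ^ b := Nat.pow_le_pow_right (by norm_num) (by omega)
          rw [Nat.testBit_lt_two_pow (m.2.trans (Nat.lt_two_pow_self.trans_le hpow)),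
            Nat.testBit_lt_two_pow (((Nat.lt_length_bits_iff k n).mp hlen).trans_le hpow)]
      have := hSk v
      rw [← Set.Finite.cast_ncard_eq (Set.toFinite _), Nat.cast_le] at this
      omega

theorem inNP_eternalVertexCoverNum_le :
    InNP {w | ∃ (n : ℕ) (G : SimpleGraph (Fin n)) (k : ℕ), G.Connected ∧ G.IsLocallyConnected ∧
      G.eternalVertexCoverNum ≤ k ∧ w = encodeGraphNat G k} := by
  convert inNP_of_holds ATerm.eternalCoverLe _ fun w N n G l T h =>
    ATerm.holds_eternalCoverLe h N using 1
  ext w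
  constructor
  · rintro ⟨n, G, k, hG, hl, hk, rfl⟩
    have hn : 0 < n := Fin.pos_iff_nonempty.mpr hG.nonempty
    exact ⟨n, G, k.bits, hn, (eternalVertexCoverNum_le_bits_iff hn G _).mpr ⟨k, hG, hl, hk, rfl⟩,
      rfl⟩
  · rintro ⟨n, G, l, hn, hT, rfl⟩
    obtain ⟨k, hG, hl, hk, rfl⟩ := (eternalVertexCoverNum_le_bits_iff hn G _).mp hT
    exact ⟨n, G, k, hG, hl, hk, rfl⟩

/-- The predicate that is expressed by `ATerm.coverQuery`. -/
def CoverQuery (n : ℕ) (G : SimpleGraph (Fin n)) (l : List Bool) (T : ℕ → ℕ → ℕ → ℕ → Prop) :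
    Prop :=
  1 < l.length ∧ ¬ l[1]? = some true ∧ (∀ b < l.length, 1 < b → l[b]? = some true) ∧
    (∀ v : Fin n, G.IsVertexCover {i | T 3 0 v i}) ∧
    ((¬ l[0]? = some true ∧ 1 < n ∧
      (G.ConnectedCert fun i j => T 2 0 i j) ∧
      (G.BlocksCert (fun i j k => T 0 i j k) fun i j k => T 1 i j k) ∧
      (∀ v : Fin n, T 3 0 v v) ∧
      (∀ v x y z : Fin n, y ≠ x → z ≠ x → ¬ T 0 x y z → T 3 0 v x) ∧
      ∀ v : Fin n, {i : Fin n | T 3 0 v i}.ncard + 1 < l.length) ∨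
    (l[0]? = some true ∧ {i : Fin n | T 3 0 0 i}.ncard + 1 + 1 < l.length))

theorem CoverQuery.exists_eq {n : ℕ} {G : SimpleGraph (Fin n)} {l : List Bool}
    {T : ℕ → ℕ → ℕ → ℕ → Prop} (h : CoverQuery n G l T) :
    ∃ b k, l = b :: false :: List.replicate k true := by
  obtain ⟨h1, h2, h3, -⟩ := h
  rcases l with _ | ⟨b, _ | ⟨c, l⟩⟩
  · simp at h1
  · simp at h1
  · obtain rfl : c = false := by simpa using h2
    refine ⟨b, l.length, ?_⟩
    congr 2
    rw [List.eq_replicate_iff]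
    refine ⟨rfl, fun a ha => ?_⟩
    obtain ⟨i, hi, rfl⟩ := List.mem_iff_getElem.mp ha
    simpa [hi] using h3 (i + 2) (by simpa using hi) (by omega)

/-- The oracle for the decision whether `evc G = mvc G`. -/
def coverOracle : Set (List Bool) :=
  {x | ∃ (n : ℕ) (G : SimpleGraph (Fin n)) (l : List Bool), 0 < n ∧ (∃ T, CoverQuery n G l T) ∧
    x = encodeGraph G ++ l}

theorem inNP_coverOracle : InNP coverOracle :=
  inNP_of_holds ATerm.coverQuery CoverQuery fun _ N _ _ _ _ h => ATerm.holds_coverQuery h N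

theorem getElem?_cons_false_replicate {c : Bool} {k b : ℕ}
    (hb : b < (c :: false :: List.replicate k true).length) (h : 1 < b) :
    (c :: false :: List.replicate k true)[b]? = some true := by
  obtain ⟨b, rfl⟩ : ∃ d, b = d + 2 := ⟨b - 2, by omega⟩
  have hb' : b < k := by simpa using hb
  simp [hb']

theorem exists_coverQuery_false_iff {n : ℕ} (hn : 0 < n) (G : SimpleGraph (Fin n)) (k : ℕ) :
    (∃ T, CoverQuery n G (false :: false :: List.replicate k true) T) ↔
      1 < n ∧ G.Connected ∧ G.HasLocallyConnectedBlocks ∧ ∀ v, ∃ S : Set (Fin n),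
        G.IsVertexCover S ∧ v ∈ S ∧ (∀ x, G.IsCutVertex x → x ∈ S) ∧ S.encard ≤ k := by
  have : Nonempty (Fin n) := ⟨⟨0, hn⟩⟩
  constructor
  · rintro ⟨T, -, -, -, hcov, ⟨-, h1, hR, hB, hself, hcut, hcard⟩ | ⟨h, -⟩⟩
    · have hpre : G.Preconnected := SimpleGraph.preconnected_iff_exists_connectedCert.mpr ⟨_, hR⟩
      refine ⟨h1, ⟨hpre⟩, hB.hasLocallyConnectedBlocks, fun v => ⟨_, hcov v, hself v,
        fun x hx => ?_, ?_⟩⟩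
      · obtain ⟨y, z, hy, hz, hE⟩ := (hB.isCutVertex_iff hpre).mp hx
        exact hcut v x y z hy hz hE
      · rw [← Set.Finite.cast_ncard_eq (Set.toFinite _), Nat.cast_le]
        have := hcard v
        simp at this
        omega
    · simp at h
  · rintro ⟨h1, hG, hB, hS⟩
    choose S hS hSv hSx hSk using hS
    obtain ⟨R, hR⟩ := SimpleGraph.preconnected_iff_exists_connectedCert.mp hG.preconnected
    obtain ⟨E, O, hEO⟩ := hB.exists_blocksCert
    obtain ⟨T, h0, h1', h2, h3, -⟩ := exists_certificate E O R (fun v i => i ∈ S v)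
      fun _ _ => True
    refine ⟨T, ?_⟩
    simp only [CoverQuery, h0, h1', h2, h3, Set.ofPred_mem_eq]
    refine ⟨by simp, by simp, fun b hb hb0 => ?_, hS, .inl ⟨by simp, h1, hR, hEO, hSv,
      fun v x y z hy hz hE => hSx v x ?_, fun v => ?_⟩⟩
    · exact getElem?_cons_false_replicate hb hb0
    · exact (hEO.isCutVertex_iff hG.preconnected).mpr ⟨y, z, hy, hz, hE⟩
    · have := hSk v
      rw [← Set.Finite.cast_ncard_eq (Set.toFinite _), Nat.cast_le] at this
      simp
      omega

theorem exists_coverQuery_true_iff {n : ℕ} (hn : 0 < n) (G : SimpleGraph (Fin n)) (k : ℕ) :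
    (∃ T, CoverQuery n G (true :: false :: List.replicate k true) T) ↔ G.vertexCoverNum < k := by
  constructor
  · rintro ⟨T, -, -, -, hcov, ⟨h, -⟩ | ⟨-, h⟩⟩
    · simp at h
    · refine (hcov ⟨0, hn⟩).vertexCoverNum_le.trans_lt ?_
      rw [← Set.Finite.cast_ncard_eq (Set.toFinite _), Nat.cast_lt]
      simp at h
      exact h
  · intro h
    obtain ⟨S, hSc, hS⟩ := G.vertexCoverNum_exists
    obtain ⟨T, -, -, -, h3, -⟩ := exists_certificate (n := n) (fun _ _ _ => True)
      (fun _ _ _ => True) (fun _ _ => True) (fun _ i => i ∈ S) fun _ _ => True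
    refine ⟨T, ?_⟩
    have h3' := h3 ⟨0, hn⟩
    simp only at h3'
    simp only [CoverQuery, h3, h3', Set.ofPred_mem_eq]
    refine ⟨by simp, by simp, fun b hb hb0 => getElem?_cons_false_replicate hb hb0, fun _ => hS,
      .inr ⟨by simp, ?_⟩⟩
    rw [← hSc, ← Set.Finite.cast_ncard_eq (Set.toFinite _), Nat.cast_lt] at h
    simpa using h

/-- The last `false` marks where the unary number starts. -/
theorem append_false_replicate_inj {a b : List Bool} {k m : ℕ}
    (h : a ++ false :: List.replicate k true = b ++ false :: List.replicate m true) :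
    a = b ∧ k = m := by
  have aux : ∀ (k m : ℕ) (a b : List Bool),
      List.replicate k true ++ false :: a = List.replicate m true ++ false :: b →
        a = b ∧ k = m := by
    intro k
    induction k with
    | zero =>
      rintro (_ | m) a b h
      · simpa using h
      · simp [List.replicate_succ] at h
    | succ k ih =>
      rintro (_ | m) a b h
      · simp [List.replicate_succ] at h
      · obtain ⟨h1, h2⟩ := ih m a b (by simpa [List.replicate_succ] using h)
        exact ⟨h1, by rw [h2]⟩
  have := aux k m a.reverse b.reverse (by simpa using congrArg List.reverse h)
  simpa using this

/-- A query is read from its end, where the unary number and `b` are determined; hence `w` must be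
exactly the code of the graph. -/
theorem append_mem_coverOracle_iff (w : List Bool) (b : Bool) (k : ℕ) :
    w ++ b :: false :: List.replicate k true ∈ coverOracle ↔
      ∃ (n : ℕ) (G : SimpleGraph (Fin n)), 0 < n ∧
        (∃ T, CoverQuery n G (b :: false :: List.replicate k true) T) ∧ w = encodeGraph G := by
  constructor
  · rintro ⟨n, G, l, hn, ⟨T, hT⟩, h⟩
    obtain ⟨c, m, rfl⟩ := hT.exists_eq
    obtain ⟨h1, rfl⟩ := append_false_replicate_inj (a := w ++ [b]) (b := encodeGraph G ++ [c])
      (by simpa using h)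
    obtain ⟨rfl, h2⟩ := List.append_inj' h1 rfl
    obtain rfl : b = c := by simpa using h2
    exact ⟨n, G, hn, ⟨T, hT⟩, rfl⟩
  · rintro ⟨n, G, hn, hT, rfl⟩
    exact ⟨n, G, _, hn, hT, rfl⟩

theorem append_true_mem_coverOracle_iff {n : ℕ} (hn : 0 < n) (G : SimpleGraph (Fin n)) (k : ℕ) :
    encodeGraph G ++ true :: false :: List.replicate k true ∈ coverOracle ↔
      G.vertexCoverNum < k := by
  rw [append_mem_coverOracle_iff, ← exists_coverQuery_true_iff hn]
  constructor
  · rintro ⟨n', G', -, hT, h⟩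
    obtain ⟨rfl, rfl, -⟩ := encodeGraph_append_injective (l := []) (l' := []) (by simpa using h)
    exact hT
  · exact fun hT => ⟨n, G, hn, hT, rfl⟩

theorem inPNP_eternalVertexCoverNum_eq :
    InPNP {w | ∃ (n : ℕ) (G : SimpleGraph (Fin n)), 2 ≤ n ∧ G.Connected ∧
      G.HasLocallyConnectedBlocks ∧ G.eternalVertexCoverNum = G.vertexCoverNum ∧
      w = encodeGraph G} := by
  refine ⟨coverOracle, inNP_coverOracle, ?_⟩
  convert inPWithOracle_of_two_queries coverOracle using 1
  ext w
  constructor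
  · rintro ⟨n, G, hn, hG, hB, heq, rfl⟩
    have : Nontrivial (Fin n) := Fin.nontrivial_iff_two_le.mpr hn
    obtain ⟨k, hk⟩ := ENat.ne_top_iff_exists.mp G.vertexCoverNum_ne_top_of_finite
    -- The search succeeds at the vertex cover number, which is at most `n` and so within its range.
    refine ⟨k, ?_, ?_, ?_⟩
    · have hlt := G.vertexCoverNum_le_card_sub_one.trans tsub_le_self
      rw [← hk, ENat.card_eq_coe_natCard, Nat.cast_le, Nat.card_eq_fintype_card,
        Fintype.card_fin] at hlt
      rw [length_encodeGraph]
      omega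
    · rw [append_mem_coverOracle_iff]
      refine ⟨n, G, by omega, (exists_coverQuery_false_iff (by omega) G k).mpr
        ⟨hn, hG, hB, fun v => ?_⟩, rfl⟩
      obtain ⟨S, hS, hv, hx⟩ := (hB.eternalVertexCoverNum_eq_iff_forall hG).mp heq v
      exact ⟨S, hS.1, hv, hx, by rw [hS.2, hk]⟩
    · rw [append_true_mem_coverOracle_iff (by omega), hk]
      exact lt_irrefl _
  · rintro ⟨k, -, h1, h2⟩
    obtain ⟨n, G, hn, hT, rfl⟩ := (append_mem_coverOracle_iff w false k).mp h1
    obtain ⟨hn', hG, hB, hS⟩ := (exists_coverQuery_false_iff hn G k).mp hT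
    -- The answer "no" gives `k ≤ mvc`, so the covers of size at most `k` from the first query are
    -- minimum covers.
    rw [append_true_mem_coverOracle_iff hn, not_lt] at h2
    have : Nontrivial (Fin n) := Fin.nontrivial_iff_two_le.mpr hn'
    refine ⟨n, G, hn', hG, hB, (hB.eternalVertexCoverNum_eq_iff_forall hG).mpr fun v => ?_, rfl⟩
    obtain ⟨S, hS, hv, hx, hk⟩ := hS v
    exact ⟨S, ⟨hS, le_antisymm (hk.trans h2) hS.vertexCoverNum_le⟩, hv, hx⟩

theorem mainTheorem5 :
    (∀ (V : Type*) [Finite V] (G : SimpleGraph V), G.Connected → G.IsLocallyConnected →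
      G.eternalVertexCoverNum = G.vertexCoverNum ∨
        G.eternalVertexCoverNum = G.vertexCoverNum + 1) ∧
    InNP {w | ∃ (n : ℕ) (G : SimpleGraph (Fin n)) (k : ℕ), G.Connected ∧ G.IsLocallyConnected ∧
      G.eternalVertexCoverNum ≤ k ∧ w = encodeGraphNat G k} ∧
    (∀ (V : Type*) [Finite V] [Nontrivial V] (G : SimpleGraph V), G.Connected →
      G.HasLocallyConnectedBlocks →
      (G.eternalVertexCoverNum = G.vertexCoverNum ↔
        ∀ v : V, ¬ G.IsCutVertex v →
          ∃ S : Set V, G.IsMinimumVertexCover S ∧ v ∈ S ∧ ∀ x : V, G.IsCutVertex x → x ∈ S)) ∧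
    InPNP {w | ∃ (n : ℕ) (G : SimpleGraph (Fin n)), 2 ≤ n ∧ G.Connected ∧
      G.HasLocallyConnectedBlocks ∧ G.eternalVertexCoverNum = G.vertexCoverNum ∧
      w = encodeGraph G} := by
  exact ⟨fun V _ G hG hl => hl.eternalVertexCoverNum_eq_or hG, inNP_eternalVertexCoverNum_le,
    fun V _ _ G hG hB => hB.eternalVertexCoverNum_eq_iff hG, inPNP_eternalVertexCoverNum_eq⟩
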